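/- **Setting.** Let $n\ge 1$. $\mathbb R_n$ is the real Clifford algebra with units $e_1,\dots,e_n$, $e_ie_j+e_je_i=-2\delta_{ij}$, basis $e_A$ ($A\subseteq\{1,\dots,n\}$) and norm $|\sum_A x_Ae_A|^2=\sum_A x_A^2$; $x\in\mathbb R^{n+1}$ is identified with $x_0+\sum_j x_je_j\in\mathbb R_n$, and $\operatorname{Re}[x]=x_0$, $\bar x=x_0-\sum_j x_je_j$. $\mathbb S$ is the set of unit $1$-vectors $I=\sum_j I_je_j$, and $L_I=\mathbb R+I\mathbb R$, identified with $\mathbb C$ by $u+Iv\leftrightarrow u+iv$. A real differentiable $f:W\to\mathbb R_n$ on an open $W\subseteq\mathbb R^{n+1}$ is *s-monogenic* if $\frac12(\partial_u+I\partial_v)f(u+Iv)=0$ on $W\cap L_I$ for every $I\in\mathbb S$. For $A\subseteq\mathbb R^{n+1}$ put $\operatorname{circ}(A)=\bigcup_{u+vI\in A}(u+vS^n)$, where $S^n$ is the unit sphere of $\mathbb R^{n+1}$. Let $V$ be a real Banach space, $V_n=V\otimes\mathbb R_n$ with $\|\sum_A v_Ae_A\|^2=\sum_A\|v_A\|^2$.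 $\mathcal B_n(V_n)$ is the set of operators $T=\sum_A T_Ae_A$, $T_A\in\mathcal B(V)$, acting by $T(v)=\sum_{A,B}T_A(v_B)e_Ae_B$, with norm $\|T\|^2=\sum_A\|T_A\|^2$; it is a right $\mathbb R_n$-module by $Ta=\sum_A T_Ae_Aa$. $\mathcal B^1_n(V_n)$ consists of the operators $T=\sum_{j=1}^nT_je_j$. The $S$-spectrum $\sigma_S(T)$ is the set of $s\in\mathbb R^{n+1}$ for which $T^2-2\operatorname{Re}[s]T+|s|^2\mathcal I$ is not invertible; for the other $s$, $S^{-1}(s,T)=-(T^2-2\operatorname{Re}[s]T+|s|^2\mathcal I)^{-1}(T-\bar s\mathcal I)$. An open set $U\subseteq\mathbb R^{n+1}$ is *admissible* for $T$ if it contains $\operatorname{circ}(\sigma_S(T))$ and, for every $I\in\mathbb S$, $\partial(U\cap L_I)$ (boundary in $L_I$) is the union of finitely many rectifiable Jordan curves which form the positively oriented boundary of $U_I=U\cap L_I$: their total winding number is $1$ around the points of $U_I$ and $0$ around the points of $L_I\setminus\overline{U_I}$. $\mathcal M_{\sigma_S(T)}$ is the set of functions $f$ that are s-monogenic on an open neighbourhood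 of $\overline U$ for some $U$ admissible for $T$. For such $f$, $U$ and $I\in\mathbb S$, with $ds_I=-ds\,I$, put $$f(T)=\frac1{2\pi}\int_{\partial U_I}S^{-1}(s,T)\,ds_I\,f(s).$$ **Theorem.** Let $T=\sum_{j=1}^nT_je_j\in\mathcal B^1_n(V_n)$. For $f\in\mathcal M_{\sigma_S(T)}$ the integral converges, and $f(T)$ belongs to $\mathcal B_n(V_n)$ and does not depend on $U$, on $I$ or on the parametrization of $\partial U_I$. Moreover: 1. (Consistency with the Riesz–Dunford calculus.) Let $n=1$. Let the complex Banach space $X=V\oplus iV$ be any complexification of $V$ (with continuous inclusion of $V$) and $A$ the bounded complex-linear extension of $T_1$ to $X$; identify $V_1$ with $X$, and $\mathbb R^2$ and $\mathbb R_1$ with $\mathbb C$, through $e_1\leftrightarrow i$. Let $F$ be a complex function with $\tilde f(z):=F(-ze_1)\in\mathcal M_{\sigma_S(T)}$. Then $\tilde f(T)=F(A):=\frac1{2\pi i}\int_{\partial D}F(z)(z-A)^{-1}dz$ for every open $D\supseteq\sigma(A)$ such that $F$ is holomorphic on a neighbourhood of $\overline D$ and $\partial D$ is positively oriented and made of finitely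 many rectifiable Jordan curves as above. 2. (Right module homomorphism.) If $f,g\in\mathcal M_{\sigma_S(T)}$ and $a,b\in\mathbb R_n$, then $fa+gb\in\mathcal M_{\sigma_S(T)}$ and $(fa+gb)(T)=f(T)a+g(T)b$. 3. (Product.) If, on an open set containing $\operatorname{circ}(\sigma_S(T))$, $f(x)=\sum_{k\ge0}x^ka_k$ and $g(x)=\sum_{k\ge0}x^kb_k$ with $a_k,b_k\in\mathbb R$, then $f,g,fg\in\mathcal M_{\sigma_S(T)}$ and $(fg)(T)=f(T)g(T)$. 4. (Continuity in $(T,f)$.) Let $f$ be s-monogenic on an open set $W\supseteq\operatorname{circ}(\sigma_S(T))$. For every $\varepsilon>0$ there are $\delta>0$ and a compact $K\subseteq W$ such that every $T'\in\mathcal B^1_n(V_n)$ with $\|T'-T\|<\delta$ satisfies $\operatorname{circ}(\sigma_S(T'))\subseteq W$, and every $g$ that is s-monogenic on $W$ with $|g-f|<\delta$ on $K$ satisfies $g\in\mathcal M_{\sigma_S(T')}$ and $\|g(T')-f(T)\|<\varepsilon$. -/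

import Mathlib

open scoped NNReal

noncomputable section

namespace SliceCalc

/-! ### The real Clifford algebra `ℝₙ` -/

/-- The sign in `e_A e_B = ± e_{A ∆ B}`: moving every `e_b` of `e_B` to its place in `e_A` gives a
factor `-1` for every pair `a > b`, and `e_a e_a = -1` gives one for every pair `a = b`. -/
def sgn {n : ℕ} (A B : Finset (Fin n)) : ℝ := ∏ a ∈ A, ∏ b ∈ B, if b ≤ a then (-1 : ℝ) else 1

/-- The underlying Euclidean space of `ℝₙ`: the coefficients `x_A` of `∑_A x_A e_A`. -/
def Cl (n : ℕ) : Type := EuclideanSpace ℝ (Finset (Fin n))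

namespace Cl

variable {n : ℕ}

instance : NormedAddCommGroup (Cl n) :=
  inferInstanceAs (NormedAddCommGroup (EuclideanSpace ℝ (Finset (Fin n))))

instance : NormedSpace ℝ (Cl n) :=
  inferInstanceAs (NormedSpace ℝ (EuclideanSpace ℝ (Finset (Fin n))))

instance : FiniteDimensional ℝ (Cl n) :=
  inferInstanceAs (FiniteDimensional ℝ (EuclideanSpace ℝ (Finset (Fin n))))

/-- The coefficient `x_A`. -/
def coeff (x : Cl n) (A : Finset (Fin n)) : ℝ := WithLp.ofLp (show EuclideanSpace ℝ _ from x) A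

/-- The element `∑_A x_A e_A`. -/
def mk (x : Finset (Fin n) → ℝ) : Cl n := show EuclideanSpace ℝ _ from WithLp.toLp 2 x

@[simp] lemma coeff_mk (x : Finset (Fin n) → ℝ) (A : Finset (Fin n)) : (mk x).coeff A = x A := rfl
@[simp] lemma coeff_add (x y : Cl n) (A : Finset (Fin n)) :
    (x + y).coeff A = x.coeff A + y.coeff A := rfl
@[simp] lemma coeff_zero (A : Finset (Fin n)) : (0 : Cl n).coeff A = 0 := rfl
@[simp] lemma coeff_smul (r : ℝ) (x : Cl n) (A : Finset (Fin n)) :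
    (r • x).coeff A = r * x.coeff A := rfl

@[ext] lemma ext {x y : Cl n} (h : ∀ A, x.coeff A = y.coeff A) : x = y :=
  WithLp.ofLp_injective 2 (funext h)

lemma prod_symmDiff {ι : Type*} [DecidableEq ι] (g : ι → ℝ) (hg : ∀ i, g i * g i = 1)
    (A B : Finset ι) : ∏ a ∈ symmDiff A B, g a = (∏ a ∈ A, g a) * ∏ a ∈ B, g a := by
  have hI : (∏ a ∈ A ∩ B, g a) * (∏ a ∈ A ∩ B, g a) = 1 := by
    rw [← Finset.prod_mul_distrib]; exact Finset.prod_eq_one fun i _ => hg i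
  have hA : (∏ a ∈ A ∩ B, g a) * (∏ a ∈ A \ B, g a) = ∏ a ∈ A, g a :=
    Finset.prod_inter_mul_prod_sdiff A B g
  have hB : (∏ a ∈ A ∩ B, g a) * (∏ a ∈ B \ A, g a) = ∏ a ∈ B, g a := by
    rw [Finset.inter_comm]; exact Finset.prod_inter_mul_prod_sdiff B A g
  have hd : Disjoint (A \ B) (B \ A) := disjoint_sdiff_sdiff
  rw [show symmDiff A B = (A \ B) ∪ (B \ A) from rfl, Finset.prod_union hd, ← hA, ← hB]
  linear_combination (-(∏ a ∈ A \ B, g a) * ∏ a ∈ B \ A, g a) * hI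

lemma sgn_symmDiff_left (A B C : Finset (Fin n)) :
    sgn (symmDiff A B) C = sgn A C * sgn B C := by
  refine prod_symmDiff _ (fun i => ?_) A B
  rw [← Finset.prod_mul_distrib]
  exact Finset.prod_eq_one fun b _ => by split_ifs <;> norm_num

lemma sgn_symmDiff_right (A B C : Finset (Fin n)) :
    sgn A (symmDiff B C) = sgn A B * sgn A C := by
  unfold sgn
  rw [← Finset.prod_mul_distrib]
  refine Finset.prod_congr rfl fun a _ => prod_symmDiff _ (fun i => ?_) B C
  split_ifs <;> norm_num

@[simp] lemma sgn_empty_left (A : Finset (Fin n)) : sgn ∅ A = 1 := by simp [sgn]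
@[simp] lemma sgn_empty_right (A : Finset (Fin n)) : sgn A ∅ = 1 := by simp [sgn]

/-- The product determined by bilinearity and `e_A e_B = sgn A B • e_{A ∆ B}`. -/
instance : Mul (Cl n) where
  mul x y := mk fun C => ∑ A, sgn A (symmDiff A C) * (x.coeff A * y.coeff (symmDiff A C))

instance : One (Cl n) where
  one := mk fun A => if A = ∅ then 1 else 0

lemma coeff_mul (x y : Cl n) (C : Finset (Fin n)) :
    (x * y).coeff C = ∑ A, sgn A (symmDiff A C) * (x.coeff A * y.coeff (symmDiff A C)) := rfl

lemma coeff_one (A : Finset (Fin n)) : (1 : Cl n).coeff A = if A = ∅ then 1 else 0 := rfl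

protected lemma mul_assoc' (x y z : Cl n) : x * y * z = x * (y * z) := by
  ext D
  simp only [coeff_mul, Finset.mul_sum, Finset.sum_mul]
  rw [Finset.sum_comm]
  refine Finset.sum_congr rfl fun A _ => ?_
  refine Fintype.sum_equiv ⟨fun C => symmDiff A C, fun C => symmDiff A C,
    fun C => symmDiff_symmDiff_cancel_left A C, fun C => symmDiff_symmDiff_cancel_left A C⟩ _ _
    fun C => ?_
  change _ = sgn A (symmDiff A D) * (x.coeff A * (sgn (symmDiff A C) (symmDiff (symmDiff A C)
    (symmDiff A D)) * (y.coeff (symmDiff A C) * z.coeff (symmDiff (symmDiff A C) (symmDiff A D)))))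
  have h1 : symmDiff (symmDiff A C) (symmDiff A D) = symmDiff C D := by
    rw [symmDiff_symmDiff_symmDiff_comm]; simp
  have h2 : sgn C (symmDiff C D) = sgn A (symmDiff C D) * sgn (symmDiff A C) (symmDiff C D) := by
    rw [← sgn_symmDiff_left]; simp
  have h3 : sgn A (symmDiff A D) = sgn A (symmDiff A C) * sgn A (symmDiff C D) := by
    rw [← sgn_symmDiff_right, symmDiff_assoc, symmDiff_symmDiff_cancel_left]
  rw [h1, h2, h3]
  ring

instance : Ring (Cl n) where
  __ := (inferInstance : AddCommGroup (Cl n))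
  left_distrib x y z := by
    ext C; simp only [coeff_mul, coeff_add, ← Finset.sum_add_distrib]
    exact Finset.sum_congr rfl fun _ _ => by ring
  right_distrib x y z := by
    ext C; simp only [coeff_mul, coeff_add, ← Finset.sum_add_distrib]
    exact Finset.sum_congr rfl fun _ _ => by ring
  zero_mul x := by ext C; simp [coeff_mul]
  mul_zero x := by ext C; simp [coeff_mul]
  mul_assoc := Cl.mul_assoc'
  one_mul x := by
    ext C
    rw [coeff_mul, Finset.sum_eq_single ∅]
    · have h : symmDiff ∅ C = C := bot_symmDiff C
      simp [coeff_one, h]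
    · intro A _ hA; simp [coeff_one, hA]
    · simp
  mul_one x := by
    ext C
    rw [coeff_mul, Finset.sum_eq_single C]
    · simp [coeff_one]
    · intro A _ hA
      simp [coeff_one, hA]
    · simp

instance : Algebra ℝ (Cl n) :=
  Algebra.ofModule
    (fun r x y => by
      ext C; simp only [coeff_mul, coeff_smul, Finset.mul_sum]
      exact Finset.sum_congr rfl fun _ _ => by ring)
    (fun r x y => by
      ext C; simp only [coeff_mul, coeff_smul, Finset.mul_sum]
      exact Finset.sum_congr rfl fun _ _ => by ring)

/-- The basis element `e_A`. -/
def basisElt (A : Finset (Fin n)) : Cl n := mk fun B => if B = A then 1 else 0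

/-- The unit `e_j`. -/
def e (j : Fin n) : Cl n := basisElt {j}

lemma basisElt_mul (A B : Finset (Fin n)) :
    basisElt A * basisElt B = sgn A B • basisElt (symmDiff A B) := by
  ext C
  rw [coeff_mul, Finset.sum_eq_single A]
  · by_cases h : C = symmDiff A B
    · subst h; simp [basisElt]
    · have h' : symmDiff A C ≠ B := by
        rintro rfl; exact h (symmDiff_symmDiff_cancel_left A C).symm
      simp [basisElt, h, h']
  · intro D _ hD; simp [basisElt, hD]
  · simp

/-- The `1`-vector `x_1 e_1 + ⋯ + x_n e_n`. -/
def vec (x : Fin n → ℝ) : Cl n := ∑ j, x j • e j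

lemma e_mul_e (i j : Fin n) : e i * e j + e j * e i = if i = j then -2 else (0 : Cl n) := by
  have h1 : (basisElt ∅ : Cl n) = 1 := rfl
  by_cases h : i = j
  · subst h
    rw [if_pos rfl, e, basisElt_mul]
    simp only [sgn, Finset.prod_singleton, le_refl, if_true, symmDiff_self, Finset.bot_eq_empty, h1]
    rw [← add_smul, show (-2 : Cl n) = (-2 : ℝ) • 1 by
      rw [Algebra.smul_def, mul_one, map_neg, map_ofNat]]
    norm_num
  · rw [if_neg h, e, e, basisElt_mul, basisElt_mul, symmDiff_comm ({j} : Finset (Fin n)) {i}, ← add_smul]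
    simp only [sgn, Finset.prod_singleton]
    rcases lt_or_gt_of_ne h with h | h
    · simp [h.le, h.not_ge]
    · simp [h.le, h.not_ge]

/-- The form `x ↦ -(x_1² + ⋯ + x_n²)`. -/
def negForm (n : ℕ) : QuadraticForm ℝ (Fin n → ℝ) :=
  QuadraticMap.weightedSumSquares ℝ (fun _ : Fin n => (-1 : ℝ))

/-- The inclusion of `1`-vectors. -/
def vecₗ (n : ℕ) : (Fin n → ℝ) →ₗ[ℝ] Cl n where
  toFun := vec
  map_add' x y := by simp [vec, add_smul, Finset.sum_add_distrib]
  map_smul' r x := by simp [vec, mul_smul, Finset.smul_sum]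

lemma vec_mul_self (x : Fin n → ℝ) : vec x * vec x = algebraMap ℝ (Cl n) (negForm n x) := by
  have key : vec x * vec x + vec x * vec x = (2 * negForm n x) • (1 : Cl n) := by
    have h : vec x * vec x = ∑ i, ∑ j, (x i * x j) • (e i * e j) := by
      simp only [vec, Finset.sum_mul, Finset.mul_sum, smul_mul_smul_comm]
      exact Finset.sum_comm
    have h' : vec x * vec x = ∑ i, ∑ j, (x i * x j) • (e j * e i) := by
      rw [h, Finset.sum_comm]
      exact Finset.sum_congr rfl fun i _ => Finset.sum_congr rfl fun j _ => by rw [mul_comm (x j)]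
    nth_rewrite 1 [h]
    rw [h', ← Finset.sum_add_distrib]
    simp only [← Finset.sum_add_distrib, ← smul_add, e_mul_e]
    simp only [smul_ite, smul_zero, Finset.sum_ite_eq, Finset.mem_univ, if_true]
    rw [negForm, QuadraticMap.weightedSumSquares_apply, Finset.mul_sum, Finset.sum_smul]
    refine Finset.sum_congr rfl fun i _ => ?_
    rw [show (-2 : Cl n) = (-2 : ℝ) • 1 by
      rw [Algebra.smul_def, mul_one, map_neg, map_ofNat], smul_smul]
    congr 1
    simp; ring
  rw [Algebra.algebraMap_eq_smul_one]
  have h2 : (2 : ℝ) • (vec x * vec x) = (2 : ℝ) • (negForm n x • (1 : Cl n)) := by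
    rw [two_smul, key, smul_smul]
  exact smul_right_injective _ (two_ne_zero (α := ℝ)) h2

/-- The canonical map from Mathlib's Clifford algebra. -/
def ofClifford (n : ℕ) : CliffordAlgebra (negForm n) →ₐ[ℝ] Cl n :=
  CliffordAlgebra.lift (negForm n) ⟨vecₗ n, vec_mul_self⟩

lemma basisElt_mem_range (A : Finset (Fin n)) : basisElt A ∈ (ofClifford n).range := by
  induction A using Finset.induction_on with
  | empty => exact one_mem _
  | insert j A hj ih =>
    have he : e j ∈ (ofClifford n).range := by
      refine ⟨CliffordAlgebra.ι _ (Pi.single j 1), ?_⟩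
      have h : ofClifford n (CliffordAlgebra.ι _ (Pi.single j 1)) = vecₗ n (Pi.single j 1) :=
        CliffordAlgebra.lift_ι_apply _ _ _
      refine h.trans ?_
      change vec _ = _
      simp [vec, Pi.single_apply]
    have hs : symmDiff {j} A = insert j A := by
      ext i; simp only [Finset.mem_symmDiff, Finset.mem_singleton, Finset.mem_insert]
      constructor
      · tauto
      · rintro (rfl | h)
        · exact Or.inl ⟨rfl, hj⟩
        · exact Or.inr ⟨h, fun h' => hj (h' ▸ h)⟩
    have hsq : sgn {j} A * sgn {j} A = 1 := by
      rw [← sgn_symmDiff_right]; simp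
    have hm := Subalgebra.smul_mem _ (Subalgebra.mul_mem _ he ih) (sgn {j} A)
    rwa [e, basisElt_mul, smul_smul, hsq, one_smul, hs] at hm

lemma ofClifford_surjective : Function.Surjective (ofClifford n) := by
  intro x
  have hx : x = ∑ A, x.coeff A • basisElt A := by
    ext B
    have hsum : ∀ s : Finset (Finset (Fin n)), (∑ A ∈ s, x.coeff A • basisElt A).coeff B
        = ∑ A ∈ s, x.coeff A * (if B = A then 1 else 0) := by
      intro s
      induction s using Finset.induction_on with
      | empty => rfl
      | insert a s ha ih => rw [Finset.sum_insert ha, Finset.sum_insert ha, coeff_add, ih]; rfl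
    rw [hsum]; simp
  have : x ∈ (ofClifford n).range := by
    rw [hx]
    exact Subalgebra.sum_mem _ fun A _ => Subalgebra.smul_mem _ (basisElt_mem_range A) _
  exact this

/-- `Cl n` is the Clifford algebra of `ℝⁿ` with the form `x ↦ -(x_1² + ⋯ + x_n²)`. -/
def equivClifford (n : ℕ) : CliffordAlgebra (negForm n) ≃ₐ[ℝ] Cl n := by
  refine AlgEquiv.ofBijective (ofClifford n) ⟨?_, ofClifford_surjective⟩
  let _ : Invertible (2 : ℝ) := invertibleOfNonzero two_ne_zero
  let b : Module.Basis (Finset (Fin n)) ℝ (CliffordAlgebra (negForm n)) :=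
    (Pi.basisFun ℝ (Fin n)).ExteriorAlgebra.map (CliffordAlgebra.equivExterior (negForm n)).symm
  have hf : FiniteDimensional ℝ (CliffordAlgebra (negForm n)) := b.finiteDimensional_of_finite
  have hd : Module.finrank ℝ (CliffordAlgebra (negForm n)) = Module.finrank ℝ (Cl n) := by
    rw [Module.finrank_eq_card_basis b]
    exact (finrank_euclideanSpace (𝕜 := ℝ) (ι := Finset (Fin n))).symm
  exact (LinearMap.injective_iff_surjective_of_finrank_eq_finrank
    (f := (ofClifford n).toLinearMap) hd).2 ofClifford_surjective

end Cl

/-! ### Paravectors, complex lines, slice-monogenic functions -/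

/-- The space `ℝⁿ⁺¹` of paravectors `x_0 + x_1 e_1 + ⋯ + x_n e_n`; the coordinate `0` is `Re x`. -/
abbrev Para (n : ℕ) : Type := EuclideanSpace ℝ (Fin (n + 1))

/-- The paravector `x`, as an element of the Clifford algebra. -/
def Para.toCl {n : ℕ} (x : Para n) : Cl n :=
  algebraMap ℝ (Cl n) (x 0) + Cl.vec fun j => x j.succ

/-- The conjugate `x_0 - x_1 e_1 - ⋯ - x_n e_n`. -/
def Para.conj {n : ℕ} (x : Para n) : Para n :=
  WithLp.toLp 2 (Fin.cons (x 0) fun j => -x j.succ)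

/-- The sphere `𝕊` of unit `1`-vectors. -/
def unitSphere (n : ℕ) : Set (EuclideanSpace ℝ (Fin n)) := {I | ‖I‖ = 1}

/-- The point `u + I v` of the complex line `L_I`, where `z = u + i v`. -/
def slicePt {n : ℕ} (I : EuclideanSpace ℝ (Fin n)) (z : ℂ) : Para n :=
  WithLp.toLp 2 (Fin.cons z.re fun j => z.im * I j)

/-- `U ∩ L_I`, read in `ℂ` through `u + i v ↦ u + I v`. -/
def slice {n : ℕ} (I : EuclideanSpace ℝ (Fin n)) (U : Set (Para n)) : Set ℂ :=
  {z | slicePt I z ∈ U}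

/-- `f` is (left) slice-monogenic on the open set `U`. -/
def IsSMonogenicOn {n : ℕ} (f : Para n → Cl n) (U : Set (Para n)) : Prop :=
  IsOpen U ∧ DifferentiableOn ℝ f U ∧
    ∀ I ∈ unitSphere n, ∀ z ∈ slice I U,
      (1 / 2 : ℝ) • (fderiv ℝ (fun w : ℂ => f (slicePt I w)) z 1
        + Cl.vec I * fderiv ℝ (fun w : ℂ => f (slicePt I w)) z Complex.I) = 0

/-- The circularization `⋃_{u + I v ∈ A} (u + v Sⁿ)`, with `Sⁿ` the unit sphere of `ℝⁿ⁺¹`. -/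
def circ {n : ℕ} (A : Set (Para n)) : Set (Para n) :=
  {x | ∃ (u v : ℝ), ∃ I ∈ unitSphere n, slicePt I ⟨u, v⟩ ∈ A ∧
    ∃ w : Para n, ‖w‖ = 1 ∧ x = EuclideanSpace.single 0 u + v • w}

/-! ### Contours in the plane -/

/-- `γ`, restricted to `[0,1]`, parametrizes a rectifiable Jordan curve. Rectifiability is expressed
by the Lipschitz condition, which holds for the parametrization proportional to arc length. -/
def IsRectifiableJordan (γ : ℝ → ℂ) : Prop :=
  (∃ K : ℝ≥0, LipschitzOnWith K γ (Set.Icc 0 1)) ∧ γ 0 = γ 1 ∧ Set.InjOn γ (Set.Ico 0 1)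

/-- The winding number of `γ` around `z`. -/
def winding (γ : ℝ → ℂ) (z : ℂ) : ℂ :=
  (2 * Real.pi * Complex.I)⁻¹ * ∫ t in (0 : ℝ)..1, (γ t - z)⁻¹ * deriv γ t

/-- The rectifiable Jordan curves `γ_1, …, γ_m` form the positively oriented boundary of `D`: their
union is `∂D`, and together they wind once around the points of `D` and not at all around the points
outside the closure of `D`. (In particular `D` is bounded.) -/
def IsPositiveBoundary (D : Set ℂ) {m : ℕ} (γ : Fin m → ℝ → ℂ) : Prop :=
  (∀ k, IsRectifiableJordan (γ k)) ∧
  frontier D = ⋃ k, γ k '' Set.Icc 0 1 ∧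
  (∀ z ∈ D, ∑ k, winding (γ k) z = 1) ∧
  (∀ z ∉ closure D, ∑ k, winding (γ k) z = 0)

/-! ### Operators on `Vₙ = V ⊗ ℝₙ` -/

section Operators

variable {V : Type*} [NormedAddCommGroup V] [NormedSpace ℝ V] {n : ℕ}

/-- `Vₙ`: the sums `∑_A v_A e_A`, with the norm given by `‖v‖² = ∑_A ‖v_A‖²`. -/
abbrev Vn (n : ℕ) (V : Type*) : Type _ := PiLp 2 fun _ : Finset (Fin n) => V

/-- The operator `∑_A T_A e_A`, that is, `v ↦ ∑_{A,B} T_A(v_B) e_A e_B`. -/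
def opOf (T : Finset (Fin n) → V →L[ℝ] V) : Vn n V →L[ℝ] Vn n V :=
  (PiLp.continuousLinearEquiv 2 ℝ fun _ : Finset (Fin n) => V).symm.toContinuousLinearMap ∘L
    ContinuousLinearMap.pi fun C => ∑ A, sgn A (symmDiff A C) •
      (T A ∘L PiLp.proj 2 (fun _ : Finset (Fin n) => V) (symmDiff A C))

lemma opOf_apply (T : Finset (Fin n) → V →L[ℝ] V) (v : Vn n V) (C : Finset (Fin n)) :
    opOf T v C = ∑ A, sgn A (symmDiff A C) • T A (v (symmDiff A C)) := by
  simp [opOf]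

/-- The set `𝓑ₙ(Vₙ)` of the operators `∑_A T_A e_A`. -/
def Bn (n : ℕ) (V : Type*) [NormedAddCommGroup V] [NormedSpace ℝ V] :
    Set (Vn n V →L[ℝ] Vn n V) :=
  Set.range opOf

/-- The component `T_A` of `T = ∑_A T_A e_A`: it maps `v` to the `A`-th component of `T(v e_∅)`. -/
def component (A : Finset (Fin n)) (T : Vn n V →L[ℝ] Vn n V) : V →L[ℝ] V :=
  PiLp.proj 2 (fun _ : Finset (Fin n) => V) A ∘L T ∘L
    (PiLp.continuousLinearEquiv 2 ℝ fun _ : Finset (Fin n) => V).symm.toContinuousLinearMap ∘L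
      ContinuousLinearMap.single ℝ (fun _ : Finset (Fin n) => V) ∅

lemma component_opOf (T : Finset (Fin n) → V →L[ℝ] V) (A : Finset (Fin n)) :
    component A (opOf T) = T A := by
  ext v
  change opOf T _ A = T A v
  rw [opOf_apply, Finset.sum_eq_single A]
  · simp
  · intro B _ hB
    have : symmDiff B A ≠ ∅ := by simpa [symmDiff_eq_bot] using hB
    simp [this]
  · simp

/-- The norm of `𝓑ₙ(Vₙ)`: `‖T‖² = ∑_A ‖T_A‖²`. -/
def bnNorm (T : Vn n V →L[ℝ] Vn n V) : ℝ := Real.sqrt (∑ A, ‖component A T‖ ^ 2)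

/-- The operator `T = ∑_j T_j e_j`. -/
def vecOp (T : Fin n → V →L[ℝ] V) : Vn n V →L[ℝ] Vn n V :=
  opOf fun A => ∑ j, if A = {j} then T j else 0

/-- The operator `v ↦ a v` on `Vₙ`, for `a ∈ ℝₙ`. If `T ∈ 𝓑ₙ(Vₙ)` then `T * leftMul a` is the
product `T a = ∑_A T_A e_A a` in the right module `𝓑ₙ(Vₙ)`. -/
def leftMul (a : Cl n) : Vn n V →L[ℝ] Vn n V :=
  opOf fun A => a.coeff A • ContinuousLinearMap.id ℝ V

/-- `T² - 2 Re[s] T + |s|² 𝓘`. -/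
def pencil (T : Vn n V →L[ℝ] Vn n V) (s : Para n) : Vn n V →L[ℝ] Vn n V :=
  T ^ 2 - (2 * s 0) • T + (‖s‖ ^ 2) • (1 : Vn n V →L[ℝ] Vn n V)

/-- The `S`-spectrum. (For `T ∈ 𝓑ₙ(Vₙ)`, a bounded inverse of the pencil is automatically linear
over `ℝₙ` on the right, hence in `𝓑ₙ(Vₙ)`.) -/
def sSpectrum (T : Vn n V →L[ℝ] Vn n V) : Set (Para n) := {s | ¬ IsUnit (pencil T s)}

/-- The `S`-resolvent operator `-(T² - 2 Re[s] T + |s|² 𝓘)⁻¹ (T - s̄ 𝓘)`. -/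
def sResolvent (s : Para n) (T : Vn n V →L[ℝ] Vn n V) : Vn n V →L[ℝ] Vn n V :=
  -(Ring.inverse (pencil T s) * (T - leftMul s.conj.toCl))

/-- The open sets used in the definition of the functional calculus of `T`. -/
structure IsAdmissible (T : Vn n V →L[ℝ] Vn n V) (U : Set (Para n)) : Prop where
  isOpen : IsOpen U
  boundary : ∀ I ∈ unitSphere n, ∃ (m : ℕ) (γ : Fin m → ℝ → ℂ), IsPositiveBoundary (slice I U) γ
  circ_subset : circ (sSpectrum T) ⊆ U

/-- `f` is locally s-monogenic on the `S`-spectrum of `T`. -/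
def LocallySMonogenic (T : Vn n V →L[ℝ] Vn n V) (f : Para n → Cl n) : Prop :=
  ∃ U W : Set (Para n), IsAdmissible T U ∧ closure U ⊆ W ∧ IsSMonogenicOn f W

/-- The integrand of `∫_γ S⁻¹(s,T) ds_I f(s)` in the parameter `t`, where `s = u + I v` runs over the
curve `γ = u + i v` and `ds_I = -ds I`. -/
def sIntegrand (T : Vn n V →L[ℝ] Vn n V) (f : Para n → Cl n) (I : EuclideanSpace ℝ (Fin n))
    (γ : ℝ → ℂ) (t : ℝ) : Vn n V →L[ℝ] Vn n V :=
  sResolvent (slicePt I (γ t)) T *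
    leftMul (-((slicePt I (deriv γ t)).toCl * Cl.vec I) * f (slicePt I (γ t)))

/-- `(1/2π) ∫_{∂U_I} S⁻¹(s,T) ds_I f(s)`, where `γ` parametrizes `∂U_I`. -/
def sIntegral (T : Vn n V →L[ℝ] Vn n V) (f : Para n → Cl n) (I : EuclideanSpace ℝ (Fin n))
    {m : ℕ} (γ : Fin m → ℝ → ℂ) : Vn n V →L[ℝ] Vn n V :=
  (1 / (2 * Real.pi) : ℝ) • ∑ k, ∫ t in (0 : ℝ)..1, sIntegrand T f I (γ k) t

/-- `(U, I, γ)` can be used to compute `f(T)`. -/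
def IsContour (T : Vn n V →L[ℝ] Vn n V) (f : Para n → Cl n) (U : Set (Para n))
    (I : EuclideanSpace ℝ (Fin n)) {m : ℕ} (γ : Fin m → ℝ → ℂ) : Prop :=
  IsAdmissible T U ∧ (∃ W, closure U ⊆ W ∧ IsSMonogenicOn f W) ∧ I ∈ unitSphere n ∧
    IsPositiveBoundary (slice I U) γ

/-- The slice-monogenic functional calculus `f(T)`: the value of the integral for some choice of
`U`, `I` and `γ`. -/
def sCalc (T : Vn n V →L[ℝ] Vn n V) (f : Para n → Cl n) : Vn n V →L[ℝ] Vn n V :=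
  Classical.epsilon fun F => ∃ (U : Set (Para n)) (I : EuclideanSpace ℝ (Fin n)) (m : ℕ)
    (γ : Fin m → ℝ → ℂ), IsContour T f U I γ ∧ F = sIntegral T f I γ

end Operators

/-! ### The Riesz–Dunford calculus -/

/-- `(1/2πi) ∫_γ F(z) (z - A)⁻¹ dz`. -/
def rieszDunford {X : Type*} [NormedAddCommGroup X] [NormedSpace ℂ X] (A : X →L[ℂ] X) (F : ℂ → ℂ)
    {m : ℕ} (γ : Fin m → ℝ → ℂ) : X →L[ℂ] X :=
  (2 * Real.pi * Complex.I : ℂ)⁻¹ •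
    ∑ k, ∫ t in (0 : ℝ)..1, (F (γ k t) * deriv (γ k) t) • resolvent A (γ k t)

/-- `γ` is a contour for which `rieszDunford A F γ` is the operator `F(A)`: it is the positively
oriented boundary of an open neighbourhood `D` of the spectrum, and `F` is holomorphic on a
neighbourhood of the closure of `D`. -/
def IsRieszDunfordContour {X : Type*} [NormedAddCommGroup X] [NormedSpace ℂ X] (A : X →L[ℂ] X)
    (F : ℂ → ℂ) {m : ℕ} (γ : Fin m → ℝ → ℂ) : Prop :=
  ∃ D Ω : Set ℂ, IsOpen D ∧ IsOpen Ω ∧ spectrum ℂ A ⊆ D ∧ closure D ⊆ Ω ∧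
    DifferentiableOn ℂ F Ω ∧ IsPositiveBoundary D γ

/-- The inclusion `j` exhibits the complex space `X` as a complexification `V ⊕ i V` of `V`. -/
def IsComplexification {V X : Type*} [NormedAddCommGroup V] [NormedSpace ℝ V]
    [NormedAddCommGroup X] [NormedSpace ℂ X] (j : V →L[ℝ] X) : Prop :=
  Function.Bijective fun p : V × V => j p.1 + Complex.I • j p.2

/-- For `n = 1` and under the identification `u + i v ↔ u + e_1 v` of `ℂ` with `ℝ²` and with `ℝ₁`,
the function `x ↦ F(-x e_1)`; here `-x e_1 = x_1 - e_1 x_0`. -/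
def rotated {n : ℕ} [NeZero n] (F : ℂ → ℂ) : Para n → Cl n := fun x =>
  (slicePt (EuclideanSpace.single 0 1) (F ⟨x (Fin.succ 0), -x 0⟩)).toCl

end SliceCalc

end

noncomputable section

namespace SliceCalc

/-! Everything reduces to one formula in the real Banach algebra of bounded operators on `Vn`. There
left multiplication by a unit vector I is an element i with i² = -1, and on the plane L_I the
S-resolvent is S(z) = (T² - 2 Re(z) T + |z|²)⁻¹ (z̄ - T). As T and i need not commute, S(z) is not
the inverse of z - T in general; but z + z̄ and z z̄ are real, and this is enough for S z - T S = 1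
(`planarResolvent_mul`). This equation implies ∂_u S + (∂_v S) i = 0, while s-monogenicity of f says
∂_u f + i ∂_v f = 0. Hence the pair -S i f, S f satisfies the Cauchy–Riemann equations, and every
real functional ℓ yields an ordinary holomorphic function ℓ(-S i f) - i ℓ(S f)
(`LeftHolAt.cauchyRiemann_resolvent`). Scalar complex analysis then applies.

The contours are known only through their winding numbers. The Cauchy–Pompeiu formula and Fubini
express ∫_γ φ dw as an area integral of ∂̄φ against the winding number (`curveIntegral_eq`). If χ is
a cutoff equal to 1 near the spectrum and supported in the domain, it follows that f(T) = -(1/2π) ∫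
S (∂_u χ + i ∂_v χ) f over the plane (`IsPositiveBoundary.contour_eq_area`, `areaCalc`). No contour
is left in this formula, and the assertions are read off from it.

Independence of the cutoff: two cutoffs differ by a function supported off the spectrum, and its
area integral vanishes. Independence of I: the circles that make up the circularized spectrum join z
to z̄ through the real axis, so the identity theorem gives the representation formula of one slice
of f by another (`representation`); the sum of the integrand over z and z̄ then contains no
imaginary unit (`areaIntegrand_add_conj`). This is where the circularization is needed. Membership
in `Bn`: that set is the commutant of the right multiplications (`mem_Bn_iff`), and these commute
with the integrand. Continuity: one cutoff serves all nearby operators, and the integrand lives on a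
fixed compact set off the spectrum (`IsCutoff.areaCalc_continuous`).

Product: the resolvent equation gives T^k for the function z^k by induction (`areaCalc_pow`), the
case k = 0 being Cauchy–Pompeiu after pushing the cutoff to infinity (`areaCalc_one`). Real
polynomials are thus multiplicative, and real power series are uniform limits of them on the support
of the gradient of the cutoff.

Consistency for n = 1: on X the operator T becomes iA, its quadratic pencil factors into commuting
complex-linear operators, and S(iζ) becomes -i(ζ - A)⁻¹ (`complexify_planarResolvent`). Both calculi
have the same area form up to the rotation ζ ↦ iζ.

Finally, admissible sets exist in every neighbourhood of the circularized spectrum: a union of small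
grid squares in the half-plane picture is rotated about the real axis, and its boundary edges, a
balanced directed graph, split into simple closed polygons (`exists_positiveBoundary`,
`exists_isAdmissible`). -/

open MeasureTheory Set Filter Topology

/-! ### The Cauchy–Pompeiu formula -/

/-- The operator `∂_u + i ∂_v`, twice the Wirtinger derivative `∂/∂z̄`. -/
def dbar (φ : ℂ → ℂ) (w : ℂ) : ℂ := fderiv ℝ φ w 1 + Complex.I * fderiv ℝ φ w Complex.I

lemma continuous_dbar {φ : ℂ → ℂ} (h : ContDiff ℝ 1 φ) : Continuous (dbar φ) := by
  have := h.continuous_fderiv one_ne_zero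
  unfold dbar
  fun_prop

lemma tsupport_dbar_subset (φ : ℂ → ℂ) : tsupport (dbar φ) ⊆ tsupport φ := by
  refine (closure_mono fun w hw => ?_).trans (tsupport_fderiv_subset ℝ (f := φ))
  rw [Function.mem_support] at hw ⊢
  contrapose! hw
  simp [dbar, hw]

lemma hasCompactSupport_dbar {φ : ℂ → ℂ} (hc : HasCompactSupport φ) :
    HasCompactSupport (dbar φ) :=
  hc.of_isClosed_subset (isClosed_tsupport _) (tsupport_dbar_subset φ)

/-- The point `e^{iθ}`. -/
def cis (θ : ℝ) : ℂ := Real.cos θ + Real.sin θ * Complex.I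

lemma norm_cis (θ : ℝ) : ‖cis θ‖ = 1 := by
  rw [cis, Complex.ofReal_cos, Complex.ofReal_sin]; exact Complex.norm_cos_add_sin_mul_I θ

lemma continuous_cis : Continuous cis := by unfold cis; fun_prop

lemma hasDerivAt_cis (θ : ℝ) : HasDerivAt cis (Complex.I * cis θ) θ := by
  have h := ((Real.hasDerivAt_cos θ).ofReal_comp).add
    (((Real.hasDerivAt_sin θ).ofReal_comp).mul_const Complex.I)
  refine h.congr_deriv ?_
  simp only [cis]
  push_cast
  linear_combination (-(Complex.sin (θ : ℂ))) * Complex.I_sq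

lemma integrableOn_polar {F : ℝ × ℝ → ℂ} (hF : Continuous F) {R : ℝ}
    (h0 : ∀ r θ, R < r → F (r, θ) = 0) : IntegrableOn F polarCoord.target := by
  have hK : IntegrableOn F (Icc 0 R ×ˢ Icc (-Real.pi) Real.pi) :=
    hF.continuousOn.integrableOn_compact (isCompact_Icc.prod isCompact_Icc)
  refine hK.of_forall_sdiff_eq_zero polarCoord.open_target.measurableSet ?_
  rintro ⟨r, θ⟩ ⟨hp, hn⟩
  simp only [polarCoord, mem_prod, mem_Ioi, mem_Ioo] at hp
  refine h0 _ _ (not_le.1 fun hr => hn ⟨⟨hp.1.le, hr⟩, hp.2.1.le, hp.2.2.le⟩)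

/-- The Cauchy–Pompeiu formula for a compactly supported function. -/
theorem integral_dbar_mul_inv {φ : ℂ → ℂ} (h1 : ContDiff ℝ 1 φ) (hc : HasCompactSupport φ) (z : ℂ) :
    ∫ w, dbar φ w * (w - z)⁻¹ = -(2 * Real.pi) * φ z := by
  rw [← integral_add_right_eq_self _ z]
  simp only [add_sub_cancel_right]
  rw [← Complex.integral_comp_polarCoord_symm]
  -- At the point z + r e^{iθ} the integrand, multiplied by the Jacobian r, is e^{-iθ}(∂_u + i ∂_v)φ
  -- = ∂_r φ + (i/r) ∂_θ φ. The summands are `A` and `B`: the first integrates in r to -φ(z), the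
  -- second in θ over a full period to 0.
  set A : ℝ × ℝ → ℂ := fun p => fderiv ℝ φ (p.1 * cis p.2 + z) (cis p.2) with hA
  set B : ℝ × ℝ → ℂ := fun p => Complex.I * fderiv ℝ φ (p.1 * cis p.2 + z) (Complex.I * cis p.2)
    with hB
  have hcD : HasCompactSupport (fderiv ℝ φ) := hc.fderiv ℝ
  obtain ⟨R, hR⟩ := (hcD.isCompact.isBounded).exists_norm_le
  obtain ⟨R', hR'⟩ := (hc.isCompact.isBounded).exists_norm_le
  have hbig : ∀ r θ, R + ‖z‖ + |R| < r → fderiv ℝ φ (r * cis θ + z) = 0 := by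
    intro r θ hr
    by_contra h
    have h2 := hR _ (subset_tsupport _ h)
    have h3 : ‖(r : ℂ) * cis θ‖ ≤ ‖(r : ℂ) * cis θ + z‖ + ‖z‖ := by
      simpa using norm_sub_le ((r : ℂ) * cis θ + z) z
    rw [norm_mul, norm_cis, Complex.norm_real, mul_one] at h3
    have := le_abs_self r
    have := abs_nonneg R
    simp only [Real.norm_eq_abs] at h3
    linarith
  have hD := h1.continuous_fderiv one_ne_zero
  have hcis := continuous_cis
  have hAc : Continuous A := by
    refine (hD.comp (f := fun p : ℝ × ℝ => (p.1 * cis p.2 + z : ℂ)) (by fun_prop)).clm_apply ?_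
    fun_prop
  have hBc : Continuous B := by
    refine continuous_const.mul
      ((hD.comp (f := fun p : ℝ × ℝ => (p.1 * cis p.2 + z : ℂ)) (by fun_prop)).clm_apply ?_)
    fun_prop
  have hAi : IntegrableOn A polarCoord.target :=
    integrableOn_polar hAc (R := R + ‖z‖ + |R|) fun r θ hr => by simp [hA, hbig r θ hr]
  have hBi : IntegrableOn B polarCoord.target :=
    integrableOn_polar hBc (R := R + ‖z‖ + |R|) fun r θ hr => by simp [hB, hbig r θ hr]
  have hsplit : ∫ p in polarCoord.target, p.1 • (dbar φ (Complex.polarCoord.symm p + z)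
      * (Complex.polarCoord.symm p)⁻¹) = ∫ p in polarCoord.target, (A p + B p) := by
    refine setIntegral_congr_fun polarCoord.open_target.measurableSet fun p hp => ?_
    have hp1 : (p.1 : ℂ) ≠ 0 := by
      have : 0 < p.1 := hp.1
      exact_mod_cast this.ne'
    have hsym : Complex.polarCoord.symm p = p.1 * cis p.2 := by
      rw [Complex.polarCoord_symm_apply, cis]
    have hcne : cis p.2 ≠ 0 := fun h => by simpa [h] using norm_cis p.2
    have hsq : (Real.cos p.2 : ℂ) ^ 2 + (Real.sin p.2 : ℂ) ^ 2 = 1 := by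
      exact_mod_cast Real.cos_sq_add_sin_sq p.2
    have hinv : (cis p.2)⁻¹ = Real.cos p.2 - Real.sin p.2 * Complex.I := by
      refine inv_eq_of_mul_eq_one_right ?_
      simp only [cis]
      linear_combination hsq - (Real.sin p.2 : ℂ) ^ 2 * Complex.I_sq
    have hl : ∀ (D : ℂ →L[ℝ] ℂ) (c s : ℝ), D (c + s * Complex.I) = c * D 1 + s * D Complex.I := by
      intro D c s
      have : (c + s * Complex.I : ℂ) = c • (1 : ℂ) + s • Complex.I := by simp [Complex.real_smul]
      rw [this, map_add, map_smul, map_smul, Complex.real_smul, Complex.real_smul]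
    have e2 : Complex.I * cis p.2 = ((-Real.sin p.2 : ℝ) : ℂ) + Real.cos p.2 * Complex.I := by
      simp only [cis]; push_cast
      linear_combination (Complex.sin (p.2 : ℂ)) * Complex.I_sq
    simp only [hA, hB, hsym, dbar]
    generalize fderiv ℝ φ (p.1 * cis p.2 + z) = D
    rw [e2, mul_inv, hinv, Complex.real_smul, hl, cis, hl]
    field_simp
    push_cast
    linear_combination (- (Complex.sin p.2) * (D Complex.I)) * Complex.I_sq
  rw [hsplit, integral_add hAi hBi]
  have hAint : ∫ p in polarCoord.target, A p = -(2 * Real.pi) * φ z := by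
    have hAi' := hAi
    simp only [polarCoord] at hAi' ⊢
    rw [Measure.volume_eq_prod, ← setIntegral_prod_swap, setIntegral_prod]
    · have : ∀ θ : ℝ, ∫ r in Ioi (0 : ℝ), A (r, θ) = -φ z := by
        intro θ
        have hder : ∀ r : ℝ, HasDerivAt (fun r : ℝ => φ (r * cis θ + z)) (A (r, θ)) r := by
          intro r
          have hl : HasDerivAt (fun r : ℝ => (r * cis θ + z : ℂ)) (cis θ) r := by
            simpa using ((Complex.ofRealCLM.hasDerivAt (x := r)).mul_const (cis θ)).add_const z
          exact ((h1.differentiable one_ne_zero _).hasFDerivAt).comp_hasDerivAt r hl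
        have hlim : Tendsto (fun r : ℝ => φ (r * cis θ + z)) atTop (𝓝 0) := by
          refine tendsto_const_nhds.congr' ?_
          filter_upwards [eventually_gt_atTop (R' + ‖z‖ + |R'|)] with r hr
          by_contra h
          have h2 := hR' _ (subset_tsupport _ (Ne.symm h))
          have h3 : ‖(r : ℂ) * cis θ‖ ≤ ‖(r : ℂ) * cis θ + z‖ + ‖z‖ := by
            simpa using norm_sub_le ((r : ℂ) * cis θ + z) z
          rw [norm_mul, norm_cis, Complex.norm_real, mul_one] at h3
          have := le_abs_self r
          have := abs_nonneg R'
          simp only [Real.norm_eq_abs] at h3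
          linarith
        have hint : IntegrableOn (fun r => A (r, θ)) (Ioi 0) := by
          have h0 : ∀ r, R + ‖z‖ + |R| < r → A (r, θ) = 0 := fun r hr => by simp [hA, hbig r θ hr]
          have hK : IntegrableOn (fun r => A (r, θ)) (Icc 0 (R + ‖z‖ + |R|)) :=
            ((hAc.comp (by fun_prop : Continuous fun r : ℝ => (r, θ))).continuousOn).integrableOn_compact
              isCompact_Icc
          exact hK.of_forall_sdiff_eq_zero measurableSet_Ioi fun r hr =>
            h0 r (not_le.1 fun h => hr.2 ⟨hr.1.le, h⟩)
        rw [integral_Ioi_of_hasDerivAt_of_tendsto' (fun r _ => hder r) hint hlim]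
        simp
      simp only [Prod.swap_prod_mk, this]
      rw [setIntegral_const]
      rw [Real.volume_real_Ioo_of_le (by linarith [Real.pi_pos]), Complex.real_smul]
      push_cast
      ring
    · exact hAi'.swap
  have hBint : ∫ p in polarCoord.target, B p = 0 := by
    have hBi' := hBi
    simp only [polarCoord] at hBi' ⊢
    rw [Measure.volume_eq_prod, setIntegral_prod _ hBi']
    rw [setIntegral_congr_fun (g := fun _ => 0) measurableSet_Ioi]
    · simp
    · intro r hr
      have hr0 : (r : ℂ) ≠ 0 := by exact_mod_cast (ne_of_gt hr)
      have hder : ∀ θ : ℝ, HasDerivAt (fun θ : ℝ => Complex.I * (r : ℂ)⁻¹ * φ (r * cis θ + z))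
          (B (r, θ)) θ := by
        intro θ
        have hl : HasDerivAt (fun θ : ℝ => (r * cis θ + z : ℂ)) (r * (Complex.I * cis θ)) θ :=
          ((hasDerivAt_cis θ).const_mul (r : ℂ)).add_const z
        have := (((h1.differentiable one_ne_zero _).hasFDerivAt).comp_hasDerivAt θ hl).const_mul
          (Complex.I * (r : ℂ)⁻¹)
        refine this.congr_deriv ?_
        simp only [hB]
        rw [← Complex.real_smul (x := r) (z := Complex.I * cis θ), map_smul, Complex.real_smul]
        field_simp
      change ∫ θ in Ioo (-Real.pi) Real.pi, B (r, θ) = 0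
      rw [← integral_Ioc_eq_integral_Ioo, ← intervalIntegral.integral_of_le (by linarith [Real.pi_pos]),
        intervalIntegral.integral_eq_sub_of_hasDerivAt (fun θ _ => hder θ)
          ((hBc.comp (by fun_prop : Continuous fun θ : ℝ => (r, θ))).intervalIntegrable _ _)]
      simp [cis]
  rw [hAint, hBint, add_zero]

/-! ### Uniform integrability of the Cauchy kernel -/

lemma locallyIntegrable_inv : LocallyIntegrable (fun w : ℂ => w⁻¹) := by
  refine locallyIntegrable_of_norm_le_rpow (α := 1) (C := 1) (by simp) (by simp) ?_ ?_
  · refine Eventually.of_forall fun w => ?_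
    rw [norm_inv, Real.rpow_neg_one, one_mul]
  · exact measurable_inv.aestronglyMeasurable

lemma integrableOn_ball_inv (c : ℂ) (r : ℝ) :
    IntegrableOn (fun w : ℂ => (w - c)⁻¹) (Metric.ball c r) := by
  have h : IntegrableOn (fun w : ℂ => w⁻¹) (Metric.ball 0 r) :=
    (locallyIntegrable_inv.integrableOn_isCompact (isCompact_closedBall 0 r)).mono_set
      Metric.ball_subset_closedBall
  have := (integrable_indicator_iff measurableSet_ball).2 h
  rw [← integrable_indicator_iff measurableSet_ball]
  refine (this.comp_sub_right c).congr (Eventually.of_forall fun w => ?_)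
  simp only [indicator, Metric.mem_ball, dist_eq_norm, sub_zero]

lemma integral_ball_norm_inv (c : ℂ) (r : ℝ) :
    ∫ w in Metric.ball c r, ‖(w - c)⁻¹‖ = ∫ w in Metric.ball (0 : ℂ) r, ‖w⁻¹‖ := by
  rw [← integral_indicator measurableSet_ball, ← integral_indicator measurableSet_ball,
    ← integral_sub_right_eq_self ((Metric.ball (0 : ℂ) r).indicator fun w => ‖w⁻¹‖) c]
  refine integral_congr_ae (Eventually.of_forall fun w => ?_)
  simp only [indicator, Metric.mem_ball, dist_eq_norm, sub_zero]

/-- Splits the kernel into a part bounded by 1 and a part whose integral is the same for all c;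
hence the bound of `integrable_mul_inv` is uniform in c. -/
lemma norm_inv_le_add_indicator (w c : ℂ) :
    ‖(w - c)⁻¹‖ ≤ 1 + (Metric.ball c 1).indicator (fun w => ‖(w - c)⁻¹‖) w := by
  by_cases h : w ∈ Metric.ball c 1
  · rw [indicator_of_mem h]; linarith
  · rw [indicator_of_notMem h, add_zero, norm_inv]
    rw [Metric.mem_ball, dist_eq_norm, not_lt] at h
    exact inv_le_one_of_one_le₀ h

/-- Uniform bounds for the Cauchy transform of a compactly supported continuous function. -/
lemma integrable_mul_inv {ρ : ℂ → ℂ} (h : Continuous ρ) (hc : HasCompactSupport ρ) :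
    (∀ c, Integrable fun w => ρ w * (w - c)⁻¹) ∧ ∃ C, ∀ c, ∫ w, ‖ρ w * (w - c)⁻¹‖ ≤ C := by
  obtain ⟨M, hM⟩ := hc.exists_bound_of_continuous h
  have hM0 : 0 ≤ M := (norm_nonneg _).trans (hM 0)
  have hρ : Integrable ρ := h.integrable_of_hasCompactSupport hc
  have hint : ∀ c, Integrable
      (fun w => ‖ρ w‖ + M * (Metric.ball c 1).indicator (fun w => ‖(w - c)⁻¹‖) w) := fun c =>
    hρ.norm.add (((integrable_indicator_iff measurableSet_ball).2
      (integrableOn_ball_inv c 1).norm).const_mul M)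
  have hle : ∀ c w, ‖ρ w * (w - c)⁻¹‖ ≤
      ‖ρ w‖ + M * (Metric.ball c 1).indicator (fun w => ‖(w - c)⁻¹‖) w := by
    intro c w
    have h0 : 0 ≤ (Metric.ball c 1).indicator (fun w => ‖(w - c)⁻¹‖) w :=
      indicator_nonneg (fun _ _ => norm_nonneg _) _
    rw [norm_mul]
    calc ‖ρ w‖ * ‖(w - c)⁻¹‖
        ≤ ‖ρ w‖ * (1 + (Metric.ball c 1).indicator (fun w => ‖(w - c)⁻¹‖) w) := by
          gcongr; exact norm_inv_le_add_indicator w c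
      _ ≤ _ := by
          rw [mul_add, mul_one]; gcongr; exact hM w
  have hi : ∀ c, Integrable fun w => ρ w * (w - c)⁻¹ := fun c =>
    (hint c).mono' (h.aestronglyMeasurable.mul
      (measurable_id.sub_const c).inv.aestronglyMeasurable) (Eventually.of_forall (hle c))
  refine ⟨hi, (∫ w, ‖ρ w‖) + M * ∫ w in Metric.ball (0 : ℂ) 1, ‖w⁻¹‖, fun c => ?_⟩
  refine (integral_mono (hi c).norm (hint c) (hle c)).trans ?_
  rw [integral_add hρ.norm (((integrable_indicator_iff measurableSet_ball).2
      (integrableOn_ball_inv c 1).norm).const_mul M), integral_const_mul,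
    integral_indicator measurableSet_ball, integral_ball_norm_inv]

/-! ### Line integrals and winding numbers of Lipschitz curves -/

lemma norm_deriv_le_of_mem_Ioo {γ : ℝ → ℂ} {K : ℝ≥0} (hγ : LipschitzOnWith K γ (Icc 0 1)) {t : ℝ}
    (ht : t ∈ Ioo (0 : ℝ) 1) : ‖deriv γ t‖ ≤ K :=
  -- Where γ is not differentiable `deriv` is 0 and the bound is trivial. The endpoints are excluded
  -- because `deriv` also sees the uncontrolled values of γ outside [0,1].
  norm_deriv_le_of_lipschitzOn (Icc_mem_nhds ht.1 ht.2) hγ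

lemma ae_uIoc_mem_Ioo : ∀ᵐ t : ℝ, t ∈ uIoc (0 : ℝ) 1 → t ∈ Ioo (0 : ℝ) 1 := by
  have : ∀ᵐ t : ℝ, t ≠ 1 := by simp [ae_iff, measure_singleton]
  filter_upwards [this] with t ht h
  rw [uIoc_of_le zero_le_one] at h
  exact ⟨h.1, lt_of_le_of_ne h.2 ht⟩

lemma aestronglyMeasurable_comp_curve {E : Type*} [NormedAddCommGroup E] {γ : ℝ → ℂ} {F : ℂ → E}
    (hF : ContinuousOn F (γ '' Icc 0 1)) (hγ : ContinuousOn γ (Icc 0 1)) :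
    AEStronglyMeasurable (fun t => F (γ t)) (volume.restrict (uIoc 0 1)) := by
  rw [uIoc_of_le zero_le_one]
  exact ((hF.comp hγ (mapsTo_image _ _)).mono Ioc_subset_Icc_self).aestronglyMeasurable
    measurableSet_Ioc

/-- The integral of a compactly supported `C¹` function along a closed Lipschitz curve, as an area
integral against the winding number. -/
theorem curveIntegral_eq {γ : ℝ → ℂ} {K : ℝ≥0} (hγ : LipschitzOnWith K γ (Icc 0 1)) {φ : ℂ → ℂ}
    (h1 : ContDiff ℝ 1 φ) (hc : HasCompactSupport φ) :
    Integrable (fun w => dbar φ w * winding γ w) ∧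
      ∫ t in (0 : ℝ)..1, φ (γ t) * deriv γ t = Complex.I * ∫ w, dbar φ w * winding γ w := by
  -- The extension of γ by constants is continuous on the whole line, which makes the integrand on
  -- the product space measurable.
  set γ' : ℝ → ℂ := fun t => γ (projIcc 0 1 zero_le_one t) with hγ'
  have hγc : Continuous γ' :=
    (hγ.continuousOn.domRestrict).comp continuous_projIcc
  have heq : ∀ t ∈ Icc (0 : ℝ) 1, γ' t = γ t := fun t ht => by
    simp [hγ', projIcc_of_mem zero_le_one ht]
  obtain ⟨hi, C, hC⟩ := integrable_mul_inv (continuous_dbar h1) (hasCompactSupport_dbar hc)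
  set F : ℝ × ℂ → ℂ := fun p => dbar φ p.2 * (p.2 - γ' p.1)⁻¹ * deriv γ p.1 with hF
  have hFm : Measurable F := by
    have h1 := (continuous_dbar h1).measurable
    have h2 := hγc.measurable
    have h3 := measurable_deriv γ
    fun_prop
  set μ := (volume : Measure ℝ).restrict (Ioc 0 1) with hμ
  have hae : ∀ᵐ t ∂μ, t ∈ Ioo (0 : ℝ) 1 := by
    rw [hμ, ae_restrict_iff' measurableSet_Ioc]
    simpa [uIoc_of_le] using ae_uIoc_mem_Ioo
  -- Fubini applies because the inner area integral is bounded independently of the pole γ(t) and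
  -- |γ'| is at most K.
  have hFi : Integrable F (μ.prod volume) := by
    rw [integrable_prod_iff hFm.aestronglyMeasurable]
    refine ⟨Eventually.of_forall fun t => (hi (γ' t)).mul_const (deriv γ t), ?_⟩
    refine (integrable_const (C * K)).mono'
      (hFm.norm.stronglyMeasurable.integral_prod_right').aestronglyMeasurable ?_
    filter_upwards [hae] with t ht
    have : ∀ w, ‖F (t, w)‖ = ‖dbar φ w * (w - γ' t)⁻¹‖ * ‖deriv γ t‖ := fun w => norm_mul _ _
    simp only [this]
    rw [integral_mul_const, norm_mul, norm_norm, Real.norm_of_nonneg (integral_nonneg fun _ => norm_nonneg _)]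
    have h0 : 0 ≤ C := (integral_nonneg fun _ => norm_nonneg _).trans (hC 0)
    exact mul_le_mul (hC _) (norm_deriv_le_of_mem_Ioo hγ ht) (norm_nonneg _) h0
  have hw : ∀ w, ∫ t, F (t, w) ∂μ = -(2 * Real.pi * Complex.I) * (dbar φ w * winding γ w) := by
    intro w
    have e : ∫ t, F (t, w) ∂μ = -dbar φ w * ∫ t in (0 : ℝ)..1, (γ t - w)⁻¹ * deriv γ t := by
      rw [intervalIntegral.integral_of_le zero_le_one, ← integral_const_mul]
      refine integral_congr_ae ?_
      filter_upwards [hae] with t ht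
      simp only [hF, heq t ⟨ht.1.le, ht.2.le⟩]
      rw [← neg_sub w (γ t), inv_neg]
      ring
    have hpi : (2 * Real.pi * Complex.I : ℂ) ≠ 0 := by simp [Real.pi_ne_zero]
    rw [e, winding]
    field_simp
  have ht : ∀ᵐ t ∂μ, ∫ w, F (t, w) = -(2 * Real.pi) * (φ (γ t) * deriv γ t) := by
    filter_upwards [hae] with t ht
    simp only [hF]
    rw [integral_mul_const, integral_dbar_mul_inv h1 hc, heq t ⟨ht.1.le, ht.2.le⟩]
    ring
  -- Integrating first over w gives the value of φ at γ(t) by Cauchy–Pompeiu; integrating first over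
  -- t gives the winding number around w.
  have hswap := integral_integral_swap (f := fun t w => F (t, w)) hFi
  simp only [hw] at hswap
  rw [integral_congr_ae ht, integral_const_mul, integral_const_mul] at hswap
  have hpi : (2 * Real.pi : ℂ) ≠ 0 := by simp [Real.pi_ne_zero]
  constructor
  · have := hFi.integral_prod_right
    simp only [hw] at this
    have h2 := this.const_mul (-(2 * Real.pi * Complex.I))⁻¹
    refine h2.congr (Eventually.of_forall fun w => ?_)
    have hpi : (2 * Real.pi * Complex.I : ℂ) ≠ 0 := by simp [Real.pi_ne_zero]
    simp only
    field_simp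
  · rw [intervalIntegral.integral_of_le zero_le_one]
    refine mul_left_cancel₀ (neg_ne_zero.2 hpi) ?_
    rw [hswap]
    ring

lemma winding_aestronglyMeasurable {γ : ℝ → ℂ} (hγ : ContinuousOn γ (Icc 0 1)) {z : ℂ}
    (hz : z ∉ γ '' Icc 0 1) :
    AEStronglyMeasurable (fun t => (γ t - z)⁻¹ * deriv γ t) (volume.restrict (uIoc 0 1)) := by
  refine AEStronglyMeasurable.mul ?_ (measurable_deriv γ).aestronglyMeasurable
  refine aestronglyMeasurable_comp_curve (F := fun w => (w - z)⁻¹) ?_ hγ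
  exact (continuousOn_id.sub continuousOn_const).inv₀ fun w hw h => hz (by
    rwa [← show w = z from sub_eq_zero.1 h])

lemma norm_winding_integrand_le {γ : ℝ → ℂ} {K : ℝ≥0} (hγ : LipschitzOnWith K γ (Icc 0 1)) {z : ℂ}
    {d : ℝ} (hd : 0 < d) (hz : ∀ t ∈ Icc (0 : ℝ) 1, d ≤ ‖γ t - z‖) {t : ℝ} (ht : t ∈ Ioo (0 : ℝ) 1) :
    ‖(γ t - z)⁻¹ * deriv γ t‖ ≤ d⁻¹ * K := by
  rw [norm_mul, norm_inv]
  exact mul_le_mul (inv_anti₀ hd (hz t ⟨ht.1.le, ht.2.le⟩)) (norm_deriv_le_of_mem_Ioo hγ ht)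
    (norm_nonneg _) (inv_nonneg.2 hd.le)

/-- Dominated convergence: for centres near z the curve stays at distance at least d/2. This carries
winding numbers from open grid squares to the edges between them. -/
lemma continuousAt_winding {γ : ℝ → ℂ} {K : ℝ≥0} (hγ : LipschitzOnWith K γ (Icc 0 1)) {z : ℂ}
    (hz : z ∉ γ '' Icc 0 1) : ContinuousAt (winding γ) z := by
  have hcomp : IsCompact (γ '' Icc 0 1) := isCompact_Icc.image_of_continuousOn hγ.continuousOn
  obtain ⟨d, hd, hball⟩ := Metric.isOpen_iff.1 hcomp.isClosed.isOpen_compl z hz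
  have hfar : ∀ᶠ x in 𝓝 z, ∀ t ∈ Icc (0 : ℝ) 1, d / 2 ≤ ‖γ t - x‖ := by
    filter_upwards [Metric.ball_mem_nhds z (half_pos hd)] with x hx t ht
    by_contra hlt
    refine hball (show γ t ∈ Metric.ball z d from ?_) (mem_image_of_mem _ ht)
    rw [Metric.mem_ball] at hx ⊢
    have := dist_triangle (γ t) x z
    rw [dist_eq_norm (γ t) x] at this
    linarith
  refine ContinuousAt.mul continuousAt_const (intervalIntegral.continuousAt_of_dominated_interval
    (bound := fun _ => (d / 2)⁻¹ * K) ?_ ?_ intervalIntegrable_const ?_)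
  · filter_upwards [hfar] with x hx
    refine winding_aestronglyMeasurable hγ.continuousOn ?_
    rintro ⟨t, ht, rfl⟩
    have := hx t ht
    simp at this
    linarith
  · filter_upwards [hfar] with x hx
    filter_upwards [ae_uIoc_mem_Ioo] with t ht h
    exact norm_winding_integrand_le hγ (half_pos hd) hx (ht h)
  · filter_upwards [ae_uIoc_mem_Ioo] with t ht h
    have hne : γ t - z ≠ 0 := fun h0 => hz ⟨t, ⟨(ht h).1.le, (ht h).2.le⟩, sub_eq_zero.1 h0⟩
    exact ((continuousAt_const.sub continuousAt_id).inv₀ hne).mul continuousAt_const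

/-- The kernel is at most (|z| - M)⁻¹ if the curve lies in the disc of radius M. -/
lemma eventually_norm_winding_lt {γ : ℝ → ℂ} {K : ℝ≥0} (hγ : LipschitzOnWith K γ (Icc 0 1)) {ε : ℝ}
    (hε : 0 < ε) : ∃ R : ℝ, ∀ z : ℂ, R < ‖z‖ → ‖winding γ z‖ < ε := by
  obtain ⟨M, hM⟩ := (isCompact_Icc.image_of_continuousOn hγ.continuousOn).isBounded.exists_norm_le
  have hM' : ∀ t ∈ Icc (0 : ℝ) 1, ‖γ t‖ ≤ M := fun t ht => hM _ (mem_image_of_mem _ ht)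
  have hM0 : 0 ≤ M := (norm_nonneg _).trans (hM' 0 (by simp))
  set c : ℝ := ‖(2 * Real.pi * Complex.I : ℂ)⁻¹‖ with hcdef
  refine ⟨M + 1 + c * K / ε, fun z hz => ?_⟩
  have hc0 : 0 ≤ c * K / ε := by positivity
  have hd : 0 < ‖z‖ - M := by linarith
  have hb : ∀ t ∈ Icc (0 : ℝ) 1, ‖z‖ - M ≤ ‖γ t - z‖ := fun t ht => by
    have := norm_sub_norm_le z (γ t)
    rw [norm_sub_rev] at this
    linarith [hM' t ht]
  have hle : ‖∫ t in (0 : ℝ)..1, (γ t - z)⁻¹ * deriv γ t‖ ≤ (‖z‖ - M)⁻¹ * K * |1 - 0| := by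
    refine intervalIntegral.norm_integral_le_of_norm_le_const_ae ?_
    filter_upwards [ae_uIoc_mem_Ioo] with t ht h
    exact norm_winding_integrand_le hγ hd hb (ht h)
  rw [winding, norm_mul, ← hcdef]
  calc c * _ ≤ c * ((‖z‖ - M)⁻¹ * K * |1 - 0|) := by gcongr
    _ = (c * K) / (‖z‖ - M) := by norm_num; field_simp
    _ < ε := by
      rw [div_lt_iff₀ hd]
      have : c * K / ε < ‖z‖ - M := by linarith
      rw [div_lt_iff₀ hε] at this
      linarith

/-! ### Positively oriented boundaries, Green's formula and cutoffs -/

lemma IsPositiveBoundary.isBounded {D : Set ℂ} {m : ℕ} {γ : Fin m → ℝ → ℂ}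
    (h : IsPositiveBoundary D γ) : Bornology.IsBounded D := by
  -- Far from the origin each of the m winding numbers is below 1/(m+1) in modulus, so they cannot
  -- add up to 1: no such point belongs to D.
  have hε : (0 : ℝ) < 1 / (m + 1) := by positivity
  choose K hK using fun k => (h.1 k).1
  choose R hR using fun k => eventually_norm_winding_lt (hK k) hε
  refine Metric.isBounded_closedBall.subset (s := D) (t := Metric.closedBall 0 (∑ k, |R k|))
    fun z hz => ?_
  by_contra hz'
  rw [Metric.mem_closedBall, dist_zero_right, not_le] at hz'
  have h1 := h.2.2.1 z hz
  have h2 : ‖∑ k, winding (γ k) z‖ ≤ ∑ _k : Fin m, (1 / (m + 1) : ℝ) :=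
    (norm_sum_le _ _).trans (Finset.sum_le_sum fun k _ => (hR k z (lt_of_le_of_lt
      ((le_abs_self _).trans (Finset.single_le_sum (f := fun k => |R k|)
        (fun _ _ => abs_nonneg _) (Finset.mem_univ k))) hz')).le)
  rw [h1, norm_one, Finset.sum_const, Finset.card_univ, Fintype.card_fin, nsmul_eq_mul,
    mul_one_div, le_div_iff₀ (by positivity)] at h2
  linarith

lemma IsPositiveBoundary.mem_frontier {D : Set ℂ} {m : ℕ} {γ : Fin m → ℝ → ℂ}
    (h : IsPositiveBoundary D γ) (k : Fin m) {t : ℝ} (ht : t ∈ Icc (0 : ℝ) 1) :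
    γ k t ∈ frontier D := by
  rw [h.2.1]; exact mem_iUnion_of_mem k (mem_image_of_mem _ ht)

/-- Green's formula. -/
theorem IsPositiveBoundary.sum_curveIntegral {D : Set ℂ} (hD : IsOpen D) {m : ℕ}
    {γ : Fin m → ℝ → ℂ} (h : IsPositiveBoundary D γ) {φ : ℂ → ℂ} (h1 : ContDiff ℝ 1 φ)
    (hc : HasCompactSupport φ) (h0 : ∀ w ∈ frontier D, dbar φ w = 0) :
    ∑ k, ∫ t in (0 : ℝ)..1, φ (γ k t) * deriv (γ k) t
      = Complex.I * ∫ w, D.indicator (dbar φ) w := by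
  choose K hK using fun k => (h.1 k).1
  rw [Finset.sum_congr rfl fun k _ => (curveIntegral_eq (hK k) h1 hc).2, ← Finset.mul_sum,
    ← integral_finsetSum _ fun k _ => (curveIntegral_eq (hK k) h1 hc).1]
  congr 1
  refine integral_congr_ae (Eventually.of_forall fun w => ?_)
  simp only [← Finset.mul_sum]
  by_cases hw : w ∈ D
  · rw [h.2.2.1 w hw, indicator_of_mem hw, mul_one]
  · rw [indicator_of_notMem hw]
    -- On the frontier nothing is prescribed for the winding number. There ∂̄φ = 0 by hypothesis, so
    -- the frontier need not be shown to be a null set.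
    by_cases hw' : w ∈ closure D
    · rw [h0 w ⟨hw', by rwa [hD.interior_eq]⟩, zero_mul]
    · rw [h.2.2.2 w hw', mul_zero]

open scoped ContDiff Manifold in
lemma exists_cutoff {K U : Set ℂ} (hK : IsCompact K) (hU : IsOpen U) (hKU : K ⊆ U) :
    ∃ χ : ℂ → ℝ, ContDiff ℝ 1 χ ∧ HasCompactSupport χ ∧ tsupport χ ⊆ U ∧ ∀ᶠ z in 𝓝ˢ K, χ z = 1 := by
  obtain ⟨L, hL, hKL, hLU⟩ := exists_compact_between hK hU hKU
  obtain ⟨f, hf1, hf0, -⟩ := exists_contMDiffMap_one_nhds_of_subset_interior (n := 1) 𝓘(ℝ, ℂ)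
    hK.isClosed hKL
  have hsupp : tsupport f ⊆ L := closure_minimal (fun z hz => by
    by_contra h; exact hz (hf0 z h)) hL.isClosed
  exact ⟨f, f.contMDiff.contDiff, hL.of_isClosed_subset (isClosed_tsupport _) hsupp,
    hsupp.trans hLU, hf1⟩

lemma exists_symmetric_cutoff {K U : Set ℂ} (hK : IsCompact K) (hU : IsOpen U) (hKU : K ⊆ U)
    (hs : ∀ z ∈ K, (starRingEnd ℂ) z ∈ K) :
    ∃ χ : ℂ → ℝ, ContDiff ℝ 1 χ ∧ HasCompactSupport χ ∧ tsupport χ ⊆ U ∧ (∀ᶠ z in 𝓝ˢ K, χ z = 1) ∧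
      ∀ z, χ ((starRingEnd ℂ) z) = χ z := by
  obtain ⟨χ, h1, hc, hsub, hev⟩ := exists_cutoff hK hU hKU
  refine ⟨fun z => χ z * χ ((starRingEnd ℂ) z), h1.mul (h1.comp Complex.conjCLE.contDiff),
    hc.mul_right, (tsupport_mul_subset_left (f := χ)).trans hsub, ?_, fun z => ?_⟩
  · rw [eventually_nhdsSet_iff_forall] at hev ⊢
    intro z hz
    have h2 := (Complex.continuous_conj.tendsto z).eventually (hev _ (hs z hz))
    filter_upwards [hev z hz, h2] with w hw hw'
    rw [hw, hw', one_mul]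
  · simp [mul_comm]

lemma dbar_congr {φ ψ : ℂ → ℂ} {w : ℂ} (h : φ =ᶠ[𝓝 w] ψ) : dbar φ w = dbar ψ w := by
  rw [dbar, dbar, h.fderiv_eq]

lemma dbar_of_differentiableAt {g : ℂ → ℂ} {w : ℂ} (h : DifferentiableAt ℂ g w) : dbar g w = 0 := by
  rw [dbar, h.fderiv_restrictScalars ℝ]
  have : fderiv ℂ g w Complex.I = Complex.I * fderiv ℂ g w 1 := by
    rw [← smul_eq_mul, ← map_smul, smul_eq_mul, mul_one]
  simp only [ContinuousLinearMap.coe_restrictScalars', this]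
  linear_combination (fderiv ℂ g w 1) * Complex.I_sq

lemma dbar_mul {φ ψ : ℂ → ℂ} {w : ℂ} (h : DifferentiableAt ℝ φ w) (h' : DifferentiableAt ℝ ψ w) :
    dbar (fun z => φ z * ψ z) w = dbar φ w * ψ w + φ w * dbar ψ w := by
  rw [dbar, dbar, dbar, fderiv_fun_mul h h']
  simp
  ring

/-- The integral over a contour of a function holomorphic near it, as an area integral
that does not involve the contour. -/
theorem IsPositiveBoundary.sum_integral_eq {D W C : Set ℂ} (hD : IsOpen D) (hW : IsOpen W) {m : ℕ}
    {γ : Fin m → ℝ → ℂ} (h : IsPositiveBoundary D γ) (hDW : closure D ⊆ W) (hC : IsClosed C)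
    (hCD : C ⊆ D) {g : ℂ → ℂ} (hg : DifferentiableOn ℂ g (W \ C)) {χ : ℂ → ℝ} (h1 : ContDiff ℝ 1 χ)
    (hc : HasCompactSupport χ) (hχD : tsupport χ ⊆ D) (hχ : ∀ᶠ z in 𝓝ˢ C, χ z = 1) :
    ∑ k, ∫ t in (0 : ℝ)..1, g (γ k t) * deriv (γ k) t
      = -Complex.I * ∫ w, dbar (fun z => (χ z : ℂ)) w * g w := by
  obtain ⟨η, hη1, hηc, hηW, hη⟩ := exists_cutoff h.isBounded.isCompact_closure hW hDW
  rw [eventually_nhdsSet_iff_forall] at hη hχ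
  have hχc1 : ContDiff ℝ 1 fun z => (χ z : ℂ) := Complex.ofRealCLM.contDiff.comp h1
  have hηc1 : ContDiff ℝ 1 fun z => (η z : ℂ) := Complex.ofRealCLM.contDiff.comp hη1
  set φ : ℂ → ℂ := fun z => ((η z : ℂ) - χ z) * g z with hφ
  have hDcl : ∀ {z}, z ∈ D → z ∈ closure D := fun hz => subset_closure hz
  have hgat : ∀ z ∈ W \ C, ∀ᶠ w in 𝓝 z, DifferentiableAt ℂ g w := fun z hz => by
    filter_upwards [(hW.sdiff hC).mem_nhds hz] with w hw
    exact hg.differentiableAt ((hW.sdiff hC).mem_nhds hw)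
  have hC0 : ∀ z ∈ C, φ =ᶠ[𝓝 z] fun _ => 0 := fun z hz => by
    filter_upwards [hη z (hDcl (hCD hz)), hχ z hz] with w hw hw'
    simp [hφ, hw, hw']
  have hχ0 : ∀ z ∉ D, χ =ᶠ[𝓝 z] fun _ => 0 := fun z hz =>
    notMem_tsupport_iff_eventuallyEq.1 fun hz' => hz (hχD hz')
  have hφ1 : ContDiff ℝ 1 φ := by
    rw [contDiff_iff_contDiffAt]
    intro z
    by_cases hzC : z ∈ C
    · exact contDiffAt_const.congr_of_eventuallyEq (hC0 z hzC)
    by_cases hzW : z ∈ W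
    · have han : AnalyticAt ℂ g z :=
        hg.analyticAt ((hW.sdiff hC).mem_nhds ⟨hzW, hzC⟩)
      exact (hηc1.contDiffAt.sub hχc1.contDiffAt).mul (han.contDiffAt.restrict_scalars ℝ)
    · have e1 : η =ᶠ[𝓝 z] fun _ => 0 :=
        notMem_tsupport_iff_eventuallyEq.1 fun hz' => hzW (hηW hz')
      refine contDiffAt_const (c := (0 : ℂ)) |>.congr_of_eventuallyEq ?_
      filter_upwards [e1, hχ0 z fun hz => hzW (hDW (hDcl hz))] with w hw hw'
      simp [hφ, hw, hw']
  have hφc : HasCompactSupport φ := by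
    refine HasCompactSupport.intro (hηc.isCompact.union hc.isCompact) fun z hz => ?_
    rw [mem_union, not_or] at hz
    simp [hφ, image_eq_zero_of_notMem_tsupport hz.1, image_eq_zero_of_notMem_tsupport hz.2]
  have hfr : ∀ z ∈ frontier D, φ =ᶠ[𝓝 z] g := fun z hz => by
    have hzD : z ∉ D := by have := hz.2; rwa [hD.interior_eq] at this
    filter_upwards [hη z hz.1, hχ0 z hzD] with w hw hw'
    simp [hφ, hw, hw']
  have hfrWC : ∀ z ∈ frontier D, z ∈ W \ C := fun z hz =>
    ⟨hDW hz.1, fun hzC => hz.2 (by rw [hD.interior_eq]; exact hCD hzC)⟩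
  have key := h.sum_curveIntegral hD hφ1 hφc fun z hz => by
    rw [dbar_congr (hfr z hz)]
    exact dbar_of_differentiableAt (hgat z (hfrWC z hz)).self_of_nhds
  have hL : ∑ k, ∫ t in (0 : ℝ)..1, φ (γ k t) * deriv (γ k) t
      = ∑ k, ∫ t in (0 : ℝ)..1, g (γ k t) * deriv (γ k) t := by
    refine Finset.sum_congr rfl fun k _ => intervalIntegral.integral_congr fun t ht => ?_
    rw [uIcc_of_le zero_le_one] at ht
    simp only [(hfr _ (h.mem_frontier k ht)).eq_of_nhds]
  rw [← hL, key, neg_mul, ← mul_neg, ← integral_neg]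
  congr 1
  refine integral_congr_ae (Eventually.of_forall fun z => ?_)
  simp only
  by_cases hzD : z ∈ D
  · rw [indicator_of_mem hzD]
    by_cases hzC : z ∈ C
    · have e : (fun z => (χ z : ℂ)) =ᶠ[𝓝 z] fun _ => 1 := by
        filter_upwards [hχ z hzC] with w hw
        simp [hw]
      rw [dbar_congr (hC0 z hzC), dbar_congr e]
      simp [dbar]
    · have e : φ =ᶠ[𝓝 z] fun w => (1 - χ w : ℂ) * g w := by
        filter_upwards [hη z (hDcl hzD)] with w hw
        simp [hφ, hw]
      have hgz := (hgat z ⟨hDW (hDcl hzD), hzC⟩).self_of_nhds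
      have hχz := hχc1.differentiable one_ne_zero z
      have hd : DifferentiableAt ℝ (fun z => (1 - χ z : ℂ)) z := hχz.const_sub 1
      rw [dbar_congr e, dbar_mul hd (hgz.restrictScalars ℝ),
        dbar_of_differentiableAt hgz]
      simp only [dbar, fderiv_const_sub]
      simp
      ring
  · have e : (fun z => (χ z : ℂ)) =ᶠ[𝓝 z] fun _ => 0 := by
      filter_upwards [hχ0 z hzD] with w hw
      simp [hw]
    rw [indicator_of_notMem hzD, dbar_congr e]
    simp [dbar]

/-! ### The S-resolvent in a real Banach algebra -/

section Core

variable {E : Type*} [NormedRing E] [NormedAlgebra ℝ E]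

/-- The operator `T² - 2 Re(z) T + |z|²`. -/
def planarPencil (T : E) (z : ℂ) : E := T ^ 2 - (2 * z.re) • T + (‖z‖ ^ 2) • (1 : E)

/-- The set of the `z` for which `T² - 2 Re(z) T + |z|²` is not invertible. -/
def planarSpectrum (T : E) : Set ℂ := {z | ¬ IsUnit (planarPencil T z)}

/-- The element `Re(z) + Im(z) i`, for an imaginary unit `i` of an algebra. -/
def cplx (i : E) (z : ℂ) : E := z.re • (1 : E) + z.im • i

/-- The `S`-resolvent on the complex plane spanned by `1` and `i`. -/
def planarResolvent (T i : E) (z : ℂ) : E :=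
  Ring.inverse (planarPencil T z) * (cplx i ((starRingEnd ℂ) z) - T)

lemma planarPencil_eq (T : E) (z : ℂ) :
    planarPencil T z = T ^ 2 - (2 * z.re) • T + (z.re ^ 2 + z.im ^ 2) • (1 : E) := by
  rw [planarPencil, Complex.sq_norm, Complex.normSq_apply, sq, sq, sq]

@[simp] lemma planarPencil_conj (T : E) (z : ℂ) :
    planarPencil T ((starRingEnd ℂ) z) = planarPencil T z := by
  simp [planarPencil]

/-- Replaces the factorization (z̄ - T)(z - T), which fails when T and i do not commute: the mixed
terms combine to -T(z + z̄), where z + z̄ is real. -/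
lemma planarPencil_eq_cplx_mul {i : E} (hi : i * i = -1) (T : E) (z : ℂ) :
    planarPencil T z = (cplx i ((starRingEnd ℂ) z) - T) * cplx i z
      - T * (cplx i ((starRingEnd ℂ) z) - T) := by
  rw [planarPencil_eq]
  simp only [cplx, Complex.conj_re, Complex.conj_im, mul_add, add_mul, sub_mul, mul_sub,
    smul_mul_assoc, mul_smul_comm, mul_one, one_mul]
  rw [hi, sq T]
  module

lemma commute_planarPencil (T : E) (z : ℂ) : Commute T (planarPencil T z) := by
  rw [planarPencil]
  exact (((Commute.refl T).pow_right 2).sub_right ((Commute.refl T).smul_right _)).add_right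
    ((Commute.one_right T).smul_right _)

omit [NormedAlgebra ℝ E] in
lemma commute_ringInverse {a b : E} (h : Commute a b) : Commute a (Ring.inverse b) := by
  by_cases hb : IsUnit b
  · obtain ⟨u, rfl⟩ := hb
    rw [Ring.inverse_unit]
    exact h.units_inv_right
  · rw [Ring.inverse_non_unit _ hb]
    exact Commute.zero_right a

lemma commute_inverse_planarPencil (T : E) (z : ℂ) :
    Commute T (Ring.inverse (planarPencil T z)) :=
  commute_ringInverse (commute_planarPencil T z)

lemma planarPencil_mul_resolvent (T i : E) {z : ℂ} (hz : z ∉ planarSpectrum T) :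
    planarPencil T z * planarResolvent T i z = cplx i ((starRingEnd ℂ) z) - T := by
  rw [planarResolvent, ← mul_assoc, Ring.mul_inverse_cancel _ (not_not.1 hz), one_mul]

/-- The `S`-resolvent equation `S⁻¹(z,T) z - T S⁻¹(z,T) = 1`. -/
lemma planarResolvent_mul {i : E} (hi : i * i = -1) (T : E) {z : ℂ} (hz : z ∉ planarSpectrum T) :
    planarResolvent T i z * cplx i z = T * planarResolvent T i z + 1 := by
  rw [planarResolvent, ← mul_assoc T, (commute_inverse_planarPencil T z).eq, mul_assoc, mul_assoc,
    ← sub_eq_iff_eq_add', ← mul_sub, ← planarPencil_eq_cplx_mul hi,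
    Ring.inverse_mul_cancel _ (not_not.1 hz)]

lemma hasFDerivAt_planarPencil (T : E) (z : ℂ) : HasFDerivAt (planarPencil T)
    ((Complex.reCLM.smulRight ((2 * z.re) • (1 : E) - (2 : ℝ) • T))
      + Complex.imCLM.smulRight ((2 * z.im) • (1 : E))) z := by
  have hre : HasFDerivAt (fun w : ℂ => w.re) Complex.reCLM z := Complex.reCLM.hasFDerivAt
  have him : HasFDerivAt (fun w : ℂ => w.im) Complex.imCLM z := Complex.imCLM.hasFDerivAt
  have h := (((hre.const_mul 2).smul_const T).const_sub (T ^ 2)).add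
    (((hre.pow 2).add (him.pow 2)).smul_const (1 : E))
  refine (h.congr_fderiv ?_).congr_of_eventuallyEq (Eventually.of_forall fun w => planarPencil_eq T w)
  ext w
  simp
  module

lemma continuous_planarPencil (T : E) : Continuous (planarPencil T) := by
  unfold planarPencil
  fun_prop

lemma continuous_cplx (i : E) : Continuous (cplx i) := by
  unfold cplx
  fun_prop

/-- `z ↦ cplx i z`, as a continuous linear map. -/
def cplxCLM (i : E) : ℂ →L[ℝ] E :=
  Complex.reCLM.smulRight (1 : E) + Complex.imCLM.smulRight i

lemma cplxCLM_apply (i : E) (z : ℂ) : cplxCLM i z = cplx i z := rfl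

variable [CompleteSpace E]

lemma isClosed_planarSpectrum (T : E) : IsClosed (planarSpectrum T) := by
  have : IsOpen {z | IsUnit (planarPencil T z)} :=
    Units.isOpen.preimage (continuous_planarPencil T)
  exact ⟨by simpa [planarSpectrum, compl_ofPred] using this⟩

lemma differentiableAt_planarResolvent (T i : E) {z : ℂ} (hz : z ∉ planarSpectrum T) :
    DifferentiableAt ℝ (planarResolvent T i) z := by
  obtain ⟨u, hu⟩ := not_not.1 hz
  have h1 : DifferentiableAt ℝ (Ring.inverse : E → E) (planarPencil T z) := by
    rw [← hu]
    exact (hasFDerivAt_ringInverse (𝕜 := ℝ) u).differentiableAt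
  refine (h1.comp z (hasFDerivAt_planarPencil T z).differentiableAt).mul
    (DifferentiableAt.sub_const ?_ T)
  exact ((cplxCLM i).comp Complex.conjCLE.toContinuousLinearMap).differentiableAt

/-- The `S`-resolvent is right holomorphic. -/
lemma fderiv_planarResolvent {i : E} (hi : i * i = -1) (T : E) {z : ℂ} (hz : z ∉ planarSpectrum T) :
    fderiv ℝ (planarResolvent T i) z 1 + fderiv ℝ (planarResolvent T i) z Complex.I * i = 0 := by
  -- The derivative of the resolvent is found by differentiating Q S = z̄ - T, where Q is the
  -- pencil, instead of the inverse.
  have hev : (fun w => planarPencil T w * planarResolvent T i w) =ᶠ[𝓝 z]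
      fun w => cplx i ((starRingEnd ℂ) w) - T := by
    filter_upwards [(isClosed_planarSpectrum T).isOpen_compl.mem_nhds hz] with w hw
    exact planarPencil_mul_resolvent T i hw
  have hR : HasFDerivAt (fun w => cplx i ((starRingEnd ℂ) w) - T)
      ((cplxCLM i).comp Complex.conjCLE.toContinuousLinearMap) z :=
    (((cplxCLM i).comp Complex.conjCLE.toContinuousLinearMap).hasFDerivAt).sub_const T
  have hL := (hasFDerivAt_planarPencil T z).mul' (differentiableAt_planarResolvent T i hz).hasFDerivAt
  have hE := (hL.congr_of_eventuallyEq hev.symm).unique hR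
  have hu := DFunLike.congr_fun hE 1
  have hv := DFunLike.congr_fun hE Complex.I
  simp [cplxCLM] at hu hv
  have hQ : IsUnit (planarPencil T z) := not_not.1 hz
  -- With Q_u = 2(u - T) and Q_v = 2v one gets Q(S_u + S_v i) = 2(1 + T S - S z), which is zero by
  -- the resolvent equation.
  refine hQ.mul_left_cancel ?_
  rw [mul_add, ← mul_assoc, mul_zero]
  have e1 := eq_sub_of_add_eq hu
  have e2 := eq_sub_of_add_eq hv
  have hS := planarResolvent_mul hi T hz
  rw [cplx] at hS
  rw [e1, e2]
  simp only [sub_mul, mul_add, mul_smul_comm, smul_mul_assoc, mul_one, one_mul, neg_mul, hi] at hS ⊢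
  rw [eq_comm, ← sub_eq_iff_eq_add'] at hS
  rw [mul_smul 2 z.im, ← hS]
  module

end Core

/-! ### Left holomorphic functions; from contour integrals to area integrals -/

section Core

variable {E : Type*} [NormedRing E] [NormedAlgebra ℝ E]

/-- `h` is differentiable at `z` and satisfies `(∂_u + i ∂_v) h = 0` there. -/
def LeftHolAt (i : E) (h : ℂ → E) (z : ℂ) : Prop :=
  DifferentiableAt ℝ h z ∧ fderiv ℝ h z 1 + i * fderiv ℝ h z Complex.I = 0

/-- A pair satisfying the Cauchy–Riemann equations gives scalar holomorphic functions. -/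
lemma differentiableAt_of_cauchyRiemann {E : Type*} [NormedAddCommGroup E] [NormedSpace ℝ E]
    {P Q : ℂ → E} {z : ℂ} (hP : DifferentiableAt ℝ P z)
    (hQ : DifferentiableAt ℝ Q z) (h1 : fderiv ℝ Q z 1 = fderiv ℝ P z Complex.I)
    (h2 : fderiv ℝ P z 1 = -fderiv ℝ Q z Complex.I) (ℓ : E →L[ℝ] ℝ) :
    DifferentiableAt ℂ (fun w => (ℓ (P w) : ℂ) - Complex.I * ℓ (Q w)) z := by
  have hd : HasFDerivAt (fun w => (ℓ (P w) : ℂ) - Complex.I * ℓ (Q w))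
      ((Complex.ofRealCLM ∘L ℓ ∘L fderiv ℝ P z) -
        Complex.I • (Complex.ofRealCLM ∘L ℓ ∘L fderiv ℝ Q z)) z :=
    ((Complex.ofRealCLM ∘L ℓ).hasFDerivAt.comp z hP.hasFDerivAt).sub
      (((Complex.ofRealCLM ∘L ℓ).hasFDerivAt.comp z hQ.hasFDerivAt).const_mul Complex.I)
  rw [differentiableAt_complex_iff_differentiableAt_real]
  refine ⟨hd.differentiableAt, ?_⟩
  rw [hd.fderiv]
  simp only [sub_apply, ContinuousLinearMap.comp_apply, smul_apply, Complex.ofRealCLM_apply, h1, h2,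
    smul_eq_mul, map_neg]
  linear_combination (ℓ (fderiv ℝ P z Complex.I) : ℂ) * Complex.I_sq

/-- The pair h, i h satisfies the Cauchy–Riemann equations because i(∂_u h) = ∂_v h. The real part
of the resulting scalar function is ℓ(h), so h can be recovered from these functions. -/
lemma LeftHolAt.differentiableAt_scalar {i : E} (hi : i * i = -1) {h : ℂ → E} {z : ℂ}
    (hh : LeftHolAt i h z) (ℓ : E →L[ℝ] ℝ) :
    DifferentiableAt ℂ (fun w => (ℓ (h w) : ℂ) - Complex.I * ℓ (i * h w)) z := by
  refine differentiableAt_of_cauchyRiemann hh.1 (hh.1.const_mul i) ?_ ?_ ℓ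
  · rw [fderiv_const_mul hh.1]
    simp only [smul_apply, smul_eq_mul]
    rw [eq_neg_of_add_eq_zero_left hh.2, mul_neg, ← mul_assoc, hi, neg_one_mul, neg_neg]
  · rw [fderiv_const_mul hh.1, eq_neg_of_add_eq_zero_left hh.2]
    simp

variable [CompleteSpace E]

/-- The functions `-S i h` and `S h` satisfy the Cauchy–Riemann equations. -/
lemma LeftHolAt.cauchyRiemann_resolvent {i : E} (hi : i * i = -1) {T : E} {h : ℂ → E} {z : ℂ}
    (hh : LeftHolAt i h z) (hz : z ∉ planarSpectrum T) (ℓ : E →L[ℝ] ℝ) :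
    DifferentiableAt ℂ (fun w => (ℓ (-(planarResolvent T i w * i * h w)) : ℂ)
      - Complex.I * ℓ (planarResolvent T i w * h w)) z := by
  have hS := differentiableAt_planarResolvent T i hz
  have e1 := eq_neg_of_add_eq_zero_left (fderiv_planarResolvent hi T hz)
  have e2 := eq_neg_of_add_eq_zero_left hh.2
  have h1 : fderiv ℝ (fun w => planarResolvent T i w * i) z
      = MulOpposite.op i • fderiv ℝ (planarResolvent T i) z := fderiv_mul_const' hS i
  refine differentiableAt_of_cauchyRiemann ((hS.mul_const i).fun_mul hh.1).fun_neg (hS.fun_mul hh.1)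
    ?_ ?_ ℓ
  · rw [fderiv_fun_neg, fderiv_fun_mul' hS hh.1, fderiv_fun_mul' (hS.mul_const i) hh.1, h1]
    simp [e1, e2, mul_assoc]
    abel
  · have hii : ∀ x, i * (i * x) = -x := fun x => by rw [← mul_assoc, hi, neg_one_mul]
    rw [fderiv_fun_neg, fderiv_fun_mul' hS hh.1, fderiv_fun_mul' (hS.mul_const i) hh.1, h1]
    simp [e1, e2, mul_assoc, hii]

/-- The complex number `∂_u χ + i ∂_v χ`. -/
def gradC (χ : ℂ → ℝ) (z : ℂ) : ℂ := ⟨fderiv ℝ χ z 1, fderiv ℝ χ z Complex.I⟩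

lemma gradC_eq_dbar {χ : ℂ → ℝ} (h : Differentiable ℝ χ) (z : ℂ) :
    gradC χ z = dbar (fun w => (χ w : ℂ)) z := by
  have : fderiv ℝ (fun w => (χ w : ℂ)) z = Complex.ofRealCLM ∘L fderiv ℝ χ z :=
    (Complex.ofRealCLM.hasFDerivAt.comp z (h z).hasFDerivAt).fderiv
  rw [dbar, this]
  apply Complex.ext <;> simp [gradC]

lemma continuous_gradC {χ : ℂ → ℝ} (h : ContDiff ℝ 1 χ) : Continuous (gradC χ) := by
  have h2 : Continuous (dbar fun w => (χ w : ℂ)) :=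
    continuous_dbar (Complex.ofRealCLM.contDiff.comp h)
  exact h2.congr fun z => (gradC_eq_dbar (h.differentiable one_ne_zero) z).symm

lemma gradC_eq_zero_of_eventually_eq {χ : ℂ → ℝ} {z : ℂ} {c : ℝ} (h : ∀ᶠ w in 𝓝 z, χ w = c) :
    gradC χ z = 0 := by
  have : χ =ᶠ[𝓝 z] fun _ => c := h
  rw [gradC, this.fderiv_eq]
  apply Complex.ext <;> simp

/-- The integrand of the area form of the functional calculus. -/
def areaIntegrand (T i : E) (χ : ℂ → ℝ) (h : ℂ → E) (z : ℂ) : E :=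
  planarResolvent T i z * cplx i (gradC χ z) * h z

/-- A cutoff function for `T` inside the open set `D`: it equals `1` near the spectrum. -/
structure IsCutoff (T : E) (D : Set ℂ) (χ : ℂ → ℝ) : Prop where
  contDiff : ContDiff ℝ 1 χ
  compact : HasCompactSupport χ
  subset : tsupport χ ⊆ D
  eventually : ∀ z ∈ planarSpectrum T, ∀ᶠ w in 𝓝 z, χ w = 1

lemma tsupport_gradC_subset (χ : ℂ → ℝ) : tsupport (gradC χ) ⊆ tsupport χ := by
  refine closure_minimal (fun z hz => ?_) (isClosed_tsupport _)
  by_contra h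
  exact hz (gradC_eq_zero_of_eventually_eq (notMem_tsupport_iff_eventuallyEq.1 h))

-- The cutoff is constant near each point of the spectrum, so the support of its gradient avoids the
-- spectrum. The area integrand is therefore continuous on a compact set and zero elsewhere.
omit [CompleteSpace E] in
lemma IsCutoff.notMem_spectrum {T : E} {D : Set ℂ} {χ : ℂ → ℝ} (hχ : IsCutoff T D χ) {z : ℂ}
    (hz : z ∈ tsupport (gradC χ)) : z ∉ planarSpectrum T := fun h => by
  refine notMem_tsupport_iff_eventuallyEq.2 ?_ hz
  filter_upwards [(hχ.eventually z h).eventually_nhds] with w hw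
  exact gradC_eq_zero_of_eventually_eq hw

omit [CompleteSpace E] in
lemma areaIntegrand_eq_zero {T i : E} {χ : ℂ → ℝ} {h : ℂ → E} {z : ℂ} (hz : z ∉ tsupport (gradC χ)) :
    areaIntegrand T i χ h z = 0 := by
  rw [areaIntegrand, image_eq_zero_of_notMem_tsupport hz]
  simp [cplx]

lemma IsCutoff.continuousOn_areaIntegrand {T : E} {D : Set ℂ} {χ : ℂ → ℝ} (hχ : IsCutoff T D χ)
    (i : E) {h : ℂ → E} (hh : ContinuousOn h D) :
    ContinuousOn (areaIntegrand T i χ h) (tsupport (gradC χ)) := by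
  refine ContinuousOn.mul (ContinuousOn.mul (fun z hz => ?_) ?_)
    (hh.mono ((tsupport_gradC_subset χ).trans hχ.subset))
  · exact (differentiableAt_planarResolvent T i (hχ.notMem_spectrum hz)).continuousAt.continuousWithinAt
  · exact ((continuous_cplx i).comp (continuous_gradC hχ.contDiff)).continuousOn

omit [CompleteSpace E] in
lemma IsCutoff.isCompact_tsupport_gradC {T : E} {D : Set ℂ} {χ : ℂ → ℝ} (hχ : IsCutoff T D χ) :
    IsCompact (tsupport (gradC χ)) :=
  hχ.compact.isCompact.of_isClosed_subset (isClosed_tsupport _) (tsupport_gradC_subset χ)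

lemma IsCutoff.integrable {T : E} {D : Set ℂ} {χ : ℂ → ℝ} (hχ : IsCutoff T D χ)
    (i : E) {h : ℂ → E} (hh : ContinuousOn h D) : Integrable (areaIntegrand T i χ h) := by
  have h1 : IntegrableOn (areaIntegrand T i χ h) (tsupport (gradC χ)) :=
    (hχ.continuousOn_areaIntegrand i hh).integrableOn_compact hχ.isCompact_tsupport_gradC
  refine (integrableOn_iff_integrable_of_support_subset fun z hz => ?_).1 h1
  by_contra hn
  exact hz (areaIntegrand_eq_zero hn)

/-- The integrand of the contour integral. -/
def contourIntegrand (T i : E) (h : ℂ → E) (γ : ℝ → ℂ) (t : ℝ) : E :=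
  planarResolvent T i (γ t) * (-(cplx i (deriv γ t) * i) * h (γ t))

-- In this form a real functional ℓ maps the integrand to the real part of G(γ) γ', where G = ℓ(-S i
-- h) - i ℓ(S h) is holomorphic.
omit [CompleteSpace E] in
lemma contourIntegrand_eq {i : E} (hi : i * i = -1) (T : E) (h : ℂ → E) (γ : ℝ → ℂ) (t : ℝ) :
    contourIntegrand T i h γ t = (deriv γ t).re • (-(planarResolvent T i (γ t) * i * h (γ t)))
      + (deriv γ t).im • (planarResolvent T i (γ t) * h (γ t)) := by
  simp only [contourIntegrand, cplx, add_mul, smul_mul_assoc, hi, one_mul, neg_add, smul_neg,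
    neg_neg, mul_add, mul_neg, mul_smul_comm, neg_mul, mul_assoc]

omit [NormedAlgebra ℝ E] [CompleteSpace E] in
lemma intervalIntegrable_smul_curve {E : Type*} [NormedAddCommGroup E] [NormedSpace ℝ E]
    {γ : ℝ → ℂ} {K : ℝ≥0} (hγ : LipschitzOnWith K γ (Icc 0 1))
    {F : ℂ → E} (hF : ContinuousOn F (γ '' Icc 0 1)) {a : ℂ →L[ℝ] ℝ} :
    IntervalIntegrable (fun t => a (deriv γ t) • F (γ t)) volume 0 1 := by
  obtain ⟨M, hM⟩ := (isCompact_Icc.image_of_continuousOn hγ.continuousOn).exists_bound_of_continuousOn hF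
  rw [intervalIntegrable_iff]
  refine (integrableOn_const (C := ‖a‖ * K * M) (by simp)).mono' ?_ ?_
  · exact (a.measurable.comp (measurable_deriv γ)).aestronglyMeasurable.smul
      (aestronglyMeasurable_comp_curve hF hγ.continuousOn)
  · rw [ae_restrict_iff' measurableSet_uIoc]
    filter_upwards [ae_uIoc_mem_Ioo] with t ht h
    have ht' := ht h
    rw [norm_smul]
    have := hM (γ t) (mem_image_of_mem _ ⟨ht'.1.le, ht'.2.le⟩)
    have h2 := (a.le_opNorm (deriv γ t)).trans
      (mul_le_mul_of_nonneg_left (norm_deriv_le_of_mem_Ioo hγ ht') (norm_nonneg a))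
    exact mul_le_mul h2 this (norm_nonneg _) (by positivity)

/-- The contour integral of the functional calculus converges, and it equals an area integral. -/
theorem IsPositiveBoundary.contour_eq_area {D W : Set ℂ} (hD : IsOpen D) (hW : IsOpen W) {m : ℕ}
    {γ : Fin m → ℝ → ℂ} (h : IsPositiveBoundary D γ) (hDW : closure D ⊆ W) {T i : E}
    (hi : i * i = -1) (hT : planarSpectrum T ⊆ D) {f : ℂ → E} (hf : ∀ z ∈ W, LeftHolAt i f z)
    {χ : ℂ → ℝ} (hχ : IsCutoff T D χ) :
    (∀ k, IntervalIntegrable (contourIntegrand T i f (γ k)) volume 0 1) ∧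
      ∑ k, ∫ t in (0 : ℝ)..1, contourIntegrand T i f (γ k) t = -∫ z, areaIntegrand T i χ f z := by
  have hfc : ContinuousOn f W := fun z hz => (hf z hz).1.continuousAt.continuousWithinAt
  have hfD : ContinuousOn f D := hfc.mono (subset_closure.trans hDW)
  have hmem : ∀ k, γ k '' Icc 0 1 ⊆ W \ planarSpectrum T := by
    rintro k _ ⟨t, ht, rfl⟩
    have := h.mem_frontier k ht
    exact ⟨hDW this.1, fun hs => this.2 (by rw [hD.interior_eq]; exact hT hs)⟩
  choose K hK using fun k => (h.1 k).1
  have hSc : ContinuousOn (planarResolvent T i) (W \ planarSpectrum T) := fun z hz =>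
    (differentiableAt_planarResolvent T i hz.2).continuousAt.continuousWithinAt
  have hPc : ContinuousOn (fun z => -(planarResolvent T i z * i * f z)) (W \ planarSpectrum T) :=
    ((hSc.mul continuousOn_const).mul (hfc.mono sdiff_subset)).neg
  have hQc : ContinuousOn (fun z => planarResolvent T i z * f z) (W \ planarSpectrum T) :=
    hSc.mul (hfc.mono sdiff_subset)
  have hint : ∀ k, IntervalIntegrable (contourIntegrand T i f (γ k)) volume 0 1 := fun k => by
    have := (intervalIntegrable_smul_curve (hK k) (hPc.mono (hmem k)) (a := Complex.reCLM)).add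
      (intervalIntegrable_smul_curve (hK k) (hQc.mono (hmem k)) (a := Complex.imCLM))
    refine this.congr fun t _ => ?_
    simp only [contourIntegrand_eq hi]
    rfl
  -- Real functionals separate the points of E, so the identity is checked after applying ℓ, where
  -- it is the real part of the scalar formula for the holomorphic function `G`.
  refine ⟨hint, (SeparatingDual.eq_iff_forall_dual_eq (R := ℝ)).2 fun ℓ => ?_⟩
  set G : ℂ → ℂ := fun w => (ℓ (-(planarResolvent T i w * i * f w)) : ℂ)
      - Complex.I * ℓ (planarResolvent T i w * f w) with hG
  have hGd : DifferentiableOn ℂ G (W \ planarSpectrum T) := fun z hz =>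
    ((hf z hz.1).cauchyRiemann_resolvent hi hz.2 ℓ).differentiableWithinAt
  have key := h.sum_integral_eq hD hW hDW (isClosed_planarSpectrum T) hT hGd hχ.contDiff hχ.compact
    hχ.subset (eventually_nhdsSet_iff_forall.2 hχ.eventually)
  have hGint : ∀ k, IntervalIntegrable (fun t => G (γ k t) * deriv (γ k) t) volume 0 1 := fun k => by
    have h1 := intervalIntegrable_smul_curve (hK k) (hGd.continuousOn.mono (hmem k))
      (a := Complex.reCLM)
    have h2 := intervalIntegrable_smul_curve (hK k) (hGd.continuousOn.mono (hmem k))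
      (a := Complex.imCLM)
    refine (h1.add (h2.mul_const Complex.I)).congr fun t _ => ?_
    simp only [Complex.real_smul, Complex.reCLM_apply, Complex.imCLM_apply]
    nth_rewrite 3 [← Complex.re_add_im (deriv (γ k) t)]
    ring
  have hL : ℓ (∑ k, ∫ t in (0 : ℝ)..1, contourIntegrand T i f (γ k) t)
      = (∑ k, ∫ t in (0 : ℝ)..1, G (γ k t) * deriv (γ k) t).re := by
    rw [map_sum, Complex.re_sum]
    refine Finset.sum_congr rfl fun k _ => ?_
    rw [← ContinuousLinearMap.intervalIntegral_comp_comm _ (hint k), ← Complex.reCLM_apply,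
      ← ContinuousLinearMap.intervalIntegral_comp_comm _ (hGint k)]
    refine intervalIntegral.integral_congr fun t _ => ?_
    simp only [contourIntegrand_eq hi, hG, map_add, map_smul, Complex.reCLM_apply]
    simp
    ring
  rw [hL, key, map_neg, ← ContinuousLinearMap.integral_comp_comm _ (hχ.integrable i hfD)]
  have hχd := hχ.contDiff.differentiable one_ne_zero
  have hR : ∀ z, (-Complex.I * (dbar (fun z => (χ z : ℂ)) z * G z)).re
      = -ℓ (areaIntegrand T i χ f z) := by
    intro z
    rw [← gradC_eq_dbar hχd]
    simp only [areaIntegrand, hG, cplx, mul_add, add_mul, mul_smul_comm, smul_mul_assoc, mul_one,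
      map_add, map_smul, map_neg, smul_eq_mul]
    simp
    ring
  have hdG : Integrable fun z => dbar (fun z => (χ z : ℂ)) z * G z := by
    have h1 : IntegrableOn (fun z => dbar (fun z => (χ z : ℂ)) z * G z) (tsupport (gradC χ)) := by
      refine ContinuousOn.integrableOn_compact hχ.isCompact_tsupport_gradC (ContinuousOn.mul ?_ ?_)
      · exact ((continuous_gradC hχ.contDiff).congr (gradC_eq_dbar hχd)).continuousOn
      · exact hGd.continuousOn.mono fun z hz => ⟨hDW (subset_closure
          (hχ.subset (tsupport_gradC_subset χ hz))), hχ.notMem_spectrum hz⟩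
    refine (integrableOn_iff_integrable_of_support_subset fun z hz => ?_).1 h1
    by_contra hn
    refine hz ?_
    simp only
    rw [← gradC_eq_dbar hχd, image_eq_zero_of_notMem_tsupport hn, zero_mul]
  rw [← integral_neg, ← integral_const_mul, ← Complex.reCLM_apply,
    ← ContinuousLinearMap.integral_comp_comm _ (hdG.const_mul _)]
  exact integral_congr_ae (Eventually.of_forall hR)

end Core

/-! ### The representation formula and the change of imaginary unit -/

section Core

variable {E : Type*} [NormedRing E] [NormedAlgebra ℝ E]

lemma fderiv_comp_conj {h : ℂ → E} {z : ℂ} (hd : DifferentiableAt ℝ h ((starRingEnd ℂ) z)) (v : ℂ) :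
    fderiv ℝ (fun w => h ((starRingEnd ℂ) w)) z v
      = fderiv ℝ h ((starRingEnd ℂ) z) ((starRingEnd ℂ) v) := by
  have := hd.hasFDerivAt.comp z (Complex.conjCLE.toContinuousLinearMap.hasFDerivAt (x := z))
  have h2 : fderiv ℝ (fun w => h ((starRingEnd ℂ) w)) z = _ := this.fderiv
  rw [h2]
  rfl

lemma differentiableAt_comp_conj {h : ℂ → E} {z : ℂ}
    (hd : DifferentiableAt ℝ h ((starRingEnd ℂ) z)) :
    DifferentiableAt ℝ (fun w => h ((starRingEnd ℂ) w)) z :=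
  hd.comp z Complex.conjCLE.differentiableAt

/-- Identity theorem for left holomorphic functions. -/
lemma eqOn_zero_of_leftHol {i : E} (hi : i * i = -1) {N : Set ℂ} (hN : IsOpen N)
    (hc : IsPreconnected N) {h : ℂ → E} (hh : ∀ z ∈ N, LeftHolAt i h z) {x₀ : ℝ} (hx : (x₀ : ℂ) ∈ N)
    (h0 : ∀ x : ℝ, (x : ℂ) ∈ N → h x = 0) : ∀ z ∈ N, h z = 0 := by
  intro z hz
  refine (SeparatingDual.eq_iff_forall_dual_eq (R := ℝ)).2 fun ℓ => ?_
  set g : ℂ → ℂ := fun w => (ℓ (h w) : ℂ) - Complex.I * ℓ (i * h w) with hg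
  have hgd : DifferentiableOn ℂ g N := fun w hw =>
    ((hh w hw).differentiableAt_scalar hi ℓ).differentiableWithinAt
  -- Real points of N accumulate at x₀, and g vanishes at them; this starts the scalar identity
  -- theorem.
  have hfreq : ∃ᶠ w in 𝓝[≠] (x₀ : ℂ), g w = 0 := by
    have hc2 : Tendsto (fun x : ℝ => (x : ℂ)) (𝓝[≠] x₀) (𝓝[≠] (x₀ : ℂ)) := by
      refine tendsto_nhdsWithin_iff.2 ⟨(Complex.continuous_ofReal.tendsto x₀).mono_left
        nhdsWithin_le_nhds, ?_⟩
      filter_upwards [self_mem_nhdsWithin] with x hx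
      exact fun h => hx (Complex.ofReal_injective h)
    refine hc2.frequently (Eventually.frequently ?_)
    have : ∀ᶠ x : ℝ in 𝓝[≠] x₀, (x : ℂ) ∈ N :=
      ((Complex.continuous_ofReal.tendsto x₀).mono_left nhdsWithin_le_nhds).eventually
        (hN.mem_nhds hx)
    filter_upwards [this] with x hx
    simp [hg, h0 x hx]
  have := (hgd.analyticOnNhd hN).eqOn_zero_of_preconnected_of_frequently_eq_zero hc hx hfreq hz
  have h2 := congrArg Complex.re this
  simpa [hg] using h2

/-- The representation formula. -/
lemma representation {i j : E} (hi : i * i = -1) (hj : j * j = -1) {N : Set ℂ} (hN : IsOpen N)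
    (hc : IsPreconnected N) (hs : ∀ z ∈ N, (starRingEnd ℂ) z ∈ N) {f g : ℂ → E}
    (hf : ∀ z ∈ N, LeftHolAt i f z) (hg : ∀ z ∈ N, LeftHolAt j g z) {x₀ : ℝ} (hx : (x₀ : ℂ) ∈ N)
    (h0 : ∀ x : ℝ, (x : ℂ) ∈ N → f x = g x) :
    ∀ z ∈ N, (2 : ℝ) • g z = (1 - j * i) * f z + (1 + j * i) * f ((starRingEnd ℂ) z) := by
  intro z hz
  rw [← sub_eq_zero]
  -- The right side is left holomorphic for j because j(1 - ji) = (1 - ji)i and j(1 + ji) = -(1 +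
  -- ji)i, the sign in the second being that of the conjugation. On the real axis it equals 2f.
  refine eqOn_zero_of_leftHol hj hN hc (h := fun z => (2 : ℝ) • g z -
    ((1 - j * i) * f z + (1 + j * i) * f ((starRingEnd ℂ) z))) (fun w hw => ?_) hx (fun x hx => ?_) z hz
  · have hfw := hf w hw
    have hfc := hf _ (hs w hw)
    have hgw := hg w hw
    have hcd := differentiableAt_comp_conj hfc.1
    have d1 := hfw.1.const_mul (1 - j * i)
    have d2 := hcd.const_mul (1 + j * i)
    have d3 := hgw.1.fun_const_smul (2 : ℝ)
    refine ⟨d3.fun_sub (d1.fun_add d2), ?_⟩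
    rw [fderiv_fun_sub d3 (d1.fun_add d2), fderiv_fun_add d1 d2, fderiv_fun_const_smul hgw.1,
      fderiv_const_mul hfw.1, fderiv_const_mul hcd]
    simp only [sub_apply, add_apply, smul_apply, fderiv_comp_conj hfc.1, smul_eq_mul, map_one,
      Complex.conj_I, map_neg, eq_neg_of_add_eq_zero_left hfw.2, eq_neg_of_add_eq_zero_left hfc.2,
      eq_neg_of_add_eq_zero_left hgw.2]
    have hjj : ∀ x, j * (j * x) = -x := fun x => by rw [← mul_assoc, hj, neg_one_mul]
    have hii : ∀ x, i * (i * x) = -x := fun x => by rw [← mul_assoc, hi, neg_one_mul]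
    simp only [sub_mul, add_mul, mul_sub, mul_add, mul_neg, one_mul, mul_assoc, hjj, hii,
      smul_neg, mul_smul_comm]
    abel
  · simp only [Complex.conj_ofReal, h0 x hx, two_smul]
    noncomm_ring

/-- The symmetrised integrand does not depend on the imaginary unit. -/
lemma areaIntegrand_add_conj {T i j : E} (hi : i * i = -1) (hj : j * j = -1) {χ : ℂ → ℝ} {f g : ℂ → E}
    {z : ℂ} (hχ : gradC χ ((starRingEnd ℂ) z) = (starRingEnd ℂ) (gradC χ z))
    (h1 : (2 : ℝ) • g z = (1 - j * i) * f z + (1 + j * i) * f ((starRingEnd ℂ) z))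
    (h2 : (2 : ℝ) • g ((starRingEnd ℂ) z)
      = (1 - j * i) * f ((starRingEnd ℂ) z) + (1 + j * i) * f z) :
    areaIntegrand T j χ g z + areaIntegrand T j χ g ((starRingEnd ℂ) z)
      = areaIntegrand T i χ f z + areaIntegrand T i χ f ((starRingEnd ℂ) z) := by
  obtain ⟨α, hα⟩ : ∃ α, α = (1 / 2 : ℝ) • (f z + f ((starRingEnd ℂ) z)) := ⟨_, rfl⟩
  obtain ⟨β, hβ⟩ : ∃ β, β = (1 / 2 : ℝ) • (i * (f ((starRingEnd ℂ) z) - f z)) := ⟨_, rfl⟩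
  have hii : ∀ x, i * (i * x) = -x := fun x => by rw [← mul_assoc, hi, neg_one_mul]
  -- The functions are f(z) = α + iβ, f(z̄) = α - iβ and g(z) = α + jβ, g(z̄) = α - jβ with the same
  -- α and β. In the sum over z and z̄ the terms linear in the unit cancel, and its square is -1, so
  -- the right side does not contain k.
  have key : ∀ k : E, k * k = -1 → planarResolvent T k z * cplx k (gradC χ z) * (α + k * β)
      + planarResolvent T k ((starRingEnd ℂ) z) * cplx k (gradC χ ((starRingEnd ℂ) z)) * (α - k * β)
      = (2 : ℝ) • (Ring.inverse (planarPencil T z) * ((z.re • 1 - T) *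
        ((gradC χ z).re • α - (gradC χ z).im • β) + z.im • ((gradC χ z).im • α + (gradC χ z).re • β))) := by
    intro k hk
    have hkk : ∀ x, k * (k * x) = -x := fun x => by rw [← mul_assoc, hk, neg_one_mul]
    rw [hχ]
    simp only [planarResolvent, planarPencil_conj, Complex.conj_conj, mul_assoc]
    rw [← mul_add, ← mul_smul_comm]
    congr 1
    simp only [cplx, Complex.conj_re, Complex.conj_im, sub_mul, add_mul, mul_add, mul_sub, smul_mul_assoc,
      mul_smul_comm, one_mul, hkk, smul_add, smul_sub, smul_neg, neg_smul, mul_neg, neg_mul, neg_neg]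
    module
  have e1 : f z = α + i * β := by
    rw [hα, hβ, mul_smul_comm, hii]; module
  have e2 : f ((starRingEnd ℂ) z) = α - i * β := by
    rw [hα, hβ, mul_smul_comm, hii]; module
  have g1 : g z = α + j * β := by
    have : g z = (1 / 2 : ℝ) • ((2 : ℝ) • g z) := by module
    rw [this, h1, hα, hβ]
    simp only [sub_mul, add_mul, one_mul, mul_smul_comm, mul_sub, mul_assoc]
    module
  have g2 : g ((starRingEnd ℂ) z) = α - j * β := by
    have : g ((starRingEnd ℂ) z) = (1 / 2 : ℝ) • ((2 : ℝ) • g ((starRingEnd ℂ) z)) := by module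
    rw [this, h2, hα, hβ]
    simp only [sub_mul, add_mul, one_mul, mul_smul_comm, mul_sub, mul_assoc]
    module
  rw [areaIntegrand, areaIntegrand, areaIntegrand, areaIntegrand, g1, g2, e1, e2, key j hj, key i hi]

lemma gradC_conj {χ : ℂ → ℝ} (hd : Differentiable ℝ χ) (hs : ∀ z, χ ((starRingEnd ℂ) z) = χ z)
    (z : ℂ) : gradC χ ((starRingEnd ℂ) z) = (starRingEnd ℂ) (gradC χ z) := by
  have h := fun v => fderiv_comp_conj (E := ℝ) (h := χ) (z := z) (hd _) v
  simp only [hs] at h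
  have h1 := h 1
  have h2 := h Complex.I
  simp only [map_one, Complex.conj_I, map_neg] at h1 h2
  apply Complex.ext
  · simp only [gradC, Complex.conj_re]; exact h1.symm
  · simp only [gradC, Complex.conj_im]; linarith

lemma integral_eq_half_add_conj {E : Type*} [NormedAddCommGroup E] [NormedSpace ℝ E] {F : ℂ → E}
    (hF : Integrable F) :
    (2 : ℝ) • ∫ z, F z = ∫ z, (F z + F ((starRingEnd ℂ) z)) := by
  have hm : MeasurePreserving (Complex.conjLIE : ℂ → ℂ) volume volume :=
    Complex.conjLIE.measurePreserving
  have he : MeasurableEmbedding (Complex.conjLIE : ℂ → ℂ) :=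
    Complex.conjLIE.toHomeomorph.measurableEmbedding
  have h1 : ∫ z, F ((starRingEnd ℂ) z) = ∫ z, F z := hm.integral_comp he F
  have h2 : Integrable fun z => F ((starRingEnd ℂ) z) := (hm.integrable_comp_emb he).2 hF
  rw [integral_add hF h2, h1, two_smul]

/-- The area integral does not depend on the imaginary unit, for a symmetric cutoff. -/
theorem integral_areaIntegrand_eq [CompleteSpace E] {T i j : E} (hi : i * i = -1) (hj : j * j = -1)
    {D : Set ℂ} {χ : ℂ → ℝ} (hχ : IsCutoff T D χ) (hs : ∀ z, χ ((starRingEnd ℂ) z) = χ z)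
    {f g : ℂ → E} (hf : ContinuousOn f D) (hg : ContinuousOn g D)
    (hrep : ∀ z ∈ D, (2 : ℝ) • g z = (1 - j * i) * f z + (1 + j * i) * f ((starRingEnd ℂ) z)) :
    ∫ z, areaIntegrand T i χ f z = ∫ z, areaIntegrand T j χ g z := by
  refine smul_right_injective _ (two_ne_zero (α := ℝ)) ?_
  simp only
  rw [integral_eq_half_add_conj (hχ.integrable i hf), integral_eq_half_add_conj (hχ.integrable j hg)]
  refine integral_congr_ae (Eventually.of_forall fun z => ?_)
  simp only
  have hgr := gradC_conj (hχ.contDiff.differentiable one_ne_zero) hs z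
  have hD : ∀ z, gradC χ z ≠ 0 → z ∈ D := fun z hz =>
    hχ.subset (tsupport_gradC_subset χ (subset_tsupport _ hz))
  by_cases h0 : gradC χ z = 0
  · simp [areaIntegrand, hgr, h0, cplx]
  · have h0' : gradC χ ((starRingEnd ℂ) z) ≠ 0 := by rw [hgr]; simpa using h0
    refine (areaIntegrand_add_conj hi hj hgr (hrep z (hD z h0)) ?_).symm
    have := hrep _ (hD _ h0')
    rwa [Complex.conj_conj] at this

end Core

/-! ### Area integrals that vanish -/

lemma integral_dbar_mul_eq_zero {Ω : Set ℂ} (hΩ : IsOpen Ω) {ρ : ℂ → ℝ} (h1 : ContDiff ℝ 1 ρ)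
    (hc : HasCompactSupport ρ) (hρ : tsupport ρ ⊆ Ω) {G : ℂ → ℂ} (hG : DifferentiableOn ℂ G Ω) :
    ∫ z, dbar (fun w => (ρ w : ℂ)) z * G z = 0 := by
  have hρ1 : ContDiff ℝ 1 fun z => (ρ z : ℂ) := Complex.ofRealCLM.contDiff.comp h1
  -- Cauchy–Pompeiu at the point 0 for this function: φ(0) = 0, and ∂̄φ(z)/z = (∂̄ρ) G because G(z)
  -- z is holomorphic on Ω.
  set φ : ℂ → ℂ := fun z => (ρ z : ℂ) * (G z * z) with hφ
  have hd : ∀ z ∈ Ω, DifferentiableAt ℂ (fun z => G z * z) z := fun z hz =>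
    (hG.differentiableAt (hΩ.mem_nhds hz)).mul differentiableAt_id
  have hout : ∀ z ∉ Ω, ρ =ᶠ[𝓝 z] fun _ => 0 := fun z hz =>
    notMem_tsupport_iff_eventuallyEq.1 fun h => hz (hρ h)
  have hφ1 : ContDiff ℝ 1 φ := by
    rw [contDiff_iff_contDiffAt]
    intro z
    by_cases hz : z ∈ Ω
    · have han : AnalyticAt ℂ (fun z => G z * z) z :=
        DifferentiableOn.analyticAt (fun w hw => (hd w hw).differentiableWithinAt) (hΩ.mem_nhds hz)
      exact hρ1.contDiffAt.mul (han.contDiffAt.restrict_scalars ℝ)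
    · refine contDiffAt_const (c := (0 : ℂ)) |>.congr_of_eventuallyEq ?_
      filter_upwards [hout z hz] with w hw
      simp [hφ, hw]
  have hφc : HasCompactSupport φ := by
    refine HasCompactSupport.intro hc.isCompact fun z hz => ?_
    simp [hφ, image_eq_zero_of_notMem_tsupport hz]
  have key := integral_dbar_mul_inv hφ1 hφc 0
  rw [show φ 0 = 0 by simp [hφ], mul_zero] at key
  rw [← key]
  refine integral_congr_ae ?_
  have : ∀ᵐ z : ℂ, z ≠ 0 := by simp [ae_iff, measure_singleton]
  filter_upwards [this] with z hz0
  rw [sub_zero]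
  by_cases hz : z ∈ Ω
  · rw [hφ, dbar_mul (hρ1.differentiable one_ne_zero z) ((hd z hz).restrictScalars ℝ),
      dbar_of_differentiableAt (hd z hz)]
    field_simp
    ring
  · have e1 : (fun z => (ρ z : ℂ)) =ᶠ[𝓝 z] fun _ => 0 := by
      filter_upwards [hout z hz] with w hw
      simp [hw]
    have e2 : φ =ᶠ[𝓝 z] fun _ => 0 := by
      filter_upwards [hout z hz] with w hw
      simp [hφ, hw]
    rw [dbar_congr e1, dbar_congr e2]
    simp [dbar]

section Core

variable {E : Type*} [NormedRing E] [NormedAlgebra ℝ E] [CompleteSpace E]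

/-- Vector-valued form of `integral_dbar_mul_eq_zero`, for a Cauchy–Riemann pair. -/
lemma integral_gradC_eq_zero_of_cauchyRiemann {Ω : Set ℂ} (hΩ : IsOpen Ω) {ρ : ℂ → ℝ}
    (h1 : ContDiff ℝ 1 ρ) (hc : HasCompactSupport ρ) (hρ : tsupport ρ ⊆ Ω) {P Q : ℂ → E}
    (hPc : ContinuousOn P Ω) (hQc : ContinuousOn Q Ω)
    (hPQ : ∀ ℓ : E →L[ℝ] ℝ, DifferentiableOn ℂ (fun w => (ℓ (P w) : ℂ) - Complex.I * ℓ (Q w)) Ω) :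
    ∫ z, ((gradC ρ z).re • P z + (gradC ρ z).im • Q z) = 0 := by
  have hts := (tsupport_gradC_subset ρ).trans hρ
  have hK : IsCompact (tsupport (gradC ρ)) :=
    hc.isCompact.of_isClosed_subset (isClosed_tsupport _) (tsupport_gradC_subset ρ)
  have hg := continuous_gradC h1
  have hint : Integrable fun z => (gradC ρ z).re • P z + (gradC ρ z).im • Q z := by
    have : IntegrableOn (fun z => (gradC ρ z).re • P z + (gradC ρ z).im • Q z)
        (tsupport (gradC ρ)) := by
      refine ContinuousOn.integrableOn_compact hK (ContinuousOn.add ?_ ?_)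
      · exact (Complex.continuous_re.comp hg).continuousOn.smul (hPc.mono hts)
      · exact (Complex.continuous_im.comp hg).continuousOn.smul (hQc.mono hts)
    refine (integrableOn_iff_integrable_of_support_subset fun z hz => ?_).1 this
    by_contra hn
    exact hz (by simp [image_eq_zero_of_notMem_tsupport hn])
  refine (SeparatingDual.eq_iff_forall_dual_eq (R := ℝ)).2 fun ℓ => ?_
  have hρd := h1.differentiable one_ne_zero
  have key := integral_dbar_mul_eq_zero hΩ h1 hc hρ (hPQ ℓ)
  have hGi : Integrable fun z => dbar (fun w => (ρ w : ℂ)) z *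
      ((ℓ (P z) : ℂ) - Complex.I * ℓ (Q z)) := by
    have : IntegrableOn (fun z => dbar (fun w => (ρ w : ℂ)) z *
      ((ℓ (P z) : ℂ) - Complex.I * ℓ (Q z))) (tsupport (gradC ρ)) := by
      refine ContinuousOn.integrableOn_compact hK (ContinuousOn.mul ?_ ((hPQ ℓ).continuousOn.mono hts))
      exact (hg.congr (gradC_eq_dbar hρd)).continuousOn
    refine (integrableOn_iff_integrable_of_support_subset fun z hz => ?_).1 this
    by_contra hn
    refine hz ?_
    simp only
    rw [← gradC_eq_dbar hρd, image_eq_zero_of_notMem_tsupport hn, zero_mul]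
  rw [← ContinuousLinearMap.integral_comp_comm _ hint, map_zero, ← Complex.zero_re, ← key,
    ← Complex.reCLM_apply, ← ContinuousLinearMap.integral_comp_comm _ hGi]
  refine integral_congr_ae (Eventually.of_forall fun z => ?_)
  simp only [← gradC_eq_dbar hρd, map_add, map_smul, Complex.reCLM_apply]
  simp

/-- The area integral vanishes for a function supported away from the spectrum. -/
lemma integral_areaIntegrand_eq_zero {T i : E} (hi : i * i = -1) {D : Set ℂ} (hD : IsOpen D)
    {ρ : ℂ → ℝ} (h1 : ContDiff ℝ 1 ρ) (hc : HasCompactSupport ρ)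
    (hρ : tsupport ρ ⊆ D \ planarSpectrum T) {f : ℂ → E} (hf : ∀ z ∈ D, LeftHolAt i f z) :
    ∫ z, areaIntegrand T i ρ f z = 0 := by
  have hfc : ContinuousOn f D := fun z hz => (hf z hz).1.continuousAt.continuousWithinAt
  have hSc : ContinuousOn (planarResolvent T i) (D \ planarSpectrum T) := fun z hz =>
    (differentiableAt_planarResolvent T i hz.2).continuousAt.continuousWithinAt
  have := integral_gradC_eq_zero_of_cauchyRiemann (hD.sdiff (isClosed_planarSpectrum T)) h1 hc hρ
    (P := fun z => planarResolvent T i z * f z) (Q := fun z => planarResolvent T i z * i * f z)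
    (hSc.mul (hfc.mono sdiff_subset)) ((hSc.mul continuousOn_const).mul (hfc.mono sdiff_subset))
    (fun ℓ z hz => by
      -- Multiplication by the complex unit turns the function of the pair -S i f, S f into that of
      -- the pair S f, S i f.
      have := (((hf z hz.1).cauchyRiemann_resolvent hi hz.2 ℓ).const_mul Complex.I)
      refine (this.congr_of_eventuallyEq (Eventually.of_forall fun w => ?_)).differentiableWithinAt
      simp only [map_neg, Complex.ofReal_neg]
      linear_combination (ℓ (planarResolvent T i w * f w) : ℂ) * Complex.I_sq)
  rw [← this]
  refine integral_congr_ae (Eventually.of_forall fun z => ?_)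
  simp only [areaIntegrand, cplx, mul_add, add_mul, mul_smul_comm, smul_mul_assoc, mul_one]

/-- Disposes of the term without resolvent in the induction of `areaCalc_pow`. -/
lemma integral_cplx_gradC_mul_eq_zero {i : E} (hi : i * i = -1) {ρ : ℂ → ℝ}
    (h1 : ContDiff ℝ 1 ρ) (hc : HasCompactSupport ρ) {f : ℂ → E} (hf : ∀ z, LeftHolAt i f z) :
    ∫ z, cplx i (gradC ρ z) * f z = 0 := by
  have hfc : ContinuousOn f univ := fun z _ => (hf z).1.continuousAt.continuousWithinAt
  have := integral_gradC_eq_zero_of_cauchyRiemann isOpen_univ h1 hc (subset_univ _)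
    (P := f) (Q := fun z => i * f z) hfc (continuousOn_const.mul hfc)
    (fun ℓ z _ => ((hf z).differentiableAt_scalar hi ℓ).differentiableWithinAt)
  rw [← this]
  refine integral_congr_ae (Eventually.of_forall fun z => ?_)
  simp only [cplx, add_mul, smul_mul_assoc, one_mul]

omit [CompleteSpace E] in
lemma cplx_mul {i : E} (hi : i * i = -1) (z w : ℂ) : cplx i z * cplx i w = cplx i (z * w) := by
  simp only [cplx, mul_add, add_mul, mul_smul_comm, smul_mul_assoc, mul_one, one_mul, hi,
    Complex.mul_re, Complex.mul_im]
  module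

omit [CompleteSpace E] in
lemma cplx_one (i : E) : cplx i 1 = 1 := by simp [cplx]

omit [CompleteSpace E] in
lemma cplx_pow {i : E} (hi : i * i = -1) (z : ℂ) (k : ℕ) : cplx i z ^ k = cplx i (z ^ k) := by
  induction k with
  | zero => simp [cplx_one]
  | succ k ih => rw [pow_succ, ih, cplx_mul hi, pow_succ]

omit [CompleteSpace E] in
lemma leftHolAt_cplx_comp {i : E} (hi : i * i = -1) {F : ℂ → ℂ} {z : ℂ} (hF : DifferentiableAt ℂ F z) :
    LeftHolAt i (fun w => cplx i (F w)) z := by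
  have h := (cplxCLM i).hasFDerivAt.comp z (hF.restrictScalars ℝ).hasFDerivAt
  have h2 : fderiv ℝ (fun w => cplx i (F w)) z = _ := h.fderiv
  refine ⟨h.differentiableAt, ?_⟩
  rw [h2, hF.fderiv_restrictScalars ℝ]
  have e : fderiv ℂ F z Complex.I = Complex.I * fderiv ℂ F z 1 := by
    rw [← smul_eq_mul, ← map_smul, smul_eq_mul, mul_one]
  simp only [ContinuousLinearMap.comp_apply, ContinuousLinearMap.coe_restrictScalars', e,
    cplxCLM_apply, cplx, Complex.mul_re, Complex.mul_im, Complex.I_re, Complex.I_im, mul_add,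
    mul_smul_comm, hi, mul_one]
  module

/-- `∫ cplx (∂̄χ(z)) z⁻¹ = -2π χ(0)`. -/
lemma integral_cplx_gradC_inv (i : E) {χ : ℂ → ℝ} (h1 : ContDiff ℝ 1 χ) (hc : HasCompactSupport χ) :
    Integrable (fun z => cplx i (gradC χ z * z⁻¹)) ∧
    ∫ z, cplx i (gradC χ z * z⁻¹) = (-(2 * Real.pi) * χ 0) • (1 : E) := by
  have hχ1 : ContDiff ℝ 1 fun z => (χ z : ℂ) := Complex.ofRealCLM.contDiff.comp h1
  have hχc : HasCompactSupport fun z => (χ z : ℂ) := hc.comp_left (g := Complex.ofReal) (by simp)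
  have hd := h1.differentiable one_ne_zero
  have hi : Integrable fun z => gradC χ z * z⁻¹ := by
    have := (integrable_mul_inv (continuous_dbar hχ1) (hasCompactSupport_dbar hχc)).1 0
    simpa only [sub_zero, ← gradC_eq_dbar hd] using this
  refine ⟨(cplxCLM i).integrable_comp hi, ?_⟩
  have e := integral_dbar_mul_inv hχ1 hχc 0
  simp only [sub_zero, ← gradC_eq_dbar hd] at e
  refine ((cplxCLM i).integral_comp_comm hi).trans ?_
  rw [e, cplxCLM_apply, cplx]
  simp

end Core

/-! ### Independence of the cutoff; the calculus on powers -/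

section Core

variable {E : Type*} [NormedRing E] [NormedAlgebra ℝ E]

lemma norm_cplx_le (i : E) (z : ℂ) : ‖cplx i z‖ ≤ (‖(1 : E)‖ + ‖i‖) * ‖z‖ := by
  refine (norm_add_le _ _).trans ?_
  rw [norm_smul, norm_smul, Real.norm_eq_abs, Real.norm_eq_abs, add_mul]
  have h1 := mul_le_mul_of_nonneg_right (Complex.abs_re_le_norm z) (norm_nonneg (1 : E))
  have h2 := mul_le_mul_of_nonneg_right (Complex.abs_im_le_norm z) (norm_nonneg i)
  linarith

variable [CompleteSpace E]

/-- Neumann series: the pencil is |z|²(1 - X) with ‖X‖ ≤ 2τ + τ², where τ = ‖T‖/|z|, and this is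
below 1 when τ < 1/3. -/
lemma norm_le_of_mem_planarSpectrum {T : E} {z : ℂ} (hz : z ∈ planarSpectrum T) : ‖z‖ ≤ 3 * ‖T‖ := by
  by_contra! h
  have hz0 : 0 < ‖z‖ := lt_of_le_of_lt (by positivity) h
  refine hz ?_
  set X : E := (2 * z.re / ‖z‖ ^ 2) • T - (1 / ‖z‖ ^ 2) • T ^ 2 with hX
  have hXn : ‖X‖ < 1 := by
    have h1 : ‖(2 * z.re / ‖z‖ ^ 2) • T‖ ≤ 2 * (‖T‖ / ‖z‖) := by
      rw [norm_smul, Real.norm_eq_abs, abs_div, abs_mul, abs_two, abs_of_pos (by positivity : 0 < ‖z‖ ^ 2)]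
      have := Complex.abs_re_le_norm z
      calc 2 * |z.re| / ‖z‖ ^ 2 * ‖T‖ ≤ 2 * ‖z‖ / ‖z‖ ^ 2 * ‖T‖ := by gcongr
        _ = 2 * (‖T‖ / ‖z‖) := by field_simp
    have h2 : ‖(1 / ‖z‖ ^ 2) • T ^ 2‖ ≤ (‖T‖ / ‖z‖) ^ 2 := by
      rw [norm_smul, Real.norm_of_nonneg (by positivity), sq T]
      calc 1 / ‖z‖ ^ 2 * ‖T * T‖ ≤ 1 / ‖z‖ ^ 2 * (‖T‖ * ‖T‖) := by gcongr; exact norm_mul_le _ _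
        _ = (‖T‖ / ‖z‖) ^ 2 := by field_simp
    have h3 : ‖T‖ / ‖z‖ < 1 / 3 := by rw [div_lt_div_iff₀ hz0 (by norm_num)]; linarith
    have h4 : 0 ≤ ‖T‖ / ‖z‖ := by positivity
    have := norm_sub_le ((2 * z.re / ‖z‖ ^ 2) • T) ((1 / ‖z‖ ^ 2) • T ^ 2)
    nlinarith
  have e : planarPencil T z = (‖z‖ ^ 2) • (1 - X) := by
    have hne : ‖z‖ ^ 2 ≠ 0 := by positivity
    rw [planarPencil, hX, smul_sub, smul_sub, smul_smul, smul_smul, mul_div_cancel₀ _ hne,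
      mul_one_div_cancel hne]
    module
  rw [e]
  exact (isUnit_one_sub_of_norm_lt_one hXn).smul (Units.mk0 (‖z‖ ^ 2) (by positivity))

lemma isCompact_planarSpectrum (T : E) : IsCompact (planarSpectrum T) :=
  Metric.isCompact_of_isClosed_isBounded (isClosed_planarSpectrum T)
    (Metric.isBounded_closedBall.subset fun z hz => by
      rw [Metric.mem_closedBall, dist_zero_right]; exact norm_le_of_mem_planarSpectrum hz)

omit [CompleteSpace E] in
/-- The resolvent equation, solved for the resolvent. -/
lemma planarResolvent_eq {i : E} (hi : i * i = -1) (T : E) {z : ℂ} (hz : z ∉ planarSpectrum T)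
    (h0 : z ≠ 0) :
    planarResolvent T i z = cplx i z⁻¹ + T * planarResolvent T i z * cplx i z⁻¹ := by
  have h := congrArg (· * cplx i z⁻¹) (planarResolvent_mul hi T hz)
  simp only [add_mul, one_mul] at h
  rw [mul_assoc, cplx_mul hi, mul_inv_cancel₀ h0, cplx_one, mul_one] at h
  rw [add_comm, ← h]

-- In S = z⁻¹ + T S z⁻¹ the hypothesis on |z| makes the last term at most half of ‖S‖, so it is
-- absorbed in the left side.
omit [CompleteSpace E] in
lemma norm_planarResolvent_le {i : E} (hi : i * i = -1) (T : E) {z : ℂ} (hz : z ∉ planarSpectrum T)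
    (h0 : z ≠ 0) (hbig : 2 * ‖T‖ * (‖(1 : E)‖ + ‖i‖) ≤ ‖z‖) :
    ‖planarResolvent T i z‖ ≤ 2 * (‖(1 : E)‖ + ‖i‖) / ‖z‖ := by
  set a := ‖(1 : E)‖ + ‖i‖
  have hz0 : 0 < ‖z‖ := norm_pos_iff.2 h0
  have hc : ‖cplx i z⁻¹‖ ≤ a / ‖z‖ := by
    have := norm_cplx_le i z⁻¹
    rwa [norm_inv, ← div_eq_mul_inv] at this
  have h1 : ‖planarResolvent T i z‖ ≤ a / ‖z‖ + ‖T‖ * ‖planarResolvent T i z‖ * (a / ‖z‖) := by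
    conv_lhs => rw [planarResolvent_eq hi T hz h0]
    refine (norm_add_le _ _).trans (add_le_add hc ((norm_mul_le _ _).trans ?_))
    exact mul_le_mul (norm_mul_le _ _) hc (norm_nonneg _) (by positivity)
  have h2 : ‖T‖ * (a / ‖z‖) ≤ 1 / 2 := by
    rw [← mul_div_assoc, div_le_iff₀ hz0]; linarith
  have h3 : ‖T‖ * ‖planarResolvent T i z‖ * (a / ‖z‖) ≤ 1 / 2 * ‖planarResolvent T i z‖ := by
    calc _ = ‖T‖ * (a / ‖z‖) * ‖planarResolvent T i z‖ := by ring
      _ ≤ _ := by gcongr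
  have : 2 * a / ‖z‖ = 2 * (a / ‖z‖) := by ring
  rw [this]; linarith

omit [CompleteSpace E] in
lemma areaIntegrand_sub {T i : E} {χ χ' : ℂ → ℝ} (h : Differentiable ℝ χ) (h' : Differentiable ℝ χ')
    (f : ℂ → E) (z : ℂ) : areaIntegrand T i (fun z => χ z - χ' z) f z
      = areaIntegrand T i χ f z - areaIntegrand T i χ' f z := by
  have : gradC (fun z => χ z - χ' z) z = gradC χ z - gradC χ' z := by
    rw [gradC, fderiv_fun_sub (h z) (h' z)]; rfl
  simp only [areaIntegrand, this, cplx, Complex.sub_re, Complex.sub_im]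
  rw [← sub_mul, ← mul_sub]
  congr 2
  module

/-- The area integral does not depend on the cutoff. -/
lemma integral_areaIntegrand_eq_of_cutoff {T i : E} (hi : i * i = -1) {D : Set ℂ} (hD : IsOpen D)
    {χ χ' : ℂ → ℝ} (hχ : IsCutoff T D χ) (hχ' : IsCutoff T D χ') {f : ℂ → E}
    (hf : ∀ z ∈ D, LeftHolAt i f z) :
    ∫ z, areaIntegrand T i χ f z = ∫ z, areaIntegrand T i χ' f z := by
  have hfc : ContinuousOn f D := fun z hz => (hf z hz).1.continuousAt.continuousWithinAt
  rw [← sub_eq_zero, ← integral_sub (hχ.integrable i hfc) (hχ'.integrable i hfc)]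
  simp only [← areaIntegrand_sub (hχ.contDiff.differentiable one_ne_zero)
    (hχ'.contDiff.differentiable one_ne_zero)]
  refine integral_areaIntegrand_eq_zero hi hD (hχ.contDiff.sub hχ'.contDiff)
    (hχ.compact.sub hχ'.compact) (fun z hz => ⟨?_, fun hs => ?_⟩) hf
  · rcases (tsupport_sub χ χ') hz with h | h
    exacts [hχ.subset h, hχ'.subset h]
  · refine notMem_tsupport_iff_eventuallyEq.2 ?_ hz
    filter_upwards [hχ.eventually z hs, hχ'.eventually z hs] with w h1 h2
    simp [h1, h2]

lemma exists_isCutoff {T : E} {D : Set ℂ} (hD : IsOpen D) (h : planarSpectrum T ⊆ D) :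
    ∃ χ, IsCutoff T D χ := by
  obtain ⟨χ, h1, hc, hs, hev⟩ := exists_cutoff (isCompact_planarSpectrum T) hD h
  exact ⟨χ, h1, hc, hs, eventually_nhdsSet_iff_forall.1 hev⟩

/-- The functional calculus in its area form. -/
def areaCalc (T i : E) (χ : ℂ → ℝ) (f : ℂ → E) : E :=
  -((1 / (2 * Real.pi) : ℝ) • ∫ z, areaIntegrand T i χ f z)

omit [CompleteSpace E] in
lemma leftHolAt_one (i : E) (z : ℂ) : LeftHolAt i (fun _ => (1 : E)) z :=
  ⟨differentiableAt_const _, by simp⟩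

/-- As the integral does not depend on the cutoff, it can be computed with χ₀(z/R) for R → ∞. After
rescaling, S(Rw) is (Rw)⁻¹ up to an error of order R⁻², and the limit is the Cauchy–Pompeiu integral
for χ₀ at 0. -/
lemma areaCalc_one {T i : E} (hi : i * i = -1) {χ : ℂ → ℝ} (hχ : IsCutoff T univ χ) :
    areaCalc T i χ (fun _ => 1) = 1 := by
  suffices h : ∫ z, areaIntegrand T i χ (fun _ => 1) z = (-(2 * Real.pi)) • (1 : E) by
    rw [areaCalc, h, smul_smul, ← neg_smul]
    have : -(1 / (2 * Real.pi) * -(2 * Real.pi)) = 1 := by field_simp [Real.pi_ne_zero]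
    rw [this, one_smul]
  -- As χ₀ is 1 near the closed unit disc, its gradient lives in |w| > 1, where |w⁻¹| is below 1.
  obtain ⟨χ₀, h1, hc, -, hev⟩ := exists_cutoff (isCompact_closedBall (0 : ℂ) 1) isOpen_univ
    (subset_univ _)
  rw [eventually_nhdsSet_iff_forall] at hev
  set a := ‖(1 : E)‖ + ‖i‖ with ha
  have ha0 : 0 ≤ a := by positivity
  have hgsupp : ∀ z, gradC χ₀ z ≠ 0 → 1 < ‖z‖ := fun z hz => by
    by_contra! h
    exact hz (gradC_eq_zero_of_eventually_eq (hev z (by simpa using h)))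
  have hg : Continuous (gradC χ₀) := continuous_gradC h1
  have hgc : HasCompactSupport (gradC χ₀) :=
    hc.isCompact.of_isClosed_subset (isClosed_tsupport _) (tsupport_gradC_subset χ₀)
  obtain ⟨hinv, hval⟩ := integral_cplx_gradC_inv i h1 hc
  rw [(hev 0 (by simp)).self_of_nhds, mul_one] at hval
  have hgi : Integrable fun z => ‖gradC χ₀ z‖ := (hg.integrable_of_hasCompactSupport hgc).norm
  set M := ∫ z, ‖gradC χ₀ z‖ with hM
  have bound : ∀ R : ℝ, 3 * ‖T‖ + 1 ≤ R → 2 * ‖T‖ * a ≤ R →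
      ‖(∫ z, areaIntegrand T i χ (fun _ => 1) z) - (-(2 * Real.pi)) • (1 : E)‖ ≤
        (‖T‖ * (2 * a) * a * M) / R := by
    intro R hR1 hR2
    have hR : 0 < R := lt_of_lt_of_le (by positivity) hR1
    set χR : ℂ → ℝ := fun z => χ₀ (R⁻¹ • z) with hχR
    have hd₀ := h1.differentiable one_ne_zero
    have hgR : ∀ z, gradC χR z = (R⁻¹ : ℝ) • gradC χ₀ (R⁻¹ • z) := fun z => by
      have h := (hd₀ (R⁻¹ • z)).hasFDerivAt.comp z
        ((hasFDerivAt_id (𝕜 := ℝ) z).fun_const_smul R⁻¹)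
      have h' : fderiv ℝ χR z = _ := h.fderiv
      apply Complex.ext <;> simp [gradC, h']
    -- The spectrum lies in the disc of radius 3‖T‖, hence in that of radius R, near which the
    -- rescaled cutoff equals 1.
    have hcut : IsCutoff T univ χR := by
      refine ⟨h1.comp (contDiff_const_smul R⁻¹), hc.comp_smul (inv_ne_zero hR.ne'), subset_univ _,
        fun z hz => ?_⟩
      refine ((continuous_const_smul R⁻¹).tendsto z).eventually (hev _ ?_)
      rw [Metric.mem_closedBall, dist_zero_right, norm_smul, norm_inv, Real.norm_of_nonneg hR.le,
        inv_mul_le_one₀ hR]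
      linarith [norm_le_of_mem_planarSpectrum hz]
    rw [integral_areaIntegrand_eq_of_cutoff hi isOpen_univ hχ hcut fun z _ => leftHolAt_one i z, ← hval]
    have hscale : ∫ z, areaIntegrand T i χR (fun _ => 1) z
        = ∫ w, (R ^ 2) • areaIntegrand T i χR (fun _ => 1) (R • w) := by
      rw [integral_smul, Measure.integral_comp_smul, Complex.finrank_real_complex, smul_smul,
        abs_of_pos (by positivity), mul_inv_cancel₀ (by positivity), one_smul]
    have hi2 : Integrable fun w => (R ^ 2) • areaIntegrand T i χR (fun _ => 1) (R • w) :=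
      ((hcut.integrable i continuousOn_const).comp_smul hR.ne').smul (R ^ 2)
    rw [hscale, ← integral_sub hi2 hinv]
    refine (norm_integral_le_of_norm_le (hgi.const_mul (‖T‖ * (2 * a) * a / R))
      (Eventually.of_forall fun w => ?_)).trans (le_of_eq ?_)
    · have hgw : gradC χR (R • w) = (R⁻¹ : ℝ) • gradC χ₀ w := by
        rw [hgR, smul_smul, inv_mul_cancel₀ hR.ne', one_smul]
      simp only [areaIntegrand, hgw, mul_one]
      by_cases h0 : gradC χ₀ w = 0
      · simp [h0, cplx]
      have hw1 := hgsupp w h0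
      have hw0 : w ≠ 0 := norm_pos_iff.1 (by linarith)
      have hRw : ‖R • w‖ = R * ‖w‖ := by rw [norm_smul, Real.norm_of_nonneg hR.le]
      have hRw' : R ≤ R * ‖w‖ := le_mul_of_one_le_right hR.le hw1.le
      have hz0 : R • w ≠ 0 := smul_ne_zero hR.ne' hw0
      have hz : R • w ∉ planarSpectrum T := fun h => by
        have := norm_le_of_mem_planarSpectrum h
        linarith
      have hS := norm_planarResolvent_le hi T hz hz0 (by rw [hRw]; linarith)
      rw [hRw] at hS
      have hc1 : cplx i (R • w)⁻¹ * cplx i ((R⁻¹ : ℝ) • gradC χ₀ w)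
          = ((R ^ 2)⁻¹ : ℝ) • cplx i (gradC χ₀ w * w⁻¹) := by
        rw [cplx_mul hi]
        have : (R • w)⁻¹ * (R⁻¹ : ℝ) • gradC χ₀ w = ((R ^ 2)⁻¹ : ℝ) • (gradC χ₀ w * w⁻¹) := by
          simp only [Complex.real_smul, mul_inv, Complex.ofReal_inv, Complex.ofReal_pow]
          ring
        rw [this]
        exact (cplxCLM i).map_smul _ _
      -- The leading term z⁻¹ of the resolvent reproduces the limiting integrand exactly; what
      -- remains is T S times it, of order 1/R.
      have hmain : (R ^ 2) • (planarResolvent T i (R • w) * cplx i ((R⁻¹ : ℝ) • gradC χ₀ w))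
          - cplx i (gradC χ₀ w * w⁻¹)
          = T * planarResolvent T i (R • w) * cplx i (gradC χ₀ w * w⁻¹) := by
        conv_lhs => rw [planarResolvent_eq hi T hz hz0]
        rw [add_mul, mul_assoc (T * _), hc1, mul_smul_comm, ← smul_add, smul_smul,
          mul_inv_cancel₀ (by positivity), one_smul, add_sub_cancel_left]
      rw [hmain]
      have hw2 : ‖gradC χ₀ w * w⁻¹‖ ≤ ‖gradC χ₀ w‖ := by
        rw [norm_mul, norm_inv]
        exact mul_le_of_le_one_right (norm_nonneg _) (inv_le_one_of_one_le₀ hw1.le)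
      calc _ ≤ ‖T‖ * ‖planarResolvent T i (R • w)‖ * ‖cplx i (gradC χ₀ w * w⁻¹)‖ :=
            (norm_mul_le _ _).trans (by gcongr; exact norm_mul_le _ _)
        _ ≤ ‖T‖ * (2 * a / R) * (a * ‖gradC χ₀ w‖) := by
            gcongr
            · refine hS.trans ?_
              gcongr
            · exact (norm_cplx_le i _).trans (by gcongr)
        _ = _ := by ring
    · rw [integral_const_mul]; ring
  rw [← sub_eq_zero, ← norm_le_zero_iff]
  have hlim : Tendsto (fun R : ℝ => (‖T‖ * (2 * a) * a * M) / R) atTop (𝓝 0) :=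
    tendsto_const_nhds.div_atTop tendsto_id
  refine ge_of_tendsto hlim ?_
  filter_upwards [eventually_ge_atTop (3 * ‖T‖ + 1), eventually_ge_atTop (2 * ‖T‖ * a)] with R hR1 hR2
  exact bound R hR1 hR2

omit [CompleteSpace E] in
lemma leftHolAt_cplx_pow {i : E} (hi : i * i = -1) (k : ℕ) (z : ℂ) :
    LeftHolAt i (fun w => cplx i w ^ k) z := by
  have := leftHolAt_cplx_comp hi (F := fun w => w ^ k) (z := z) (differentiableAt_pow k)
  simpa only [cplx_pow hi] using this

/-- By S z = T S + 1 the integrand of z^(k+1) is T times that of z^k plus a term free of the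
resolvent, whose integral vanishes. -/
lemma areaCalc_pow {T i : E} (hi : i * i = -1) {χ : ℂ → ℝ} (hχ : IsCutoff T univ χ) (k : ℕ) :
    areaCalc T i χ (fun z => cplx i z ^ k) = T ^ k := by
  induction k with
  | zero => simpa using areaCalc_one hi hχ
  | succ k ih =>
    have hk : ContinuousOn (fun z => cplx i z ^ k) univ :=
      ((continuous_cplx i).pow k).continuousOn
    have hcpl : Integrable fun z => cplx i (gradC χ z) * cplx i z ^ k := by
      refine Continuous.integrable_of_hasCompactSupport ?_ ?_
      · exact ((continuous_cplx i).comp (continuous_gradC hχ.contDiff)).mul ((continuous_cplx i).pow k)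
      · refine HasCompactSupport.intro hχ.isCompact_tsupport_gradC fun z hz => ?_
        simp [image_eq_zero_of_notMem_tsupport hz, cplx]
    have e : ∀ z, areaIntegrand T i χ (fun z => cplx i z ^ (k + 1)) z
        = T * areaIntegrand T i χ (fun z => cplx i z ^ k) z + cplx i (gradC χ z) * cplx i z ^ k := by
      intro z
      by_cases h0 : gradC χ z = 0
      · simp [areaIntegrand, h0, cplx]
      have hz : z ∉ planarSpectrum T := hχ.notMem_spectrum (subset_tsupport _ h0)
      have hcomm : cplx i (gradC χ z) * cplx i z = cplx i z * cplx i (gradC χ z) := by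
        rw [cplx_mul hi, cplx_mul hi, mul_comm]
      calc _ = planarResolvent T i z * (cplx i (gradC χ z) * cplx i z) * cplx i z ^ k := by
            simp only [areaIntegrand, pow_succ', mul_assoc]
        _ = (planarResolvent T i z * cplx i z) * cplx i (gradC χ z) * cplx i z ^ k := by
            rw [hcomm]; simp only [mul_assoc]
        _ = _ := by
            rw [planarResolvent_mul hi T hz]; simp only [areaIntegrand, add_mul, one_mul, mul_assoc]
    rw [pow_succ', ← ih, areaCalc, areaCalc, integral_congr_ae (Eventually.of_forall e),
      integral_add ((hχ.integrable i hk).const_mul T) hcpl,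
      integral_cplx_gradC_mul_eq_zero hi hχ.contDiff hχ.compact (leftHolAt_cplx_pow hi k), add_zero,
      integral_const_mul_of_integrable (hχ.integrable i hk)]
    simp

end Core

/-! ### The circularized spectrum in a plane; continuity of the area form -/

section Core

variable {E : Type*} [NormedRing E] [NormedAlgebra ℝ E]

/-- The union of the circles with centre `Re z` and radius `|Im z|`, for `z` in the spectrum. -/
def circleSet (T : E) : Set ℂ := {c | ∃ z ∈ planarSpectrum T, ‖c - z.re‖ = |z.im|}

lemma planarSpectrum_subset_circleSet (T : E) : planarSpectrum T ⊆ circleSet T := fun z hz =>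
  ⟨z, hz, by
    have : z - z.re = z.im * Complex.I := by rw [sub_eq_iff_eq_add']; exact (Complex.re_add_im z).symm
    rw [this, norm_mul, Complex.norm_I, mul_one, Complex.norm_real, Real.norm_eq_abs]⟩

/-- As an image of a compact product under an explicit map, the set is compact and moves little when
the spectrum moves little. -/
lemma circleSet_eq_image (T : E) : circleSet T
    = (fun p : ℂ × ℂ => (p.1.re + |p.1.im| * p.2 : ℂ)) '' (planarSpectrum T ×ˢ Metric.sphere 0 1) := by
  ext c
  constructor
  · rintro ⟨z, hz, hc⟩
    by_cases h : z.im = 0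
    · refine ⟨(z, 1), ⟨hz, by simp⟩, ?_⟩
      rw [h, abs_zero, norm_eq_zero, sub_eq_zero] at hc
      simp [h, hc]
    · have h' : ((|z.im| : ℝ) : ℂ) ≠ 0 := by exact_mod_cast abs_ne_zero.2 h
      refine ⟨(z, (c - z.re) / |z.im|), ⟨hz, ?_⟩, ?_⟩
      · rw [mem_sphere_zero_iff_norm, norm_div, hc, Complex.norm_real, Real.norm_eq_abs, abs_abs,
          div_self (abs_ne_zero.2 h)]
      · simp only
        rw [mul_div_cancel₀ _ h', add_sub_cancel]
  · rintro ⟨⟨z, w⟩, ⟨hz, hw⟩, rfl⟩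
    refine ⟨z, hz, ?_⟩
    rw [mem_sphere_zero_iff_norm] at hw
    simp only [add_sub_cancel_left]
    rw [norm_mul, hw, mul_one, Complex.norm_real, Real.norm_eq_abs, abs_abs]

lemma conj_mem_circleSet {T : E} {c : ℂ} (h : c ∈ circleSet T) : (starRingEnd ℂ) c ∈ circleSet T := by
  obtain ⟨z, hz, hc⟩ := h
  refine ⟨z, hz, ?_⟩
  rw [← hc, ← Complex.norm_conj (c - z.re), map_sub, Complex.conj_ofReal]

lemma sphere_subset_circleSet {T : E} {z : ℂ} (hz : z ∈ planarSpectrum T) :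
    Metric.sphere (z.re : ℂ) |z.im| ⊆ circleSet T := fun c hc =>
  ⟨z, hz, by rwa [mem_sphere_iff_norm] at hc⟩

variable [CompleteSpace E]

lemma isCompact_circleSet (T : E) : IsCompact (circleSet T) := by
  rw [circleSet_eq_image]
  refine ((isCompact_planarSpectrum T).prod (isCompact_sphere 0 1)).image ?_
  fun_prop

omit [CompleteSpace E] in
lemma continuous_planarPencil_prod : Continuous fun p : E × ℂ => planarPencil p.1 p.2 := by
  unfold planarPencil
  fun_prop

lemma continuousAt_planarResolvent_prod {T i : E} {z : ℂ} (hz : z ∉ planarSpectrum T) :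
    ContinuousAt (fun p : E × ℂ => planarResolvent p.1 i p.2) (T, z) := by
  obtain ⟨u, hu⟩ := not_not.1 hz
  have h1 : ContinuousAt (Ring.inverse : E → E) (planarPencil T z) := by
    rw [← hu]; exact NormedRing.inverse_continuousAt u
  refine ContinuousAt.mul (ContinuousAt.comp (f := fun p : E × ℂ => planarPencil p.1 p.2)
    (x := (T, z)) h1 continuous_planarPencil_prod.continuousAt) ?_
  have : Continuous fun p : E × ℂ => cplx i ((starRingEnd ℂ) p.2) - p.1 := by
    have := continuous_cplx i
    fun_prop
  exact this.continuousAt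

/-- Upper semicontinuity of the spectrum. -/
lemma eventually_planarSpectrum_subset {T : E} {O : Set ℂ} (hO : IsOpen O) (h : planarSpectrum T ⊆ O) :
    ∀ᶠ T' in 𝓝 T, planarSpectrum T' ⊆ O := by
  -- For ‖T'‖ < ‖T‖ + 1 the spectrum of T' stays in this ball, so only the compact part of the ball
  -- outside O matters. There the pencil of T is invertible, an open condition.
  have hK : IsCompact (Metric.closedBall (0 : ℂ) (3 * (‖T‖ + 1)) \ O) :=
    (isCompact_closedBall _ _).diff hO
  have h1 : ∀ᶠ T' in 𝓝 T, ∀ z ∈ Metric.closedBall (0 : ℂ) (3 * (‖T‖ + 1)) \ O,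
      IsUnit (planarPencil T' z) := by
    refine hK.eventually_forall_of_forall_eventually fun z hz => ?_
    have hu : IsUnit (planarPencil T z) := by
      by_contra hn; exact hz.2 (h hn)
    exact continuous_planarPencil_prod.continuousAt.eventually
      (Units.isOpen.mem_nhds (x := planarPencil (T, z).1 (T, z).2) hu)
  have h2 : ∀ᶠ T' in 𝓝 T, ‖T'‖ < ‖T‖ + 1 :=
    (continuous_norm.tendsto T).eventually (gt_mem_nhds (by linarith))
  filter_upwards [h1, h2] with T' h1 h2 z hz
  by_contra hzO
  refine hz (h1 z ⟨?_, hzO⟩)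
  rw [Metric.mem_closedBall, dist_zero_right]
  have := norm_le_of_mem_planarSpectrum hz
  linarith

lemma eventually_circleSet_subset {T : E} {O : Set ℂ} (hO : IsOpen O) (h : circleSet T ⊆ O) :
    ∀ᶠ T' in 𝓝 T, circleSet T' ⊆ O := by
  obtain ⟨ε, hε, hεO⟩ := (isCompact_circleSet T).exists_thickening_subset_open hO h
  -- If z moves by less than ε/2, then Re z and |Im z| each move by less than ε/2, so Re z + |Im z|
  -- w moves by less than ε when |w| = 1.
  filter_upwards [eventually_planarSpectrum_subset (Metric.isOpen_thickening (δ := ε / 2))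
    (Metric.self_subset_thickening (half_pos hε) (planarSpectrum T))] with T' hT'
  refine Subset.trans ?_ hεO
  rw [circleSet_eq_image T', circleSet_eq_image T]
  rintro _ ⟨⟨z', w⟩, ⟨hz', hw⟩, rfl⟩
  obtain ⟨z, hz, hd⟩ := Metric.mem_thickening_iff.1 (hT' hz')
  refine Metric.mem_thickening_iff.2 ⟨_, ⟨(z, w), ⟨hz, hw⟩, rfl⟩, ?_⟩
  rw [mem_sphere_zero_iff_norm] at hw
  rw [dist_eq_norm] at hd ⊢
  have e : (z'.re + |z'.im| * w - (z.re + |z.im| * w) : ℂ)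
      = ((z' - z).re : ℂ) + ((|z'.im| - |z.im| : ℝ) : ℂ) * w := by
    rw [Complex.sub_re]; push_cast; ring
  simp only
  rw [e]
  refine (norm_add_le _ _).trans_lt ?_
  rw [norm_mul, hw, mul_one, Complex.norm_real, Complex.norm_real, Real.norm_eq_abs, Real.norm_eq_abs]
  have h1 := Complex.abs_re_le_norm (z' - z)
  have h2 := Complex.abs_im_le_norm (z' - z)
  have h3 := abs_abs_sub_abs_le z'.im z.im
  rw [Complex.sub_im] at h2
  linarith

/-- The points near which χ is 1 form an open set, so it also contains the spectra of nearby
operators: a single cutoff serves all of them. -/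
lemma IsCutoff.eventually_isCutoff {T : E} {D : Set ℂ} {χ : ℂ → ℝ} (hχ : IsCutoff T D χ) :
    ∀ᶠ T' in 𝓝 T, IsCutoff T' D χ := by
  filter_upwards [eventually_planarSpectrum_subset (T := T) (O := {z | ∀ᶠ w in 𝓝 z, χ w = 1})
    isOpen_setOfPred_eventually_nhds hχ.eventually] with T' hT'
  exact ⟨hχ.contDiff, hχ.compact, hχ.subset, hT'⟩

/-- Joint continuity of the calculus in the operator and the function. -/
theorem IsCutoff.areaCalc_continuous {T : E} {D : Set ℂ} {χ : ℂ → ℝ} (hχ : IsCutoff T D χ) (i : E)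
    {f : ℂ → E} (hf : ContinuousOn f D) {ε : ℝ} (hε : 0 < ε) :
    ∃ δ > 0, ∀ T' : E, ‖T' - T‖ < δ → ∀ g : ℂ → E, ContinuousOn g D →
      (∀ z ∈ tsupport (gradC χ), ‖g z - f z‖ < δ) →
      ‖areaCalc T' i χ g - areaCalc T i χ f‖ < ε := by
  set K := tsupport (gradC χ) with hKdef
  have hK : IsCompact K := hχ.isCompact_tsupport_gradC
  have hKD : K ⊆ D := (tsupport_gradC_subset χ).trans hχ.subset
  have hSc : ContinuousOn (planarResolvent T i) K := fun z hz =>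
    (differentiableAt_planarResolvent T i (hχ.notMem_spectrum hz)).continuousAt.continuousWithinAt
  obtain ⟨A, hA⟩ := hK.exists_bound_of_continuousOn hSc
  obtain ⟨B, hB⟩ := hK.exists_bound_of_continuousOn (hf.mono hKD)
  obtain ⟨G, hG⟩ := hK.exists_bound_of_continuousOn
    ((continuous_cplx i).comp (continuous_gradC hχ.contDiff)).continuousOn
  -- The first term comes from the change of the resolvent, with |B| + 1 bounding g because η ≤ 1;
  -- the second comes from g - f.
  set C : ℝ := |G| * (|B| + 1) + |A| * |G| with hC
  have hC0 : 0 ≤ C := by positivity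
  set v : ℝ := volume.real K with hv
  have hv0 : 0 ≤ v := measureReal_nonneg
  obtain ⟨η, hη0, hη1, hη⟩ : ∃ η > 0, η ≤ 1 ∧ η * C * v < ε := by
    refine ⟨min 1 (ε / (2 * (C * v + 1))), by positivity, min_le_left _ _, ?_⟩
    have h1 : min 1 (ε / (2 * (C * v + 1))) * (C * v) ≤ ε / (2 * (C * v + 1)) * (C * v) := by
      gcongr; exact min_le_right _ _
    have h2 : ε / (2 * (C * v + 1)) * (C * v) < ε := by
      rw [div_mul_eq_mul_div, div_lt_iff₀ (by positivity)]
      nlinarith [mul_nonneg hC0 hv0]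
    rw [mul_assoc]; linarith
  have hev : ∀ᶠ T' in 𝓝 T, ∀ z ∈ K, ‖planarResolvent T' i z - planarResolvent T i z‖ < η := by
    refine hK.eventually_forall_of_forall_eventually fun z hz => ?_
    have hz' := hχ.notMem_spectrum hz
    have c1 := continuousAt_planarResolvent_prod (i := i) hz'
    have c2 : ContinuousAt (fun p : E × ℂ => planarResolvent T i p.2) (T, z) :=
      ContinuousAt.comp (f := fun p : E × ℂ => p.2) (x := (T, z))
        (differentiableAt_planarResolvent T i hz').continuousAt continuousAt_snd
    have := (c1.sub c2).norm
    refine this.eventually (gt_mem_nhds ?_)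
    simpa using hη0
  obtain ⟨δ, hδ, hball⟩ := Metric.eventually_nhds_iff.1 (hev.and hχ.eventually_isCutoff)
  refine ⟨min δ η, lt_min hδ hη0, fun T' hT' g hg hgf => ?_⟩
  obtain ⟨hS, hcut⟩ := hball (y := T') (by rw [dist_eq_norm]; exact hT'.trans_le (min_le_left _ _))
  rw [areaCalc, areaCalc, ← neg_sub', norm_neg, ← smul_sub,
    ← integral_sub (hcut.integrable i hg) (hχ.integrable i hf)]
  have hb : ∀ z ∈ K, ‖areaIntegrand T' i χ g z - areaIntegrand T i χ f z‖ ≤ η * C := by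
    intro z hz
    have hA' := (hA z hz).trans (le_abs_self A)
    have hB' := (hB z hz).trans (le_abs_self B)
    have hG' : ‖cplx i (gradC χ z)‖ ≤ |G| := (hG z hz).trans (le_abs_self G)
    have hgf' : ‖g z - f z‖ ≤ η := ((hgf z hz).trans_le (min_le_right _ _)).le
    have hg' : ‖g z‖ ≤ |B| + 1 := by
      have := norm_add_le (g z - f z) (f z)
      rw [sub_add_cancel] at this
      linarith
    have e : areaIntegrand T' i χ g z - areaIntegrand T i χ f z
        = (planarResolvent T' i z - planarResolvent T i z) * cplx i (gradC χ z) * g z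
          + planarResolvent T i z * cplx i (gradC χ z) * (g z - f z) := by
      simp only [areaIntegrand, sub_mul, mul_sub]; abel
    rw [e]
    calc _ ≤ ‖planarResolvent T' i z - planarResolvent T i z‖ * ‖cplx i (gradC χ z)‖ * ‖g z‖
          + ‖planarResolvent T i z‖ * ‖cplx i (gradC χ z)‖ * ‖g z - f z‖ :=
          (norm_add_le _ _).trans (add_le_add
            ((norm_mul_le _ _).trans (by gcongr; exact norm_mul_le _ _))
            ((norm_mul_le _ _).trans (by gcongr; exact norm_mul_le _ _)))
      _ ≤ η * |G| * (|B| + 1) + |A| * |G| * η := by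
          gcongr
          exact (hS z hz).le
      _ = η * C := by rw [hC]; ring
  have hset : ∫ z, (areaIntegrand T' i χ g z - areaIntegrand T i χ f z)
      = ∫ z in K, (areaIntegrand T' i χ g z - areaIntegrand T i χ f z) := by
    refine (setIntegral_eq_integral_of_forall_compl_eq_zero fun z hz => ?_).symm
    rw [areaIntegrand_eq_zero hz, areaIntegrand_eq_zero hz, sub_zero]
  have h1 : ‖∫ z, (areaIntegrand T' i χ g z - areaIntegrand T i χ f z)‖ ≤ η * C * v := by
    rw [hset]
    exact norm_setIntegral_le_of_norm_le_const hK.measure_lt_top hb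
  have h2 : ‖(1 / (2 * Real.pi) : ℝ)‖ ≤ 1 := by
    rw [Real.norm_of_nonneg (by positivity), div_le_one (by positivity)]
    linarith [Real.pi_gt_three]
  rw [norm_smul]
  calc _ ≤ 1 * (η * C * v) := by gcongr
    _ < ε := by rwa [one_mul]

end Core

/-! ### Cycle decomposition of balanced directed graphs -/

section Cycles

variable {V : Type*} [DecidableEq V]

/-- A simple closed walk of length `L ≥ 3`, given by a sequence of vertices. -/
structure IsSimpleCycle (L : ℕ) (c : ℕ → V) : Prop where
  three_le : 3 ≤ L
  closed : c L = c 0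
  inj : InjOn c (Iio L)

/-- A finite directed graph is balanced if every potential has total increment `0`. -/
def Balanced (E : Finset (V × V)) : Prop := ∀ φ : V → ℤ, ∑ e ∈ E, (φ e.2 - φ e.1) = 0

/-- Test the balance with the indicator of the end point of e. If no edge leaves it, every increment
is nonnegative and that of e is 1, as e is then no loop. -/
lemma Balanced.exists_out {E : Finset (V × V)} (h : Balanced E) {e : V × V} (he : e ∈ E) :
    ∃ w, (e.2, w) ∈ E := by
  by_contra! hn
  have h0 := h fun v => if v = e.2 then 1 else 0
  have h1 : ∀ f ∈ E, (0 : ℤ) ≤ (if f.2 = e.2 then 1 else 0) - (if f.1 = e.2 then 1 else 0) := by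
    intro f hf
    have : f.1 ≠ e.2 := fun h' => hn f.2 (by rw [← h']; exact hf)
    rw [if_neg this]
    split_ifs <;> norm_num
  have h2 := (Finset.sum_eq_zero_iff_of_nonneg h1).1 h0 e he
  have : e.1 ≠ e.2 := fun h' => hn e.2 (by rw [← h'] ; rw [show (e.1, e.1) = e from by ext <;> simp [h']]; exact he)
  simp [this] at h2

/-- Following a choice of outgoing edges, a walk in a finite graph becomes periodic, and a minimal
period is a simple cycle. Periods 1 and 2 would give a loop or two opposite edges. -/
lemma exists_simpleCycle {E : Finset (V × V)} (h : Balanced E) (hs : ∀ e ∈ E, e.swap ∉ E)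
    (hne : E.Nonempty) : ∃ (L : ℕ) (c : ℕ → V), IsSimpleCycle L c ∧ ∀ j, (c j, c (j + 1)) ∈ E := by
  classical
  have hout : ∀ v : V, ∃ w, (∃ w', (v, w') ∈ E) → (v, w) ∈ E := fun v => by
    by_cases hv : ∃ w', (v, w') ∈ E
    · exact ⟨hv.choose, fun _ => hv.choose_spec⟩
    · exact ⟨v, fun h' => absurd h' hv⟩
  choose s hsE using hout
  obtain ⟨e₀, he₀⟩ := hne
  have hiter : ∀ j, (s^[j] e₀.1, s^[j + 1] e₀.1) ∈ E := by
    intro j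
    induction j with
    | zero => exact hsE _ ⟨e₀.2, he₀⟩
    | succ j ih =>
      rw [Function.iterate_succ_apply' s (j + 1)]
      exact hsE _ (h.exists_out ih)
  obtain ⟨a, b, hab, heq⟩ : ∃ a b, a < b ∧ s^[a] e₀.1 = s^[b] e₀.1 := by
    have hmaps : ∀ j, s^[j] e₀.1 ∈ E.image Prod.fst := fun j =>
      Finset.mem_image.2 ⟨_, hiter j, rfl⟩
    obtain ⟨a, b, hne, heq⟩ := Finite.exists_ne_map_eq_of_infinite
      (fun j : ℕ => (⟨s^[j] e₀.1, hmaps j⟩ : E.image Prod.fst))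
    rcases lt_or_gt_of_ne hne with h' | h'
    · exact ⟨a, b, h', congrArg Subtype.val heq⟩
    · exact ⟨b, a, h', congrArg Subtype.val heq.symm⟩
  set p := s^[a] e₀.1 with hp
  have hper : Function.IsPeriodicPt s (b - a) p := by
    rw [Function.IsPeriodicPt, Function.IsFixedPt, hp, ← Function.iterate_add_apply,
      Nat.sub_add_cancel hab.le, ← heq]
  have hL : 0 < Function.minimalPeriod s p := hper.minimalPeriod_pos (by omega)
  have hpE : ∀ j, (s^[j] p, s^[j + 1] p) ∈ E := fun j => by
    have := hiter (j + a)
    rwa [Function.iterate_add_apply, show j + a + 1 = (j + 1) + a by ring,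
      Function.iterate_add_apply] at this
  have hclosed : s^[Function.minimalPeriod s p] p = p := Function.iterate_minimalPeriod
  refine ⟨Function.minimalPeriod s p, fun j => s^[j] p, ⟨?_, by simp,
    Function.iterate_injOn_Iio_minimalPeriod⟩, hpE⟩
  by_contra! hlt
  have h0 := hpE 0
  have h1 := hpE 1
  rcases (by omega : Function.minimalPeriod s p = 1 ∨ Function.minimalPeriod s p = 2) with h' | h'
  · rw [h'] at hclosed
    simp only [Function.iterate_zero, id_eq, zero_add, hclosed] at h0
    exact hs _ h0 h0
  · rw [h'] at hclosed
    simp only [Function.iterate_zero, id_eq, zero_add] at h0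
    rw [show (1 + 1 : ℕ) = 2 from rfl, hclosed] at h1
    exact hs _ h0 h1

/-- A balanced directed graph without opposite edges is an edge-disjoint union of simple cycles. -/
theorem Balanced.exists_cycles {E : Finset (V × V)} (h : Balanced E) (hs : ∀ e ∈ E, e.swap ∉ E) :
    ∃ (m : ℕ) (L : Fin m → ℕ) (c : Fin m → ℕ → V), (∀ k, IsSimpleCycle (L k) (c k)) ∧
      (∀ k j, (c k j, c k (j + 1)) ∈ E) ∧
      (∀ e ∈ E, ∃ k, ∃ j < L k, e = (c k j, c k (j + 1))) ∧
      ∀ F : V × V → ℂ, ∑ e ∈ E, F e = ∑ k, ∑ j ∈ Finset.range (L k), F (c k j, c k (j + 1)) := by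
  induction hn : E.card using Nat.strong_induction_on generalizing E with
  | _ n ih =>
    subst hn
    rcases E.eq_empty_or_nonempty with rfl | hne
    · exact ⟨0, Fin.elim0, Fin.elim0, fun k => k.elim0, fun k => k.elim0, by simp, by simp⟩
    obtain ⟨L, c, hc, hcE⟩ := exists_simpleCycle h hs hne
    set C := (Finset.range L).image fun j => (c j, c (j + 1)) with hC
    have hinj : InjOn (fun j => (c j, c (j + 1))) (Finset.range L : Set ℕ) := fun j hj j' hj' he =>
      hc.inj (by simpa using hj) (by simpa using hj') (Prod.ext_iff.1 he).1
    have hCE : C ⊆ E := by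
      intro e he
      obtain ⟨j, -, rfl⟩ := Finset.mem_image.1 he
      exact hcE j
    have hCne : C.Nonempty := ⟨_, Finset.mem_image.2 ⟨0, Finset.mem_range.2 (by
      have := hc.three_le; omega), rfl⟩⟩
    -- The increments of a potential along a closed walk telescope to zero, so what is left after
    -- removing the cycle is still balanced.
    have hbal : Balanced (E \ C) := fun φ => by
      have h1 := Finset.sum_sdiff hCE (f := fun e : V × V => φ e.2 - φ e.1)
      rw [h φ, hC, Finset.sum_image hinj] at h1
      simp only at h1
      rw [Finset.sum_range_sub (fun j => φ (c j)), hc.closed, sub_self, add_zero] at h1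
      exact h1
    obtain ⟨m, L', c', h1, h2, h3, h4⟩ := ih (E \ C).card
      (Finset.card_lt_card (Finset.sdiff_ssubset hCE hCne)) hbal
      (fun e he he' => hs e (Finset.mem_sdiff.1 he).1 (Finset.mem_sdiff.1 he').1) rfl
    refine ⟨m + 1, Fin.cons L L', Fin.cons c c', ?_, ?_, ?_, ?_⟩
    · exact Fin.forall_fin_succ.2 ⟨hc, h1⟩
    · exact Fin.forall_fin_succ.2 ⟨hcE, fun k j => (Finset.mem_sdiff.1 (h2 k j)).1⟩
    · intro e he
      by_cases heC : e ∈ C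
      · obtain ⟨j, hj, rfl⟩ := Finset.mem_image.1 heC
        exact ⟨0, j, Finset.mem_range.1 hj, rfl⟩
      · obtain ⟨k, j, hj, he⟩ := h3 e (Finset.mem_sdiff.2 ⟨he, heC⟩)
        exact ⟨k.succ, j, by simpa using hj, by simpa using he⟩
    · intro F
      rw [Fin.sum_univ_succ, ← Finset.sum_sdiff hCE, h4 F, hC, Finset.sum_image hinj, add_comm]
      simp

end Cycles

/-! ### Edges of grid squares -/

/-- The oriented edges of the unit square with lower left corner `q`. -/
def sqEdges (q : ℤ × ℤ) : Finset ((ℤ × ℤ) × (ℤ × ℤ)) :=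
  {((q.1, q.2), (q.1 + 1, q.2)), ((q.1 + 1, q.2), (q.1 + 1, q.2 + 1)),
    ((q.1 + 1, q.2 + 1), (q.1, q.2 + 1)), ((q.1, q.2 + 1), (q.1, q.2))}

lemma sum_sqEdges {M : Type*} [AddCommMonoid M] (q : ℤ × ℤ) (F : (ℤ × ℤ) × (ℤ × ℤ) → M) :
    ∑ e ∈ sqEdges q, F e = F ((q.1, q.2), (q.1 + 1, q.2)) + (F ((q.1 + 1, q.2), (q.1 + 1, q.2 + 1))
      + (F ((q.1 + 1, q.2 + 1), (q.1, q.2 + 1)) + F ((q.1, q.2 + 1), (q.1, q.2)))) := by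
  obtain ⟨a, b⟩ := q
  rw [sqEdges, Finset.sum_insert, Finset.sum_insert, Finset.sum_insert, Finset.sum_singleton] <;>
    simp [Prod.ext_iff]

/-- The squares are run through counterclockwise, so an oriented edge determines its square as the
one on its left. -/
lemma sqEdges_disjoint {q q' : ℤ × ℤ} (h : q ≠ q') : Disjoint (sqEdges q) (sqEdges q') := by
  obtain ⟨a, b⟩ := q
  obtain ⟨a', b'⟩ := q'
  rw [Finset.disjoint_left]
  rintro ⟨⟨x, y⟩, ⟨x', y'⟩⟩ h1 h2
  simp only [sqEdges, Finset.mem_insert, Finset.mem_singleton, Prod.mk.injEq] at h1 h2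
  exact h (by rw [Prod.mk.injEq]; omega)

/-- All edges of the squares in `S`. -/
def allEdges (S : Finset (ℤ × ℤ)) : Finset ((ℤ × ℤ) × (ℤ × ℤ)) := S.biUnion sqEdges

/-- The edges of the boundary of the union of the squares in `S`. -/
def bdEdges (S : Finset (ℤ × ℤ)) : Finset ((ℤ × ℤ) × (ℤ × ℤ)) :=
  (allEdges S).filter fun e => e.swap ∉ allEdges S

lemma swap_notMem_bdEdges {S : Finset (ℤ × ℤ)} {e : (ℤ × ℤ) × (ℤ × ℤ)} (he : e ∈ bdEdges S) :
    e.swap ∉ bdEdges S := fun h => (Finset.mem_filter.1 he).2 (Finset.mem_filter.1 h).1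

/-- The edges of `allEdges S` that are not in `bdEdges S` occur with both orientations, and their
contributions cancel in pairs. -/
lemma sum_bdEdges {M : Type*} [AddCommGroup M] [IsAddTorsionFree M] (S : Finset (ℤ × ℤ))
    {F : (ℤ × ℤ) × (ℤ × ℤ) → M} (hF : ∀ e, F e.swap = -F e) :
    ∑ e ∈ bdEdges S, F e = ∑ q ∈ S, ∑ e ∈ sqEdges q, F e := by
  rw [← Finset.sum_biUnion fun q _ q' _ h => sqEdges_disjoint h]
  change _ = ∑ e ∈ allEdges S, F e
  rw [← Finset.sum_filter_add_sum_filter_not (allEdges S) (fun e => e.swap ∉ allEdges S)]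
  refine (add_eq_left.2 ?_).symm
  refine Finset.sum_involution (fun e _ => e.swap) (fun e _ => by rw [hF, add_neg_cancel])
    (fun e _ hne h => hne ?_) (fun e he => ?_) fun e _ => e.swap_swap
  · have := hF e
    rwa [h, eq_neg_iff_add_eq_zero, ← two_nsmul, nsmul_eq_zero_iff_right two_ne_zero] at this
  · simp only [Finset.mem_filter, not_not, Prod.swap_swap] at he ⊢
    exact ⟨he.2, he.1⟩

lemma balanced_bdEdges (S : Finset (ℤ × ℤ)) : Balanced (bdEdges S) := fun φ => by
  rw [sum_bdEdges S (F := fun e => φ e.2 - φ e.1) fun e => by simp]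
  refine Finset.sum_eq_zero fun q _ => ?_
  rw [sum_sqEdges]
  ring

/-! ### Polygonal curves -/

/-- Truncation to the unit interval. -/
def clamp (y : ℝ) : ℝ := max 0 (min 1 y)

lemma lipschitzWith_clamp : LipschitzWith 1 clamp :=
  (LipschitzWith.id.const_min 1).const_max 0

lemma clamp_of_nonpos {y : ℝ} (h : y ≤ 0) : clamp y = 0 := by
  rw [clamp, min_eq_right (by linarith), max_eq_left h]

lemma clamp_of_one_le {y : ℝ} (h : 1 ≤ y) : clamp y = 1 := by
  rw [clamp, min_eq_left h, max_eq_right zero_le_one]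

lemma clamp_of_mem {y : ℝ} (h0 : 0 ≤ y) (h1 : y ≤ 1) : clamp y = y := by
  rw [clamp, min_eq_right h1, max_eq_right h0]

/-- The polygon through `P 0, …, P L`, parametrized by `[0,1]`. -/
def polygon (L : ℕ) (P : ℕ → ℂ) (t : ℝ) : ℂ :=
  P 0 + ∑ j ∈ Finset.range L, clamp (L * t - j) • (P (j + 1) - P j)

/-- On the j-th time interval the truncations of smaller index are 1 and telescope to P j - P 0, and
those of larger index are 0. -/
lemma polygon_eq {L : ℕ} (P : ℕ → ℂ) {j : ℕ} (hj : j < L) {t : ℝ} (h0 : (j : ℝ) ≤ L * t)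
    (h1 : L * t ≤ j + 1) : polygon L P t = P j + (L * t - j) • (P (j + 1) - P j) := by
  have hsplit : ∑ i ∈ Finset.range L, clamp (L * t - i) • (P (i + 1) - P i)
      = ∑ i ∈ Finset.range (j + 1), clamp (L * t - i) • (P (i + 1) - P i) := by
    refine (Finset.sum_subset (Finset.range_subset_range.2 hj) fun i _ hi => ?_).symm
    rw [Finset.mem_range, not_lt] at hi
    have : (j : ℝ) + 1 ≤ i := by exact_mod_cast hi
    rw [clamp_of_nonpos (by linarith), zero_smul]
  have hlow : ∑ i ∈ Finset.range j, clamp (L * t - i) • (P (i + 1) - P i) = P j - P 0 := by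
    rw [← Finset.sum_range_sub]
    refine Finset.sum_congr rfl fun i hi => ?_
    have : (i : ℝ) + 1 ≤ j := by exact_mod_cast Finset.mem_range.1 hi
    rw [clamp_of_one_le (by linarith), one_smul]
  rw [polygon, hsplit, Finset.sum_range_succ, hlow, clamp_of_mem (by linarith) (by linarith)]
  ring

lemma polygon_zero (L : ℕ) (P : ℕ → ℂ) : polygon L P 0 = P 0 := by
  rw [polygon, Finset.sum_eq_zero, add_zero]
  intro j _
  rw [clamp_of_nonpos (by simp), zero_smul]

lemma polygon_one (L : ℕ) (P : ℕ → ℂ) : polygon L P 1 = P L := by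
  have : ∑ i ∈ Finset.range L, clamp (L * 1 - i) • (P (i + 1) - P i) = P L - P 0 := by
    rw [← Finset.sum_range_sub]
    refine Finset.sum_congr rfl fun i hi => ?_
    have : (i : ℝ) + 1 ≤ L := by exact_mod_cast Finset.mem_range.1 hi
    rw [clamp_of_one_le (by linarith), one_smul]
  rw [polygon, this, add_sub_cancel]

lemma exists_lipschitz_polygon (L : ℕ) (P : ℕ → ℂ) : ∃ K : ℝ≥0, LipschitzWith K (polygon L P) := by
  have h : ∀ s : Finset ℕ, ∃ K : ℝ≥0, LipschitzWith K
      fun t : ℝ => ∑ j ∈ s, clamp (L * t - j) • (P (j + 1) - P j) := by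
    intro s
    induction s using Finset.induction_on with
    | empty => exact ⟨0, by simp only [Finset.sum_empty]; exact LipschitzWith.const 0⟩
    | insert a s ha ih =>
      obtain ⟨K, hK⟩ := ih
      have h1 : LipschitzWith ‖(L : ℝ)‖₊ fun t : ℝ => L * t - a := by
        refine LipschitzWith.of_dist_le_mul fun x y => ?_
        rw [Real.dist_eq, Real.dist_eq, coe_nnnorm, Real.norm_eq_abs, ← abs_mul]
        exact le_of_eq (by congr 1; ring)
      have h2 : LipschitzWith ‖P (a + 1) - P a‖₊ fun r : ℝ => r • (P (a + 1) - P a) := by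
        refine LipschitzWith.of_dist_le_mul fun x y => ?_
        rw [dist_eq_norm, ← sub_smul, norm_smul, coe_nnnorm, mul_comm, Real.dist_eq, Real.norm_eq_abs]
      simp only [Finset.sum_insert ha]
      exact ⟨_, (h2.comp (lipschitzWith_clamp.comp h1)).add hK⟩
  obtain ⟨K, hK⟩ := h (Finset.range L)
  exact ⟨_, (LipschitzWith.const (P 0)).add hK⟩

/-- The integral of `f(w) dw` along the segment from `p` to `q`. -/
def segmentIntegral (f : ℂ → ℂ) (p q : ℂ) : ℂ :=
  ∫ s in (0 : ℝ)..1, f (p + s • (q - p)) * (q - p)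

lemma segmentIntegral_swap (f : ℂ → ℂ) (p q : ℂ) :
    segmentIntegral f q p = -segmentIntegral f p q := by
  have h := intervalIntegral.integral_comp_sub_left
    (fun s : ℝ => f (p + s • (q - p)) * (q - p)) (a := 0) (b := 1) 1
  rw [sub_zero, sub_self] at h
  rw [segmentIntegral, segmentIntegral, ← h, ← intervalIntegral.integral_neg]
  refine intervalIntegral.integral_congr fun s _ => ?_
  have : p + (1 - s) • (q - p) = q + s • (p - q) := by module
  simp only [this]
  ring

lemma exists_edge_of_mem_Icc {L : ℕ} (hL : 0 < L) {t : ℝ} (ht : t ∈ Icc (0 : ℝ) 1) :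
    ∃ j < L, (j : ℝ) ≤ L * t ∧ L * t ≤ j + 1 := by
  have hL' : (0 : ℝ) < L := by exact_mod_cast hL
  rcases ht.2.lt_or_eq with h | h
  · refine ⟨⌊L * t⌋₊, ?_, Nat.floor_le (by have := ht.1; positivity), (Nat.lt_floor_add_one _).le⟩
    rw [Nat.floor_lt (by have := ht.1; positivity)]
    nlinarith
  -- The floor would give the index L at t = 1; the end point belongs to the last edge.
  · refine ⟨L - 1, by omega, ?_, ?_⟩
    · rw [h, mul_one]; exact_mod_cast Nat.sub_le _ _
    · rw [h, mul_one]
      have : ((L - 1 : ℕ) : ℝ) + 1 = L := by exact_mod_cast Nat.sub_add_cancel hL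
      rw [this]

lemma image_polygon {L : ℕ} (hL : 0 < L) (P : ℕ → ℂ) :
    polygon L P '' Icc 0 1 = ⋃ j ∈ Finset.range L, segment ℝ (P j) (P (j + 1)) := by
  have hL' : (0 : ℝ) < L := by exact_mod_cast hL
  ext z
  simp only [mem_image, mem_iUnion, Finset.mem_range, exists_prop]
  constructor
  · rintro ⟨t, ht, rfl⟩
    obtain ⟨j, hj, h0, h1⟩ := exists_edge_of_mem_Icc hL ht
    refine ⟨j, hj, ?_⟩
    rw [polygon_eq P hj h0 h1, segment_eq_image']
    exact ⟨L * t - j, ⟨by linarith, by linarith⟩, rfl⟩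
  · rintro ⟨j, hj, hz⟩
    rw [segment_eq_image'] at hz
    obtain ⟨s, hs, rfl⟩ := hz
    have hj' : (j : ℝ) + 1 ≤ L := by exact_mod_cast hj
    have e : L * ((j + s) / L) = j + s := by field_simp
    refine ⟨(j + s) / L, ⟨by have := hs.1; positivity, ?_⟩, ?_⟩
    · rw [div_le_one hL']; linarith [hs.2]
    · rw [polygon_eq P hj (by rw [e]; linarith [hs.1]) (by rw [e]; linarith [hs.2]), e,
        add_sub_cancel_left]

lemma integral_polygon {L : ℕ} (hL : 0 < L) (P : ℕ → ℂ) {f : ℂ → ℂ}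
    (hf : ContinuousOn f (polygon L P '' Icc 0 1)) :
    ∫ t in (0 : ℝ)..1, f (polygon L P t) * deriv (polygon L P) t
      = ∑ j ∈ Finset.range L, segmentIntegral f (P j) (P (j + 1)) := by
  have hL' : (0 : ℝ) < L := by exact_mod_cast hL
  obtain ⟨K, hK⟩ := exists_lipschitz_polygon L P
  have hint : IntervalIntegrable (fun t => f (polygon L P t) * deriv (polygon L P) t) volume 0 1 := by
    have hK' := hK.lipschitzOnWith (s := Icc 0 1)
    have h1 := intervalIntegrable_smul_curve hK' hf (a := Complex.reCLM)
    have h2 := intervalIntegrable_smul_curve hK' hf (a := Complex.imCLM)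
    refine (h1.add (h2.mul_const Complex.I)).congr fun t _ => ?_
    simp only [Complex.real_smul, Complex.reCLM_apply, Complex.imCLM_apply]
    nth_rewrite 3 [← Complex.re_add_im (deriv (polygon L P) t)]
    ring
  have hsub : ∀ j < L, IntervalIntegrable (fun t => f (polygon L P t) * deriv (polygon L P) t) volume
      ((j : ℝ) / L) (((j + 1 : ℕ) : ℝ) / L) := by
    intro j hj
    refine hint.mono_set ?_
    have hj' : ((j + 1 : ℕ) : ℝ) ≤ L := by exact_mod_cast hj
    rw [uIcc_of_le zero_le_one, uIcc_of_le (by gcongr; simp)]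
    exact Icc_subset_Icc (by positivity) ((div_le_one hL').2 hj')
  have key := intervalIntegral.sum_integral_adjacent_intervals hsub
  rw [Nat.cast_zero, zero_div, div_self hL'.ne'] at key
  rw [← key]
  refine Finset.sum_congr rfl fun j hj => ?_
  have hj := Finset.mem_range.1 hj
  have hle : (j : ℝ) / L ≤ ((j + 1 : ℕ) : ℝ) / L := by gcongr; simp
  -- On the open interval the polygon is affine, so `deriv` has its constant slope; the vertices
  -- form a null set.
  have hcong : ∫ t in ((j : ℝ) / L)..(((j + 1 : ℕ) : ℝ) / L),
      f (polygon L P t) * deriv (polygon L P) t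
      = ∫ t in ((j : ℝ) / L)..(((j + 1 : ℕ) : ℝ) / L), (L : ℝ) •
        (fun s : ℝ => f (P j + s • (P (j + 1) - P j)) * (P (j + 1) - P j)) (L * t - j) := by
    rw [intervalIntegral.integral_of_le hle, intervalIntegral.integral_of_le hle,
      integral_Ioc_eq_integral_Ioo, integral_Ioc_eq_integral_Ioo]
    refine setIntegral_congr_fun measurableSet_Ioo fun t ht => ?_
    have hloc : ∀ s ∈ Ioo ((j : ℝ) / L) (((j + 1 : ℕ) : ℝ) / L),
        polygon L P s = P j + (L * s - j) • (P (j + 1) - P j) := fun s hs => by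
      have h0 := (div_lt_iff₀' hL').1 hs.1
      have h1 := (lt_div_iff₀' hL').1 hs.2
      push_cast at h1
      exact polygon_eq P hj h0.le h1.le
    have hder : HasDerivAt (polygon L P) ((L : ℝ) • (P (j + 1) - P j)) t := by
      have h1 : HasDerivAt (fun s : ℝ => P j + (L * s - j) • (P (j + 1) - P j))
          ((L : ℝ) • (P (j + 1) - P j)) t := by
        have := ((((hasDerivAt_id t).const_mul (L : ℝ)).sub_const (j : ℝ)).smul_const
          (P (j + 1) - P j)).const_add (P j)
        simpa using this
      refine h1.congr_of_eventuallyEq ?_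
      filter_upwards [isOpen_Ioo.mem_nhds ht] with s hs using hloc s hs
    simp only [hder.deriv, hloc t ht, Complex.real_smul]
    ring
  have hsc := intervalIntegral.smul_integral_comp_mul_sub
    (fun s : ℝ => f (P j + s • (P (j + 1) - P j)) * (P (j + 1) - P j)) (L : ℝ) (j : ℝ)
    (a := (j : ℝ) / L) (b := ((j + 1 : ℕ) : ℝ) / L)
  rw [mul_div_cancel₀ _ hL'.ne', mul_div_cancel₀ _ hL'.ne', sub_self, Nat.cast_add, Nat.cast_one,
    add_sub_cancel_left] at hsc
  rw [hcong, intervalIntegral.integral_smul, segmentIntegral]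
  push_cast
  exact hsc

/-! ### The square grid -/

/-- The point `h (a + i b)` of the grid with mesh `h`. -/
def gridPt (h : ℝ) (q : ℤ × ℤ) : ℂ := ⟨h * q.1, h * q.2⟩

/-- The steps of length one along the coordinate axes. -/
def IsUnitStep (e : (ℤ × ℤ) × (ℤ × ℤ)) : Prop :=
  (e.2.1 = e.1.1 + 1 ∧ e.2.2 = e.1.2) ∨ (e.2.1 = e.1.1 - 1 ∧ e.2.2 = e.1.2) ∨
    (e.2.1 = e.1.1 ∧ e.2.2 = e.1.2 + 1) ∨ (e.2.1 = e.1.1 ∧ e.2.2 = e.1.2 - 1)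

lemma isUnitStep_of_mem_bdEdges {S : Finset (ℤ × ℤ)} {e : (ℤ × ℤ) × (ℤ × ℤ)}
    (he : e ∈ bdEdges S) : IsUnitStep e := by
  obtain ⟨q, -, hq⟩ := Finset.mem_biUnion.1 (Finset.mem_filter.1 he).1
  obtain ⟨⟨x, y⟩, ⟨x', y'⟩⟩ := e
  simp only [sqEdges, Finset.mem_insert, Finset.mem_singleton, Prod.mk.injEq] at hq
  simp only [IsUnitStep]
  omega

/-- Half-open edges do not contain their end vertex, so two of them meet only if they start at the
same vertex or are opposite. This is all that injectivity of the boundary polygons requires. -/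
lemma IsUnitStep.eq_or_eq_swap {e e' : (ℤ × ℤ) × (ℤ × ℤ)} (he : IsUnitStep e) (he' : IsUnitStep e')
    {s s' : ℝ} (hs : s ∈ Ico (0 : ℝ) 1) (hs' : s' ∈ Ico (0 : ℝ) 1)
    (h1 : (e.1.1 : ℝ) + s * (e.2.1 - e.1.1) = e'.1.1 + s' * (e'.2.1 - e'.1.1))
    (h2 : (e.1.2 : ℝ) + s * (e.2.2 - e.1.2) = e'.1.2 + s' * (e'.2.2 - e'.1.2)) :
    e.1 = e'.1 ∨ e' = e.swap := by
  obtain ⟨⟨x, y⟩, ⟨x₁, y₁⟩⟩ := e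
  obtain ⟨⟨x', y'⟩, ⟨x₁', y₁'⟩⟩ := e'
  obtain ⟨hs0, hs1⟩ := hs
  obtain ⟨hs0', hs1'⟩ := hs'
  simp only [IsUnitStep, Prod.swap_prod_mk, Prod.mk.injEq] at *
  rcases he with ⟨hx, hy⟩ | ⟨hx, hy⟩ | ⟨hx, hy⟩ | ⟨hx, hy⟩ <;>
  rcases he' with ⟨hx', hy'⟩ | ⟨hx', hy'⟩ | ⟨hx', hy'⟩ | ⟨hx', hy'⟩ <;>
  · rw [hx, hx'] at h1
    rw [hy, hy'] at h2
    push_cast at h1 h2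
    ring_nf at h1 h2
    -- The starting vertices differ by at most 1 in each coordinate, which leaves finitely many
    -- cases.
    have a1 : (x : ℝ) < x' + 2 := by linarith
    have a2 : (x' : ℝ) < x + 2 := by linarith
    have a3 : (y : ℝ) < y' + 2 := by linarith
    have a4 : (y' : ℝ) < y + 2 := by linarith
    norm_cast at a1 a2 a3 a4
    have hk : x' = x - 1 ∨ x' = x ∨ x' = x + 1 := by omega
    have hl : y' = y - 1 ∨ y' = y ∨ y' = y + 1 := by omega
    rcases hk with hk | hk | hk <;> rcases hl with hl | hl | hl <;>
      first
        | (exfalso; rw [hk] at h1; rw [hl] at h2; push_cast at h1 h2; linarith)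
        | (left; constructor <;> omega)
        | (right; refine ⟨⟨?_, ?_⟩, ?_, ?_⟩ <;> omega)

/-- Opposite edges do not both occur in the boundary, and edges with the same start are the same
edge of a simple cycle. Different cycles may still share vertices, which is harmless. -/
lemma injOn_polygon_gridPt {h : ℝ} (hh : h ≠ 0) {L : ℕ} {c : ℕ → ℤ × ℤ} (hc : IsSimpleCycle L c)
    {S : Finset (ℤ × ℤ)} (hE : ∀ j, (c j, c (j + 1)) ∈ bdEdges S) :
    InjOn (polygon L fun j => gridPt h (c j)) (Ico 0 1) := by
  have hL : 0 < L := by have := hc.three_le; omega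
  have hL' : (0 : ℝ) < L := by exact_mod_cast hL
  have key : ∀ t ∈ Ico (0 : ℝ) 1, ∃ j < L, ∃ s ∈ Ico (0 : ℝ) 1, L * t = j + s ∧
      polygon L (fun j => gridPt h (c j)) t
        = gridPt h (c j) + s • (gridPt h (c (j + 1)) - gridPt h (c j)) := by
    intro t ht
    have h0 : 0 ≤ L * t := mul_nonneg hL'.le ht.1
    have hj : ⌊L * t⌋₊ < L := by rw [Nat.floor_lt h0]; nlinarith [ht.2]
    have hf := Nat.floor_le h0
    have hf' := Nat.lt_floor_add_one (L * t)
    exact ⟨⌊L * t⌋₊, hj, L * t - ⌊L * t⌋₊, ⟨by linarith, by linarith⟩, by ring,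
      polygon_eq _ hj hf hf'.le⟩
  intro t ht t' ht' heq
  obtain ⟨j, hj, s, hs, hts, hp⟩ := key t ht
  obtain ⟨j', hj', s', hs', hts', hp'⟩ := key t' ht'
  rw [hp, hp'] at heq
  have h1 := congrArg Complex.re heq
  have h2 := congrArg Complex.im heq
  simp only [gridPt, Complex.add_re, Complex.add_im, Complex.real_smul, Complex.mul_re,
    Complex.mul_im, Complex.sub_re, Complex.sub_im, Complex.ofReal_re, Complex.ofReal_im, zero_mul,
    sub_zero, add_zero] at h1 h2
  have h1' : ((c j).1 : ℝ) + s * ((c (j + 1)).1 - (c j).1)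
      = (c j').1 + s' * ((c (j' + 1)).1 - (c j').1) := by
    apply mul_left_cancel₀ hh; linear_combination h1
  have h2' : ((c j).2 : ℝ) + s * ((c (j + 1)).2 - (c j).2)
      = (c j').2 + s' * ((c (j' + 1)).2 - (c j').2) := by
    apply mul_left_cancel₀ hh; linear_combination h2
  rcases (isUnitStep_of_mem_bdEdges (hE j)).eq_or_eq_swap (isUnitStep_of_mem_bdEdges (hE j'))
    hs hs' h1' h2' with h | h
  · obtain rfl : j = j' := hc.inj hj hj' h
    have hss : s = s' := by
      rcases isUnitStep_of_mem_bdEdges (hE j) with h | h | h | h <;> simp only at h <;>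
        rw [h.1] at h1' <;> rw [h.2] at h2' <;> push_cast at h1' h2' <;> linarith
    have : L * t = L * t' := by rw [hts, hts', hss]
    exact mul_left_cancel₀ hL'.ne' this
  · exact absurd (h ▸ hE j') (swap_notMem_bdEdges (hE j))

/-! ### Winding numbers of squares -/

/-- The factor ω rotates a half-plane that contains the segment, with z on its boundary line, into
the right half-plane, where log((w - z)ω) is a primitive of the integrand. -/
lemma segmentIntegral_inv {p q z ω : ℂ} (hω : ω ≠ 0) (hp : 0 < ((p - z) * ω).re)
    (hq : 0 < ((q - z) * ω).re) :
    segmentIntegral (fun w => (w - z)⁻¹) p q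
      = Complex.log ((q - z) * ω) - Complex.log ((p - z) * ω) := by
  have hpos : ∀ s ∈ Icc (0 : ℝ) 1, 0 < ((p + s • (q - p) - z) * ω).re := by
    intro s hs
    have : (p + s • (q - p) - z) * ω = (1 - s) • ((p - z) * ω) + s • ((q - z) * ω) := by
      simp only [Complex.real_smul]; push_cast; ring
    rw [this, Complex.add_re, Complex.smul_re, Complex.smul_re, smul_eq_mul, smul_eq_mul]
    rcases hs.1.eq_or_lt with h | h
    · rw [← h]; simpa using hp
    · have h1 := mul_pos h hq
      have h2 := mul_nonneg (sub_nonneg.2 hs.2) hp.le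
      linarith
  have hd : ∀ s ∈ uIcc (0 : ℝ) 1, HasDerivAt (fun s : ℝ => Complex.log ((p + s • (q - p) - z) * ω))
      ((p + s • (q - p) - z)⁻¹ * (q - p)) s := by
    intro s hs
    rw [uIcc_of_le zero_le_one] at hs
    have hne : (p + s • (q - p) - z) * ω ≠ 0 := fun h => by
      have h0 := hpos s hs; rw [h, Complex.zero_re] at h0; exact h0.false
    have h1 : HasDerivAt (fun s : ℝ => (p + s • (q - p) - z) * ω) ((q - p) * ω) s := by
      have := (((((hasDerivAt_id s).smul_const (q - p)).const_add p).sub_const z).mul_const ω)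
      simpa using this
    have h2 := h1.clog_real (Or.inl (hpos s hs))
    convert h2 using 1
    have := left_ne_zero_of_mul hne
    field_simp
  have hcont : ContinuousOn (fun s : ℝ => (p + s • (q - p) - z)⁻¹ * (q - p)) (uIcc 0 1) := by
    refine ContinuousOn.mul (ContinuousOn.inv₀ (by fun_prop) fun s hs h => ?_) continuousOn_const
    rw [uIcc_of_le zero_le_one] at hs
    have h0 := hpos s hs; rw [h, zero_mul, Complex.zero_re] at h0; exact h0.false
  rw [segmentIntegral, intervalIntegral.integral_eq_sub_of_hasDerivAt hd hcont.intervalIntegrable]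
  simp

/-- The argument of w lies between 0 and π/2, so a rotation by -π/2 does not leave the principal
branch. -/
lemma log_neg_I_mul {w : ℂ} (hr : 0 < w.re) (hi : 0 < w.im) :
    Complex.log (-Complex.I * w) = Complex.log w - Real.pi / 2 * Complex.I := by
  have hw : w ≠ 0 := fun h => by simp [h] at hr
  have h0 := Complex.arg_nonneg_iff.2 hi.le
  have h1 := (abs_le.1 (Complex.abs_arg_le_pi_div_two_iff.2 hr.le)).2
  have hpi := Real.pi_pos
  rw [(Complex.log_mul_eq_add_log_iff (neg_ne_zero.2 Complex.I_ne_zero) hw).2, Complex.log_neg_I]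
  · ring
  · rw [Complex.arg_neg_I]
    constructor <;> linarith

/-- The closed square with lower left corner `q` of the grid with mesh `h`. -/
def gridSq (h : ℝ) (q : ℤ × ℤ) : Set ℂ :=
  Icc (h * q.1) (h * (q.1 + 1)) ×ℂ Icc (h * q.2) (h * (q.2 + 1))

/-- The corresponding open square. -/
def gridSqInt (h : ℝ) (q : ℤ × ℤ) : Set ℂ :=
  Ioo (h * q.1) (h * (q.1 + 1)) ×ℂ Ioo (h * q.2) (h * (q.2 + 1))

lemma mem_gridSq {h : ℝ} {q : ℤ × ℤ} {z : ℂ} : z ∈ gridSq h q ↔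
    (h * q.1 ≤ z.re ∧ z.re ≤ h * (q.1 + 1)) ∧ h * q.2 ≤ z.im ∧ z.im ≤ h * (q.2 + 1) := Iff.rfl

lemma mem_gridSqInt {h : ℝ} {q : ℤ × ℤ} {z : ℂ} : z ∈ gridSqInt h q ↔
    (h * q.1 < z.re ∧ z.re < h * (q.1 + 1)) ∧ h * q.2 < z.im ∧ z.im < h * (q.2 + 1) := Iff.rfl

/-- The integral of `dw / (w - z)` along an edge. -/
def edgeInt (h : ℝ) (z : ℂ) (e : (ℤ × ℤ) × (ℤ × ℤ)) : ℂ :=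
  segmentIntegral (fun w => (w - z)⁻¹) (gridPt h e.1) (gridPt h e.2)

/-- Each side has its own branch of the logarithm, with ω = i, 1, -i, -1. At each of the four
corners the branches of the adjacent sides differ by iπ/2. -/
lemma sum_edgeInt_of_mem {h : ℝ} {q : ℤ × ℤ} {z : ℂ} (hz : z ∈ gridSqInt h q) :
    ∑ e ∈ sqEdges q, edgeInt h z e = 2 * Real.pi * Complex.I := by
  obtain ⟨⟨h1, h2⟩, h3, h4⟩ := mem_gridSqInt.1 hz
  rw [sum_sqEdges]
  simp only [edgeInt]
  set BL := gridPt h (q.1, q.2) with hBL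
  set BR := gridPt h (q.1 + 1, q.2) with hBR
  set TR := gridPt h (q.1 + 1, q.2 + 1) with hTR
  set TL := gridPt h (q.1, q.2 + 1) with hTL
  rw [segmentIntegral_inv (ω := Complex.I), segmentIntegral_inv (ω := 1),
    segmentIntegral_inv (ω := -Complex.I), segmentIntegral_inv (ω := -1)]
  · have e1 : Complex.log ((BR - z) * 1) = Complex.log ((BR - z) * Complex.I)
        - Real.pi / 2 * Complex.I := by
      rw [← log_neg_I_mul]
      · congr 1; linear_combination (BR - z) * Complex.I_sq
      · simp [hBR, gridPt]; linarith
      · simp [hBR, gridPt]; linarith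
    have e2 : Complex.log ((TR - z) * -Complex.I) = Complex.log ((TR - z) * 1)
        - Real.pi / 2 * Complex.I := by
      rw [← log_neg_I_mul]
      · congr 1; ring
      · simp [hTR, gridPt]; linarith
      · simp [hTR, gridPt]; linarith
    have e3 : Complex.log ((TL - z) * -1) = Complex.log ((TL - z) * -Complex.I)
        - Real.pi / 2 * Complex.I := by
      rw [← log_neg_I_mul]
      · congr 1; linear_combination (-(TL - z)) * Complex.I_sq
      · simp [hTL, gridPt]; linarith
      · simp [hTL, gridPt]; linarith
    have e4 : Complex.log ((BL - z) * Complex.I) = Complex.log ((BL - z) * -1)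
        - Real.pi / 2 * Complex.I := by
      rw [← log_neg_I_mul]
      · congr 1; ring
      · simp [hBL, gridPt]; linarith
      · simp [hBL, gridPt]; linarith
    rw [e1, e2, e3, e4]
    ring
  all_goals first
    | simp; done
    | (simp [hBL, hBR, hTR, hTL, gridPt]; linarith)

/-- A point outside the closed square is separated from it by a line parallel to an axis, so one
branch serves all four sides and the sum telescopes. -/
lemma sum_edgeInt_of_notMem {h : ℝ} (hh : 0 < h) {q : ℤ × ℤ} {z : ℂ} (hz : z ∉ gridSq h q) :
    ∑ e ∈ sqEdges q, edgeInt h z e = 0 := by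
  have key : ∀ ω : ℂ, ω ≠ 0 → 0 < ((gridPt h (q.1, q.2) - z) * ω).re →
      0 < ((gridPt h (q.1 + 1, q.2) - z) * ω).re → 0 < ((gridPt h (q.1 + 1, q.2 + 1) - z) * ω).re →
      0 < ((gridPt h (q.1, q.2 + 1) - z) * ω).re → ∑ e ∈ sqEdges q, edgeInt h z e = 0 := by
    intro ω hω h1 h2 h3 h4
    rw [sum_sqEdges]
    simp only [edgeInt]
    rw [segmentIntegral_inv hω h1 h2, segmentIntegral_inv hω h2 h3, segmentIntegral_inv hω h3 h4,
      segmentIntegral_inv hω h4 h1]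
    ring
  rw [mem_gridSq, not_and_or, not_and_or, not_and_or, not_le, not_le, not_le, not_le] at hz
  rcases hz with (hz | hz) | hz | hz
  · refine key 1 one_ne_zero ?_ ?_ ?_ ?_ <;> simp [gridPt] <;> nlinarith
  · refine key (-1) (by simp) ?_ ?_ ?_ ?_ <;> simp [gridPt] <;> nlinarith
  · refine key (-Complex.I) (by simp) ?_ ?_ ?_ ?_ <;> simp [gridPt] <;> nlinarith
  · refine key Complex.I (by simp) ?_ ?_ ?_ ?_ <;> simp [gridPt] <;> nlinarith

/-! ### Unions of grid squares -/

lemma exists_swap_mem_sqEdges {q : ℤ × ℤ} {e : (ℤ × ℤ) × (ℤ × ℤ)} (he : e ∈ sqEdges q) :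
    ∃ q', e.swap ∈ sqEdges q' := by
  obtain ⟨a, b⟩ := q
  simp only [sqEdges, Finset.mem_insert, Finset.mem_singleton] at he
  rcases he with rfl | rfl | rfl | rfl
  · exact ⟨(a, b - 1), by simp [sqEdges]⟩
  · exact ⟨(a + 1, b), by simp [sqEdges]⟩
  · exact ⟨(a, b + 1), by simp [sqEdges]⟩
  · exact ⟨(a - 1, b), by simp [sqEdges]⟩

lemma isClosed_gridSq (h : ℝ) (q : ℤ × ℤ) : IsClosed (gridSq h q) :=
  isClosed_Icc.reProdIm isClosed_Icc

lemma isOpen_gridSqInt (h : ℝ) (q : ℤ × ℤ) : IsOpen (gridSqInt h q) :=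
  isOpen_Ioo.reProdIm isOpen_Ioo

lemma closure_gridSqInt {h : ℝ} (hh : 0 < h) (q : ℤ × ℤ) :
    closure (gridSqInt h q) = gridSq h q := by
  rw [gridSqInt, Complex.closure_reProdIm, closure_Ioo (by nlinarith), closure_Ioo (by nlinarith),
    gridSq]

lemma eq_of_mem_gridSqInt {h : ℝ} (hh : 0 < h) {q q' : ℤ × ℤ} {z : ℂ} (hz : z ∈ gridSqInt h q)
    (hz' : z ∈ gridSq h q') : q = q' := by
  obtain ⟨⟨h1, h2⟩, h3, h4⟩ := mem_gridSqInt.1 hz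
  obtain ⟨⟨h1', h2'⟩, h3', h4'⟩ := mem_gridSq.1 hz'
  have a1 := lt_of_mul_lt_mul_left (h1.trans_le h2') hh.le
  have a2 := lt_of_mul_lt_mul_left (h1'.trans_lt h2) hh.le
  have a3 := lt_of_mul_lt_mul_left (h3.trans_le h4') hh.le
  have a4 := lt_of_mul_lt_mul_left (h3'.trans_lt h4) hh.le
  norm_cast at a1 a2 a3 a4
  ext <;> omega

lemma gridPt_mem_gridSq {h : ℝ} (hh : 0 < h) {q : ℤ × ℤ} {e : (ℤ × ℤ) × (ℤ × ℤ)}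
    (he : e ∈ sqEdges q) : gridPt h e.1 ∈ gridSq h q ∧ gridPt h e.2 ∈ gridSq h q := by
  simp only [sqEdges, Finset.mem_insert, Finset.mem_singleton] at he
  rcases he with rfl | rfl | rfl | rfl <;>
    (simp only [mem_gridSq, gridPt]; push_cast; refine ⟨⟨⟨?_, ?_⟩, ?_, ?_⟩, ⟨?_, ?_⟩, ?_, ?_⟩ <;> nlinarith)

lemma convex_gridSq (h : ℝ) (q : ℤ × ℤ) : Convex ℝ (gridSq h q) :=
  ((convex_Icc _ _).linear_preimage Complex.reLm).inter
    ((convex_Icc _ _).linear_preimage Complex.imLm)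

/-- The segment of an edge. -/
def edgeSeg (h : ℝ) (e : (ℤ × ℤ) × (ℤ × ℤ)) : Set ℂ := segment ℝ (gridPt h e.1) (gridPt h e.2)

lemma edgeSeg_swap (h : ℝ) (e : (ℤ × ℤ) × (ℤ × ℤ)) : edgeSeg h e.swap = edgeSeg h e :=
  segment_symm _ _ _

lemma edgeSeg_subset {h : ℝ} (hh : 0 < h) {q : ℤ × ℤ} {e : (ℤ × ℤ) × (ℤ × ℤ)}
    (he : e ∈ sqEdges q) : edgeSeg h e ⊆ gridSq h q :=
  (convex_gridSq h q).segment_subset (gridPt_mem_gridSq hh he).1 (gridPt_mem_gridSq hh he).2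

lemma exists_edge_of_horizontal {h : ℝ} (hh : 0 < h) {a a' b : ℤ} (ha : a ≠ a') {z : ℂ}
    (hz : z ∈ gridSq h (a, b)) (hz' : z ∈ gridSq h (a', b)) :
    ∃ e ∈ sqEdges (a, b), e.swap ∈ sqEdges (a', b) ∧ z ∈ edgeSeg h e := by
  have main : ∀ a : ℤ, z ∈ gridSq h (a, b) → z ∈ gridSq h (a + 1, b) →
      z ∈ edgeSeg h ((a + 1, b), (a + 1, b + 1)) := by
    intro a hz hz'
    obtain ⟨⟨h1, h2⟩, h3, h4⟩ := mem_gridSq.1 hz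
    obtain ⟨⟨h1', h2'⟩, -⟩ := mem_gridSq.1 hz'
    push_cast at *
    rw [edgeSeg, segment_eq_image']
    refine ⟨z.im / h - b, ⟨?_, ?_⟩, ?_⟩
    · rw [sub_nonneg, le_div_iff₀ hh]; linarith
    · rw [sub_le_iff_le_add, div_le_iff₀ hh]; linarith
    · apply Complex.ext
      · simp [gridPt]; linarith
      · simp [gridPt]; field_simp; ring
  obtain ⟨⟨h1, h2⟩, h3, h4⟩ := mem_gridSq.1 hz
  obtain ⟨⟨h1', h2'⟩, h3', h4'⟩ := mem_gridSq.1 hz'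
  have a1 := le_of_mul_le_mul_left (h1.trans h2') hh
  have a2 := le_of_mul_le_mul_left (h1'.trans h2) hh
  norm_cast at a1 a2
  simp only at a1 a2
  rcases (show a' = a + 1 ∨ a = a' + 1 by omega) with rfl | rfl
  · exact ⟨((a + 1, b), (a + 1, b + 1)), by simp [sqEdges], by simp [sqEdges], main _ hz hz'⟩
  · exact ⟨((a' + 1, b + 1), (a' + 1, b)), by simp [sqEdges], by simp [sqEdges],
      by rw [← edgeSeg_swap]; exact main _ hz' hz⟩

lemma exists_edge_of_vertical {h : ℝ} (hh : 0 < h) {a b b' : ℤ} (hb : b ≠ b') {z : ℂ}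
    (hz : z ∈ gridSq h (a, b)) (hz' : z ∈ gridSq h (a, b')) :
    ∃ e ∈ sqEdges (a, b), e.swap ∈ sqEdges (a, b') ∧ z ∈ edgeSeg h e := by
  have main : ∀ b : ℤ, z ∈ gridSq h (a, b) → z ∈ gridSq h (a, b + 1) →
      z ∈ edgeSeg h ((a, b + 1), (a + 1, b + 1)) := by
    intro b hz hz'
    obtain ⟨⟨h1, h2⟩, h3, h4⟩ := mem_gridSq.1 hz
    obtain ⟨-, h3', h4'⟩ := mem_gridSq.1 hz'
    push_cast at *
    rw [edgeSeg, segment_eq_image']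
    refine ⟨z.re / h - a, ⟨?_, ?_⟩, ?_⟩
    · rw [sub_nonneg, le_div_iff₀ hh]; linarith
    · rw [sub_le_iff_le_add, div_le_iff₀ hh]; linarith
    · apply Complex.ext
      · simp [gridPt]; field_simp; ring
      · simp [gridPt]; linarith
  obtain ⟨⟨h1, h2⟩, h3, h4⟩ := mem_gridSq.1 hz
  obtain ⟨⟨h1', h2'⟩, h3', h4'⟩ := mem_gridSq.1 hz'
  have a1 := le_of_mul_le_mul_left (h3.trans h4') hh
  have a2 := le_of_mul_le_mul_left (h3'.trans h4) hh
  norm_cast at a1 a2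
  simp only at a1 a2
  rcases (show b' = b + 1 ∨ b = b' + 1 by omega) with rfl | rfl
  · exact ⟨((a + 1, b + 1), (a, b + 1)), by simp [sqEdges], by simp [sqEdges],
      by rw [← edgeSeg_swap]; exact main _ hz hz'⟩
  · exact ⟨((a, b' + 1), (a + 1, b' + 1)), by simp [sqEdges], by simp [sqEdges], main _ hz' hz⟩

/-- The union of the closed squares in `S`. -/
def gridUnion (h : ℝ) (S : Finset (ℤ × ℤ)) : Set ℂ := ⋃ q ∈ S, gridSq h q

lemma mem_gridUnion {h : ℝ} {S : Finset (ℤ × ℤ)} {z : ℂ} :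
    z ∈ gridUnion h S ↔ ∃ q ∈ S, z ∈ gridSq h q := by simp [gridUnion]

lemma isClosed_gridUnion (h : ℝ) (S : Finset (ℤ × ℤ)) : IsClosed (gridUnion h S) :=
  S.finite_toSet.isClosed_biUnion fun q _ => isClosed_gridSq h q

lemma gridSqInt_subset {h : ℝ} (hh : 0 < h) {S : Finset (ℤ × ℤ)} {q : ℤ × ℤ} (hq : q ∈ S) :
    gridSqInt h q ⊆ interior (gridUnion h S) :=
  interior_maximal (fun _ hz => mem_gridUnion.2
    ⟨q, hq, closure_gridSqInt hh q ▸ subset_closure hz⟩) (isOpen_gridSqInt h q)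

lemma closure_interior_gridUnion {h : ℝ} (hh : 0 < h) (S : Finset (ℤ × ℤ)) :
    closure (interior (gridUnion h S)) = gridUnion h S := by
  refine (closure_minimal interior_subset (isClosed_gridUnion h S)).antisymm fun z hz => ?_
  obtain ⟨q, hq, hzq⟩ := mem_gridUnion.1 hz
  rw [← closure_gridSqInt hh] at hzq
  exact closure_mono (gridSqInt_subset hh hq) hzq

/-- For y near x the floor of y lies between ⌈x⌉ - 1 and ⌊x⌋. So the grid cell of a point near z
also contains z, which gives `mem_interior_gridUnion`. -/
lemma eventually_floor (x : ℝ) : ∀ᶠ y : ℝ in 𝓝 x, (⌊y⌋ : ℝ) ≤ x ∧ x ≤ ⌊y⌋ + 1 := by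
  have h1 : ∀ᶠ y : ℝ in 𝓝 x, y < ⌊x⌋ + 1 := eventually_lt_nhds (Int.lt_floor_add_one x)
  have h2 : ∀ᶠ y : ℝ in 𝓝 x, (⌈x⌉ : ℝ) - 1 < y :=
    eventually_gt_nhds (by linarith [Int.ceil_lt_add_one x])
  filter_upwards [h1, h2] with y hy1 hy2
  have a1 : ⌊y⌋ < ⌊x⌋ + 1 := Int.floor_lt.2 (by push_cast; exact hy1)
  have a2 : ⌈x⌉ - 1 ≤ ⌊y⌋ := Int.le_floor.2 (by push_cast; exact hy2.le)
  constructor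
  · exact le_trans (by exact_mod_cast Int.lt_add_one_iff.1 a1) (Int.floor_le x)
  · exact (Int.le_ceil x).trans (by have : ⌈x⌉ ≤ ⌊y⌋ + 1 := by linarith
                                    exact_mod_cast this)

lemma mem_gridSq_floor {h : ℝ} (hh : 0 < h) {z : ℂ} {a b : ℤ}
    (ha : (a : ℝ) ≤ z.re / h ∧ z.re / h ≤ a + 1) (hb : (b : ℝ) ≤ z.im / h ∧ z.im / h ≤ b + 1) :
    z ∈ gridSq h (a, b) := by
  rw [le_div_iff₀ hh, div_le_iff₀ hh] at ha hb
  rw [mem_gridSq]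
  exact ⟨⟨by linarith [ha.1], by linarith [ha.2]⟩, by linarith [hb.1], by linarith [hb.2]⟩

lemma mem_interior_gridUnion {h : ℝ} (hh : 0 < h) {S : Finset (ℤ × ℤ)} {z : ℂ}
    (hz : ∀ q, z ∈ gridSq h q → q ∈ S) : z ∈ interior (gridUnion h S) := by
  rw [mem_interior_iff_mem_nhds]
  have h1 : Tendsto (fun w : ℂ => w.re / h) (𝓝 z) (𝓝 (z.re / h)) :=
    (Complex.continuous_re.div_const h).tendsto z
  have h2 : Tendsto (fun w : ℂ => w.im / h) (𝓝 z) (𝓝 (z.im / h)) :=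
    (Complex.continuous_im.div_const h).tendsto z
  filter_upwards [h1.eventually (eventually_floor _), h2.eventually (eventually_floor _)]
    with w hw1 hw2
  refine mem_gridUnion.2 ⟨_, hz _ (mem_gridSq_floor hh hw1 hw2), mem_gridSq_floor hh ?_ ?_⟩
  · exact ⟨Int.floor_le _, (Int.lt_floor_add_one _).le⟩
  · exact ⟨Int.floor_le _, (Int.lt_floor_add_one _).le⟩

lemma mem_bdEdges_of_swap {S : Finset (ℤ × ℤ)} {q q' : ℤ × ℤ} {e : (ℤ × ℤ) × (ℤ × ℤ)} (hq : q ∈ S)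
    (hq' : q' ∉ S) (he : e ∈ sqEdges q) (he' : e.swap ∈ sqEdges q') : e ∈ bdEdges S := by
  refine Finset.mem_filter.2 ⟨Finset.mem_biUnion.2 ⟨q, hq, he⟩, fun h => ?_⟩
  obtain ⟨q₂, hq₂, he₂⟩ := Finset.mem_biUnion.1 h
  rcases eq_or_ne q₂ q' with rfl | hne
  · exact hq' hq₂
  · exact Finset.disjoint_left.1 (sqEdges_disjoint hne) he₂ he'

/-- A frontier point lies in a square of S and in one not in S, and an edge between two such
neighbours belongs to the boundary. Conversely, the square across a boundary edge is not in S, and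
its interior points accumulate at the edge. -/
lemma frontier_interior_gridUnion {h : ℝ} (hh : 0 < h) (S : Finset (ℤ × ℤ)) :
    frontier (interior (gridUnion h S)) = ⋃ e ∈ bdEdges S, edgeSeg h e := by
  rw [frontier, closure_interior_gridUnion hh, interior_interior]
  ext z
  simp only [Set.mem_sdiff, mem_iUnion, exists_prop]
  constructor
  · rintro ⟨hz, hzi⟩
    obtain ⟨q, hq, hzq⟩ := mem_gridUnion.1 hz
    obtain ⟨q', hzq', hq'⟩ : ∃ q', z ∈ gridSq h q' ∧ q' ∉ S := by
      by_contra! hall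
      exact hzi (mem_interior_gridUnion hh hall)
    -- The two squares may touch only at a corner. This third square shares a row with one and a
    -- column with the other, so one of the two steps through it leaves S across an edge containing
    -- z.
    have hz'' : z ∈ gridSq h (q.1, q'.2) := ⟨hzq.1, hzq'.2⟩
    by_cases hS : (q.1, q'.2) ∈ S
    · have hne : q.1 ≠ q'.1 := fun h' => hq' (by rwa [h'] at hS)
      obtain ⟨e, he, he', hze⟩ := exists_edge_of_horizontal hh hne hz'' hzq'
      exact ⟨e, mem_bdEdges_of_swap hS hq' he he', hze⟩
    · have hne : q.2 ≠ q'.2 := fun h' => hS (by rw [← h']; exact hq)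
      obtain ⟨e, he, he', hze⟩ := exists_edge_of_vertical hh hne hzq hz''
      exact ⟨e, mem_bdEdges_of_swap hq hS he he', hze⟩
  · rintro ⟨e, he, hze⟩
    obtain ⟨q, hq, heq⟩ := Finset.mem_biUnion.1 (Finset.mem_filter.1 he).1
    obtain ⟨q', heq'⟩ := exists_swap_mem_sqEdges heq
    have hq' : q' ∉ S := fun h' => (Finset.mem_filter.1 he).2 (Finset.mem_biUnion.2 ⟨q', h', heq'⟩)
    refine ⟨mem_gridUnion.2 ⟨q, hq, edgeSeg_subset hh heq hze⟩, fun hzi => ?_⟩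
    have hz' : z ∈ closure (gridSqInt h q') := by
      rw [closure_gridSqInt hh]
      exact edgeSeg_subset hh heq' (by rwa [edgeSeg_swap])
    obtain ⟨w, hw, hw'⟩ := mem_closure_iff.1 hz' _ isOpen_interior hzi
    obtain ⟨q₂, hq₂, hwq₂⟩ := mem_gridUnion.1 (interior_subset hw)
    exact hq' (eq_of_mem_gridSqInt hh hw' hwq₂ ▸ hq₂)

/-- Inner edges cancel, so the total winding number is the sum of those of the squares: 1 in each
open square of S and 0 off the closed union. -/
lemma exists_positiveBoundary_gridUnion {h : ℝ} (hh : 0 < h) (S : Finset (ℤ × ℤ)) :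
    ∃ (m : ℕ) (γ : Fin m → ℝ → ℂ), IsPositiveBoundary (interior (gridUnion h S)) γ := by
  obtain ⟨m, L, c, hc, hcE, hEc, hsum⟩ := (balanced_bdEdges S).exists_cycles
    fun e he => swap_notMem_bdEdges he
  have hL : ∀ k, 0 < L k := fun k => by have := (hc k).three_le; omega
  set γ : Fin m → ℝ → ℂ := fun k => polygon (L k) fun j => gridPt h (c k j) with hγ
  have hJ : ∀ k, IsRectifiableJordan (γ k) := fun k => by
    refine ⟨?_, ?_, injOn_polygon_gridPt hh.ne' (hc k) (hcE k)⟩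
    · obtain ⟨K, hK⟩ := exists_lipschitz_polygon (L k) fun j => gridPt h (c k j)
      exact ⟨K, hK.lipschitzOnWith⟩
    · rw [hγ]
      simp only
      rw [polygon_zero, polygon_one, (hc k).closed]
  have hF : frontier (interior (gridUnion h S)) = ⋃ k, γ k '' Icc 0 1 := by
    rw [frontier_interior_gridUnion hh]
    ext z
    simp only [hγ, image_polygon (hL _), mem_iUnion, exists_prop, Finset.mem_range]
    constructor
    · rintro ⟨e, he, hz⟩
      obtain ⟨k, j, hj, rfl⟩ := hEc e he
      exact ⟨k, j, hj, hz⟩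
    · rintro ⟨k, j, hj, hz⟩
      exact ⟨_, hcE k j, hz⟩
  have hW : ∀ z ∉ frontier (interior (gridUnion h S)), ∑ k, winding (γ k) z
      = (2 * Real.pi * Complex.I)⁻¹ * ∑ q ∈ S, ∑ e ∈ sqEdges q, edgeInt h z e := by
    intro z hz
    rw [← sum_bdEdges S fun e => segmentIntegral_swap _ _ _, hsum, Finset.mul_sum]
    refine Finset.sum_congr rfl fun k _ => ?_
    rw [winding, integral_polygon (hL k) (f := fun w => (w - z)⁻¹)]
    · rfl
    · refine ContinuousOn.inv₀ (by fun_prop) fun w hw h0 => hz ?_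
      rw [hF, mem_iUnion]
      exact ⟨k, by rwa [← sub_eq_zero.1 h0]⟩
  have h2pi : (2 * Real.pi * Complex.I : ℂ) ≠ 0 := Complex.two_pi_I_ne_zero
  refine ⟨m, γ, hJ, hF, fun z hz => ?_, fun z hz => ?_⟩
  -- Interior points on the grid lines are not covered by the open squares. The total winding number
  -- is continuous off the frontier, so the value 1 extends to them.
  · have hzf : ∀ z ∈ interior (gridUnion h S), z ∉ frontier (interior (gridUnion h S)) := by
      intro z hz h'
      rw [isOpen_interior.frontier_eq] at h'
      exact h'.2 hz
    have hcont : ContinuousAt (fun w => ∑ k, winding (γ k) w) z := by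
      refine tendsto_finsetSum _ fun k _ => ?_
      obtain ⟨K, hK⟩ := (hJ k).1
      refine continuousAt_winding hK fun h' => hzf z hz ?_
      rw [hF, mem_iUnion]
      exact ⟨k, h'⟩
    obtain ⟨q, hq, hzq⟩ := mem_gridUnion.1 (interior_subset hz)
    rw [← closure_gridSqInt hh] at hzq
    have hev : ∀ w ∈ gridSqInt h q, ∑ k, winding (γ k) w = 1 := by
      intro w hw
      rw [hW w (hzf w (gridSqInt_subset hh hq hw)), Finset.sum_eq_single q, sum_edgeInt_of_mem hw,
        inv_mul_cancel₀ h2pi]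
      · exact fun q' _ hne => sum_edgeInt_of_notMem hh fun h' => hne (eq_of_mem_gridSqInt hh hw h').symm
      · exact fun h' => absurd hq h'
    have := mem_closure_iff_nhdsWithin_neBot.1 hzq
    refine tendsto_nhds_unique (hcont.mono_left nhdsWithin_le_nhds : Tendsto _ (𝓝[gridSqInt h q] z) _)
      (Tendsto.congr' ?_ tendsto_const_nhds)
    filter_upwards [self_mem_nhdsWithin] with w hw using (hev w hw).symm
  · rw [hW z fun h' => hz (frontier_subset_closure h')]
    rw [closure_interior_gridUnion hh] at hz
    rw [Finset.sum_eq_zero, mul_zero]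
    exact fun q hq => sum_edgeInt_of_notMem hh fun h' => hz (mem_gridUnion.2 ⟨q, hq, h'⟩)

/-- Every compact subset of an open set has a neighbourhood with polygonal boundary. -/
theorem exists_positiveBoundary {C N : Set ℂ} (hC : IsCompact C) (hN : IsOpen N) (hCN : C ⊆ N)
    (hs : ∀ z ∈ C, (starRingEnd ℂ) z ∈ C) : ∃ D : Set ℂ, IsOpen D ∧ C ⊆ D ∧ closure D ⊆ N ∧
      (∀ z ∈ D, (starRingEnd ℂ) z ∈ D) ∧ Bornology.IsBounded D ∧
      ∃ (m : ℕ) (γ : Fin m → ℝ → ℂ), IsPositiveBoundary D γ := by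
  classical
  obtain ⟨δ, hδ, hδN⟩ := hC.exists_cthickening_subset_open hN hCN
  -- Two points of one square differ by at most |Δ Re| + |Δ Im| ≤ 2h = δ, so every square that meets
  -- C stays within δ of C.
  set h : ℝ := δ / 2 with hh'
  have hh : 0 < h := by positivity
  obtain ⟨R, hR⟩ := hC.isBounded.exists_norm_le
  set M : ℤ := ⌈R / h⌉ + 1 with hM
  have hbd : ∀ q : ℤ × ℤ, ∀ z ∈ C, z ∈ gridSq h q → (-M ≤ q.1 ∧ q.1 ≤ M) ∧ -M ≤ q.2 ∧ q.2 ≤ M := by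
    intro q z hz hzq
    obtain ⟨⟨h1, h2⟩, h3, h4⟩ := mem_gridSq.1 hzq
    have hr := abs_le.1 ((Complex.abs_re_le_norm z).trans (hR z hz))
    have hi := abs_le.1 ((Complex.abs_im_le_norm z).trans (hR z hz))
    have hc : R ≤ h * ⌈R / h⌉ := by
      have := Int.le_ceil (R / h)
      rw [div_le_iff₀ hh] at this
      linarith
    have a1 := le_of_mul_le_mul_left (h1.trans (hr.2.trans hc)) hh
    have a2 := le_of_mul_le_mul_left (h3.trans (hi.2.trans hc)) hh
    have a3 : -(⌈R / h⌉ : ℝ) ≤ q.1 + 1 := le_of_mul_le_mul_left (by linarith [hr.1]) hh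
    have a4 : -(⌈R / h⌉ : ℝ) ≤ q.2 + 1 := le_of_mul_le_mul_left (by linarith [hi.1]) hh
    norm_cast at a1 a2 a3 a4
    omega
  set S : Finset (ℤ × ℤ) := (Finset.Icc (-M) M ×ˢ Finset.Icc (-M) M).filter
    fun q => (gridSq h q ∩ C).Nonempty with hS
  have hmem : ∀ q, q ∈ S ↔ (gridSq h q ∩ C).Nonempty := by
    intro q
    rw [hS, Finset.mem_filter, Finset.mem_product, Finset.mem_Icc, Finset.mem_Icc]
    exact and_iff_right_of_imp fun ⟨z, hz, hzC⟩ => hbd q z hzC hz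
  have hsub : gridUnion h S ⊆ Metric.cthickening δ C := by
    intro z hz
    obtain ⟨q, hq, hzq⟩ := mem_gridUnion.1 hz
    obtain ⟨c, hcq, hcC⟩ := (hmem q).1 hq
    refine Metric.mem_cthickening_of_dist_le z c δ C hcC ?_
    obtain ⟨⟨h1, h2⟩, h3, h4⟩ := mem_gridSq.1 hzq
    obtain ⟨⟨h1', h2'⟩, h3', h4'⟩ := mem_gridSq.1 hcq
    rw [dist_eq_norm]
    refine (Complex.norm_le_abs_re_add_abs_im _).trans ?_
    rw [Complex.sub_re, Complex.sub_im]
    have b1 : |z.re - c.re| ≤ h := abs_le.2 ⟨by linarith, by linarith⟩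
    have b2 : |z.im - c.im| ≤ h := abs_le.2 ⟨by linarith, by linarith⟩
    linarith
  -- Conjugation exchanges the rows b and -b - 1 of the grid and preserves C, so the chosen family
  -- of squares is symmetric.
  have hconj : ∀ z ∈ gridUnion h S, (starRingEnd ℂ) z ∈ gridUnion h S := by
    have hsq : ∀ (q : ℤ × ℤ) (z : ℂ), z ∈ gridSq h q →
        (starRingEnd ℂ) z ∈ gridSq h (q.1, -q.2 - 1) := by
      intro q z hz
      obtain ⟨⟨h1, h2⟩, h3, h4⟩ := mem_gridSq.1 hz
      rw [mem_gridSq, Complex.conj_re, Complex.conj_im]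
      push_cast
      exact ⟨⟨h1, h2⟩, by linarith, by linarith⟩
    intro z hz
    obtain ⟨q, hq, hzq⟩ := mem_gridUnion.1 hz
    obtain ⟨c, hcq, hcC⟩ := (hmem q).1 hq
    exact mem_gridUnion.2 ⟨(q.1, -q.2 - 1), (hmem _).2 ⟨_, hsq q c hcq, hs c hcC⟩, hsq q z hzq⟩
  refine ⟨interior (gridUnion h S), isOpen_interior, fun z hz => mem_interior_gridUnion hh
    fun q hq => (hmem q).2 ⟨z, hq, hz⟩, ?_, ?_, ?_, exists_positiveBoundary_gridUnion hh S⟩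
  · rw [closure_interior_gridUnion hh]
    exact hsub.trans hδN
  · intro z hz
    have hpre : interior (gridUnion h S) ⊆ (starRingEnd ℂ) ⁻¹' interior (gridUnion h S) :=  by
      have : (starRingEnd ℂ) ⁻¹' interior (gridUnion h S)
          = interior ((starRingEnd ℂ) ⁻¹' gridUnion h S) :=
        Complex.conjLIE.toHomeomorph.preimage_interior _
      rw [this]
      exact interior_mono fun z hz => hconj z hz
    exact hpre hz
  · exact (hC.isBounded.cthickening.subset hsub).subset interior_subset

/-! ### Independence of the plane -/

section Independence

variable {E : Type*} [NormedRing E] [NormedAlgebra ℝ E]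

lemma IsCutoff.mono {T : E} {D D' : Set ℂ} {χ : ℂ → ℝ} (hχ : IsCutoff T D χ) (h : D ⊆ D') :
    IsCutoff T D' χ :=
  ⟨hχ.contDiff, hχ.compact, hχ.subset.trans h, hχ.eventually⟩

lemma LeftHolAt.continuousOn {i : E} {h : ℂ → E} {D : Set ℂ} (hh : ∀ z ∈ D, LeftHolAt i h z) :
    ContinuousOn h D := fun z hz => (hh z hz).1.continuousAt.continuousWithinAt

lemma isPreconnected_thickening {F : Type*} [SeminormedAddCommGroup F] [NormedSpace ℝ F] {s : Set F}
    (hs : IsPreconnected s) (ε : ℝ) : IsPreconnected (Metric.thickening ε s) := by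
  rw [← add_ball_zero, ← Set.add_image_prod]
  exact (hs.prod (convex_ball (0 : F) ε).isPreconnected).image _ continuous_add.continuousOn

lemma conj_mem_thickening {s : Set ℂ} (hs : ∀ z ∈ s, (starRingEnd ℂ) z ∈ s) (ε : ℝ) :
    ∀ z ∈ Metric.thickening ε s, (starRingEnd ℂ) z ∈ Metric.thickening ε s := by
  intro z hz
  obtain ⟨w, hw, hd⟩ := Metric.mem_thickening_iff.1 hz
  refine Metric.mem_thickening_iff.2 ⟨_, hs w hw, ?_⟩
  rwa [Complex.dist_conj_conj]

/-- The area integrals of slice functions with the same values on the real axis agree. -/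
theorem areaCalc_eq_of_eqOn_real [CompleteSpace E] {T i j : E} (hi : i * i = -1) (hj : j * j = -1)
    {D D' : Set ℂ} (hD : IsOpen D) (hD' : IsOpen D') (hCD : circleSet T ⊆ D) (hCD' : circleSet T ⊆ D')
    {f g : ℂ → E} (hf : ∀ z ∈ D, LeftHolAt i f z) (hg : ∀ z ∈ D', LeftHolAt j g z)
    (h0 : ∀ x : ℝ, f x = g x) {χ χ' : ℂ → ℝ} (hχ : IsCutoff T D χ) (hχ' : IsCutoff T D' χ') :
    areaCalc T i χ f = areaCalc T j χ' g := by
  have hC := isCompact_circleSet T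
  obtain ⟨ε, hε, hεD⟩ := hC.exists_thickening_subset_open (hD.inter hD')
    (subset_inter hCD hCD')
  set N := Metric.thickening ε (circleSet T) with hN
  have hNo : IsOpen N := Metric.isOpen_thickening
  obtain ⟨ρ, h1, hc, hsub, hev, hsym⟩ := exists_symmetric_cutoff hC hNo
    (Metric.self_subset_thickening hε _) fun z hz => conj_mem_circleSet hz
  have hρ : IsCutoff T N ρ := ⟨h1, hc, hsub, fun z hz =>
    eventually_nhdsSet_iff_forall.1 hev z (planarSpectrum_subset_circleSet T hz)⟩
  -- A point of N is close to one circle of `circleSet T`. The thickening of that circle is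
  -- connected, symmetric and contains the real point Re w + |Im w|, so the representation formula
  -- holds on it, although N itself may be disconnected.
  have hrep : ∀ z ∈ N, (2 : ℝ) • g z = (1 - j * i) * f z + (1 + j * i) * f ((starRingEnd ℂ) z) := by
    intro z hz
    obtain ⟨c, ⟨w, hw, hcw⟩, hd⟩ := Metric.mem_thickening_iff.1 hz
    have hs : Metric.sphere (w.re : ℂ) |w.im| ⊆ circleSet T := sphere_subset_circleSet hw
    have hsN : Metric.thickening ε (Metric.sphere (w.re : ℂ) |w.im|) ⊆ N :=
      Metric.thickening_subset_of_subset ε hs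
    have hrank : 1 < Module.rank ℝ ℂ := by rw [Complex.rank_real_complex]; norm_num
    refine representation hi hj Metric.isOpen_thickening
      (isPreconnected_thickening (isPreconnected_sphere hrank (w.re : ℂ) |w.im|) ε)
      (conj_mem_thickening ?_ ε) (fun z hz => hf z (hεD (hsN hz)).1)
      (fun z hz => hg z (hεD (hsN hz)).2) (x₀ := w.re + |w.im|)
      (Metric.self_subset_thickening hε _ ?_) (fun x _ => h0 x) z
      (Metric.mem_thickening_iff.2 ⟨c, ?_, hd⟩)
    · intro z hz
      rw [mem_sphere_iff_norm] at hz ⊢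
      rw [← Complex.conj_ofReal, ← map_sub, Complex.norm_conj, hz]
    · rw [mem_sphere_iff_norm]; push_cast; simp
    · rwa [mem_sphere_iff_norm]
  have hfN : ∀ z ∈ N, LeftHolAt i f z := fun z hz => hf z (hεD hz).1
  have hgN : ∀ z ∈ N, LeftHolAt j g z := fun z hz => hg z (hεD hz).2
  rw [areaCalc, areaCalc,
    integral_areaIntegrand_eq_of_cutoff hi hD hχ (hρ.mono fun z hz => (hεD hz).1) hf,
    integral_areaIntegrand_eq hi hj hρ hsym (LeftHolAt.continuousOn hfN) (LeftHolAt.continuousOn hgN)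
      hrep,
    integral_areaIntegrand_eq_of_cutoff hj hD' hχ' (hρ.mono fun z hz => (hεD hz).2) hg]

lemma commute_cplx {R i : E} (h : Commute R i) (z : ℂ) : Commute R (cplx i z) :=
  ((Commute.one_right R).smul_right _).add_right (h.smul_right _)

lemma commute_planarResolvent {R T i : E} (hT : Commute R T) (hi : Commute R i) (z : ℂ) :
    Commute R (planarResolvent T i z) := by
  refine (commute_ringInverse ?_).mul_right ((commute_cplx hi _).sub_right hT)
  rw [planarPencil]
  exact ((hT.pow_right 2).sub_right (hT.smul_right _)).add_right ((Commute.one_right R).smul_right _)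

variable [CompleteSpace E]

/-- Used with R a right multiplication by a basis element, to see that f(T) belongs to `Bn`. -/
lemma commute_areaCalc {R T i : E} (hT : Commute R T) (hi : Commute R i) {D : Set ℂ} {χ : ℂ → ℝ}
    (hχ : IsCutoff T D χ) {f : ℂ → E} (hf : ContinuousOn f D) (hR : ∀ z, Commute R (f z)) :
    Commute R (areaCalc T i χ f) := by
  refine ((show Commute R (∫ z, areaIntegrand T i χ f z) from ?_).smul_right _).neg_right
  have hint := hχ.integrable i hf
  rw [Commute, SemiconjBy, ← integral_const_mul_of_integrable hint,
    ← integral_mul_const_of_integrable hint]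
  refine integral_congr_ae (Eventually.of_forall fun z => ?_)
  exact ((commute_planarResolvent hT hi z).mul_right (commute_cplx hi _)).mul_right (hR z)

lemma areaCalc_add_mul {T i : E} {D : Set ℂ} {χ : ℂ → ℝ} (hχ : IsCutoff T D χ) {f g : ℂ → E}
    (hf : ContinuousOn f D) (hg : ContinuousOn g D) (a b : E) :
    areaCalc T i χ (fun z => f z * a + g z * b) = areaCalc T i χ f * a + areaCalc T i χ g * b := by
  have hfi := hχ.integrable i hf
  have hgi := hχ.integrable i hg
  have h : ∫ z, areaIntegrand T i χ (fun z => f z * a + g z * b) z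
      = (∫ z, areaIntegrand T i χ f z) * a + (∫ z, areaIntegrand T i χ g z) * b := by
    rw [← integral_mul_const_of_integrable hfi, ← integral_mul_const_of_integrable hgi,
      ← integral_add (hfi.mul_const a) (hgi.mul_const b)]
    refine integral_congr_ae (Eventually.of_forall fun z => ?_)
    simp only [areaIntegrand, mul_add, mul_assoc]
  rw [areaCalc, h, areaCalc, areaCalc, smul_add, neg_add, neg_mul, neg_mul, smul_mul_assoc,
    smul_mul_assoc]

end Independence

/-! ### The algebra of operators `∑_A T_A e_A` -/

section Operators

/-- The element `v e_∅`. -/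
def scalarIncl {V : Type*} [NormedAddCommGroup V] (n : ℕ) (v : V) : Vn n V := WithLp.toLp 2 (Pi.single ∅ v)

lemma scalarIncl_apply {V : Type*} [NormedAddCommGroup V] {n : ℕ} (v : V) (A : Finset (Fin n)) :
    scalarIncl n v A = if A = ∅ then v else 0 := by
  simp [scalarIncl]

variable {V : Type*} [NormedAddCommGroup V] [NormedSpace ℝ V] {n : ℕ}

lemma component_apply (A : Finset (Fin n)) (T : Vn n V →L[ℝ] Vn n V) (v : V) :
    component A T v = T (scalarIncl n v) A := rfl

/-- The multiplication `v ↦ v e_B` from the right. -/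
def rightMul (B : Finset (Fin n)) : Vn n V →L[ℝ] Vn n V :=
  (PiLp.continuousLinearEquiv 2 ℝ fun _ : Finset (Fin n) => V).symm.toContinuousLinearMap ∘L
    ContinuousLinearMap.pi fun C =>
      sgn (symmDiff C B) B • PiLp.proj 2 (fun _ : Finset (Fin n) => V) (symmDiff C B)

lemma rightMul_apply (B : Finset (Fin n)) (v : Vn n V) (C : Finset (Fin n)) :
    rightMul B v C = sgn (symmDiff C B) B • v (symmDiff C B) := by
  simp [rightMul]

lemma opOf_mul_rightMul (T : Finset (Fin n) → V →L[ℝ] V) (B : Finset (Fin n)) :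
    Commute (rightMul B) (opOf T) := by
  refine ContinuousLinearMap.ext fun v => PiLp.ext fun C => ?_
  rw [mul_apply_eq_comp, mul_apply_eq_comp, rightMul_apply, opOf_apply,
    opOf_apply, Finset.smul_sum]
  refine Finset.sum_congr rfl fun A _ => ?_
  rw [rightMul_apply, map_smul, smul_smul, smul_smul, ← symmDiff_assoc]
  congr 1
  simp only [Cl.sgn_symmDiff_left, Cl.sgn_symmDiff_right]
  ring

lemma sum_rightMul_scalarIncl (v : Vn n V) : v = ∑ B, rightMul B (scalarIncl n (v B)) := by
  refine PiLp.ext fun C => ?_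
  rw [WithLp.ofLp_sum, Finset.sum_apply, Finset.sum_eq_single C]
  · rw [rightMul_apply, symmDiff_self, scalarIncl_apply]; simp
  · intro B _ hB
    rw [rightMul_apply, scalarIncl_apply, if_neg, smul_zero]
    rw [← Finset.bot_eq_empty, symmDiff_eq_bot]
    exact hB.symm
  · simp

/-- Since v is the sum of the elements (v_B e_∅) e_B, an operator commuting with the right
multiplications is determined by its values on V e_∅, that is, by its components. A commutant is
stable under sums, products and integrals. -/
lemma mem_Bn_iff {T : Vn n V →L[ℝ] Vn n V} : T ∈ Bn n V ↔ ∀ B, Commute (rightMul B) T := by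
  constructor
  · rintro ⟨S, rfl⟩ B
    exact opOf_mul_rightMul S B
  · intro h
    refine ⟨fun A => component A T, ContinuousLinearMap.ext fun v => ?_⟩
    have h2 : T v = ∑ B, rightMul B (T (scalarIncl n (v B))) := by
      nth_rewrite 1 [sum_rightMul_scalarIncl v]
      rw [map_sum]
      exact Finset.sum_congr rfl fun B _ => (DFunLike.congr_fun (h B) (scalarIncl n (v B))).symm
    rw [h2]
    refine PiLp.ext fun C => ?_
    rw [opOf_apply, WithLp.ofLp_sum, Finset.sum_apply]
    refine Fintype.sum_equiv ⟨fun A => symmDiff A C, fun A => symmDiff A C,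
      fun A => symmDiff_symmDiff_cancel_right C A, fun A => symmDiff_symmDiff_cancel_right C A⟩ _ _
      fun A => ?_
    change _ = rightMul (symmDiff A C) (T (scalarIncl n (v (symmDiff A C)))) C
    rw [rightMul_apply, component_apply, symmDiff_comm A C, symmDiff_symmDiff_cancel_left]

lemma ext_of_mem_Bn {S T : Vn n V →L[ℝ] Vn n V} (hS : S ∈ Bn n V) (hT : T ∈ Bn n V)
    (h : ∀ v, S (scalarIncl n v) = T (scalarIncl n v)) : S = T := by
  obtain ⟨S, rfl⟩ := hS
  obtain ⟨T, rfl⟩ := hT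
  congr 1
  funext A
  ext v
  rw [← component_opOf S, ← component_opOf T, component_apply, component_apply, h]

lemma mul_mem_Bn {S T : Vn n V →L[ℝ] Vn n V} (hS : S ∈ Bn n V) (hT : T ∈ Bn n V) :
    S * T ∈ Bn n V :=
  mem_Bn_iff.2 fun B => (mem_Bn_iff.1 hS B).mul_right (mem_Bn_iff.1 hT B)

lemma sub_mem_Bn {S T : Vn n V →L[ℝ] Vn n V} (hS : S ∈ Bn n V) (hT : T ∈ Bn n V) :
    S - T ∈ Bn n V :=
  mem_Bn_iff.2 fun B => (mem_Bn_iff.1 hS B).sub_right (mem_Bn_iff.1 hT B)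

lemma leftMul_mem_Bn (a : Cl n) : leftMul a ∈ Bn n V := ⟨_, rfl⟩

lemma leftMul_apply (a : Cl n) (v : Vn n V) (C : Finset (Fin n)) : leftMul a v C
    = ∑ A, (sgn A (symmDiff A C) * a.coeff A) • v (symmDiff A C) := by
  rw [leftMul, opOf_apply]
  simp [mul_smul]

lemma leftMul_scalarIncl (a : Cl n) (v : V) (C : Finset (Fin n)) :
    leftMul a (scalarIncl n v) C = a.coeff C • v := by
  rw [← component_apply, leftMul, component_opOf]; rfl

lemma leftMul_mul (a b : Cl n) :
    (leftMul (a * b) : Vn n V →L[ℝ] Vn n V) = leftMul a * leftMul b := by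
  refine ext_of_mem_Bn (leftMul_mem_Bn _) (mul_mem_Bn (leftMul_mem_Bn _) (leftMul_mem_Bn _))
    fun v => PiLp.ext fun C => ?_
  rw [leftMul_scalarIncl, mul_apply_eq_comp, leftMul_apply, Cl.coeff_mul, Finset.sum_smul]
  refine Finset.sum_congr rfl fun A _ => ?_
  rw [leftMul_scalarIncl, smul_smul, mul_assoc]

lemma leftMul_one : (leftMul 1 : Vn n V →L[ℝ] Vn n V) = 1 := by
  refine ext_of_mem_Bn (leftMul_mem_Bn _) (mem_Bn_iff.2 fun B => Commute.one_right _)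
    fun v => PiLp.ext fun C => ?_
  rw [leftMul_scalarIncl, Cl.coeff_one, one_apply_eq_self, scalarIncl_apply, ite_smul,
    one_smul, zero_smul]

variable (V n) in
/-- The map `a ↦ leftMul a`. -/
def leftMulCLM : Cl n →L[ℝ] (Vn n V →L[ℝ] Vn n V) :=
  LinearMap.toContinuousLinearMap
    { toFun := leftMul
      map_add' := fun a b => ContinuousLinearMap.ext fun v => PiLp.ext fun C => by
        rw [_root_.add_apply, PiLp.add_apply, leftMul_apply, leftMul_apply,
          leftMul_apply, ← Finset.sum_add_distrib]
        simp only [Cl.coeff_add, mul_add, add_smul]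
      map_smul' := fun r a => ContinuousLinearMap.ext fun v => PiLp.ext fun C => by
        rw [RingHom.id_apply, _root_.smul_apply, PiLp.smul_apply, leftMul_apply,
          leftMul_apply, Finset.smul_sum]
        simp only [Cl.coeff_smul, smul_smul, mul_left_comm] }

lemma leftMulCLM_apply (a : Cl n) : leftMulCLM V n a = leftMul a := rfl

lemma leftMul_add (a b : Cl n) : (leftMul (a + b) : Vn n V →L[ℝ] Vn n V) = leftMul a + leftMul b :=
  map_add (leftMulCLM V n) a b

lemma leftMul_sub (a b : Cl n) : (leftMul (a - b) : Vn n V →L[ℝ] Vn n V) = leftMul a - leftMul b :=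
  map_sub (leftMulCLM V n) a b

lemma leftMul_neg (a : Cl n) : (leftMul (-a) : Vn n V →L[ℝ] Vn n V) = -leftMul a :=
  map_neg (leftMulCLM V n) a

lemma leftMul_smul (r : ℝ) (a : Cl n) : (leftMul (r • a) : Vn n V →L[ℝ] Vn n V) = r • leftMul a :=
  map_smul (leftMulCLM V n) r a

lemma leftMul_algebraMap (r : ℝ) :
    (leftMul (algebraMap ℝ (Cl n) r) : Vn n V →L[ℝ] Vn n V) = r • 1 := by
  rw [Algebra.algebraMap_eq_smul_one, leftMul_smul, leftMul_one]

lemma abs_sgn (A B : Finset (Fin n)) : |sgn A B| = 1 := by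
  rw [sgn, Finset.abs_prod]
  refine Finset.prod_eq_one fun a _ => ?_
  rw [Finset.abs_prod]
  exact Finset.prod_eq_one fun b _ => by split_ifs <;> simp

lemma sqrt_sum_sq_le {ι : Type*} (s : Finset ι) {a : ι → ℝ} (ha : ∀ i, 0 ≤ a i) :
    Real.sqrt (∑ i ∈ s, a i ^ 2) ≤ ∑ i ∈ s, a i :=
  Real.sqrt_le_iff.2 ⟨Finset.sum_nonneg fun i _ => ha i, Finset.sum_sq_le_sq_sum_of_nonneg fun i _ => ha i⟩

lemma norm_component_le_bnNorm (A : Finset (Fin n)) (T : Vn n V →L[ℝ] Vn n V) :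
    ‖component A T‖ ≤ bnNorm T := by
  rw [bnNorm]
  exact Real.le_sqrt_of_sq_le (Finset.single_le_sum (f := fun A => ‖component A T‖ ^ 2)
    (fun _ _ => by positivity) (Finset.mem_univ A))

/-- Together with `bnNorm_le_norm` this makes the two norms equivalent on `Bn`, so continuity can be
proved in the operator norm. -/
lemma norm_le_bnNorm : ∃ c : ℝ, 0 < c ∧ ∀ T ∈ Bn n V, ‖T‖ ≤ c * bnNorm T := by
  refine ⟨(Fintype.card (Finset (Fin n)) : ℝ) * Fintype.card (Finset (Fin n)), by positivity, ?_⟩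
  rintro _ ⟨T, rfl⟩
  have hb : 0 ≤ bnNorm (opOf T) := Real.sqrt_nonneg _
  refine ContinuousLinearMap.opNorm_le_bound _ (by positivity) fun v => ?_
  rw [PiLp.norm_eq_of_L2]
  refine (sqrt_sum_sq_le _ fun C => norm_nonneg _).trans ?_
  have h : ∀ C, ‖opOf T v C‖ ≤ Fintype.card (Finset (Fin n)) * (bnNorm (opOf T) * ‖v‖) := by
    intro C
    rw [opOf_apply]
    refine (norm_sum_le _ _).trans ?_
    refine (Finset.sum_le_card_nsmul _ _ (bnNorm (opOf T) * ‖v‖) fun A _ => ?_).trans_eq ?_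
    · rw [norm_smul, Real.norm_eq_abs, abs_sgn, one_mul]
      refine ((T A).le_opNorm _).trans ?_
      gcongr
      · rw [← component_opOf T A]; exact norm_component_le_bnNorm A _
      · exact PiLp.norm_apply_le v _
    · rw [Finset.card_univ, nsmul_eq_mul]
  refine (Finset.sum_le_card_nsmul _ _ _ fun C _ => h C).trans_eq ?_
  rw [Finset.card_univ, nsmul_eq_mul]
  ring

lemma bnNorm_le_norm : ∃ c : ℝ, 0 < c ∧ ∀ T : Vn n V →L[ℝ] Vn n V, bnNorm T ≤ c * ‖T‖ := by
  refine ⟨(Fintype.card (Finset (Fin n)) : ℝ), by positivity, fun T => ?_⟩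
  refine (sqrt_sum_sq_le _ fun C => norm_nonneg _).trans ?_
  refine (Finset.sum_le_card_nsmul _ _ ‖T‖ fun A _ => ?_).trans_eq ?_
  · refine ContinuousLinearMap.opNorm_le_bound _ (norm_nonneg _) fun v => ?_
    rw [component_apply]
    refine (PiLp.norm_apply_le _ _).trans ((T.le_opNorm _).trans_eq ?_)
    congr 1
    exact PiLp.norm_single 2 (fun _ : Finset (Fin n) => V) ∅ v
  · rw [Finset.card_univ, nsmul_eq_mul]

end Operators

/-! ### Slices -/

section Slices

variable {n : ℕ}

lemma vec_mul_vec {I : EuclideanSpace ℝ (Fin n)} (hI : I ∈ unitSphere n) :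
    Cl.vec I * Cl.vec I = -1 := by
  have h : Cl.negForm n I = -1 := by
    have h1 : ∑ j, I j ^ 2 = 1 := by
      have h2 : ‖I‖ = 1 := hI
      rw [EuclideanSpace.norm_eq, Real.sqrt_eq_one] at h2
      simpa using h2
    have h2 : Cl.negForm n I = -∑ j, I j ^ 2 := by
      rw [Cl.negForm, QuadraticMap.weightedSumSquares_apply, ← Finset.sum_neg_distrib]
      exact Finset.sum_congr rfl fun j _ => by simp [sq]
    rw [h2, h1]
  rw [Cl.vec_mul_self, h, map_neg, map_one]

lemma slicePt_zero (I : EuclideanSpace ℝ (Fin n)) (z : ℂ) : slicePt I z 0 = z.re := rfl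

lemma slicePt_succ (I : EuclideanSpace ℝ (Fin n)) (z : ℂ) (j : Fin n) :
    slicePt I z j.succ = z.im * I j := rfl

lemma slicePt_eq (I : EuclideanSpace ℝ (Fin n)) (z : ℂ) :
    slicePt I z = z.re • slicePt I 1 + z.im • slicePt I Complex.I := by
  refine PiLp.ext fun k => ?_
  refine Fin.cases ?_ (fun j => ?_) k
  · simp [slicePt_zero]
  · simp [slicePt_succ]

/-- The map `slicePt I` as a linear map. -/
def slicePtCLM (I : EuclideanSpace ℝ (Fin n)) : ℂ →L[ℝ] Para n :=
  Complex.reCLM.smulRight (slicePt I 1) + Complex.imCLM.smulRight (slicePt I Complex.I)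

lemma slicePtCLM_apply (I : EuclideanSpace ℝ (Fin n)) (z : ℂ) : slicePtCLM I z = slicePt I z := by
  rw [slicePt_eq I z]; rfl

lemma coe_slicePtCLM (I : EuclideanSpace ℝ (Fin n)) : ⇑(slicePtCLM I) = slicePt I :=
  funext (slicePtCLM_apply I)

lemma continuous_slicePt (I : EuclideanSpace ℝ (Fin n)) : Continuous (slicePt I) := by
  rw [← coe_slicePtCLM]; exact (slicePtCLM I).continuous

lemma continuous_slicePt_prod :
    Continuous fun p : EuclideanSpace ℝ (Fin n) × ℂ => slicePt p.1 p.2 := by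
  refine (PiLp.continuous_toLp 2 _).comp (continuous_pi fun k => ?_)
  refine Fin.cases ?_ (fun j => ?_) k
  · simp only [Fin.cons_zero]; fun_prop
  · simp only [Fin.cons_succ]; fun_prop

lemma norm_slicePt {I : EuclideanSpace ℝ (Fin n)} (hI : I ∈ unitSphere n) (z : ℂ) :
    ‖slicePt I z‖ = ‖z‖ := by
  have h1 : ∑ j, I j ^ 2 = 1 := by
    have h2 : ‖I‖ = 1 := hI
    rw [EuclideanSpace.norm_eq, Real.sqrt_eq_one] at h2
    simpa using h2
  rw [← sq_eq_sq₀ (norm_nonneg _) (norm_nonneg _), EuclideanSpace.real_norm_sq_eq, Fin.sum_univ_succ,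
    Complex.sq_norm, Complex.normSq_apply]
  simp only [slicePt_zero, slicePt_succ, mul_pow, ← Finset.mul_sum, h1]
  ring

lemma slicePt_ofReal (I J : EuclideanSpace ℝ (Fin n)) (x : ℝ) : slicePt I x = slicePt J x := by
  simp [slicePt]

lemma toCl_slicePt (I : EuclideanSpace ℝ (Fin n)) (z : ℂ) :
    (slicePt I z).toCl = algebraMap ℝ (Cl n) z.re + z.im • Cl.vec I := by
  simp only [Para.toCl, slicePt_zero, slicePt_succ, Cl.vec, Finset.smul_sum, smul_smul]

lemma conj_slicePt (I : EuclideanSpace ℝ (Fin n)) (z : ℂ) :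
    (slicePt I z).conj = slicePt I ((starRingEnd ℂ) z) := by
  simp only [Para.conj, slicePt_zero, slicePt_succ]
  simp [slicePt]

lemma exists_slicePt_eq [NeZero n] (x : Para n) : ∃ I ∈ unitSphere n,
    x = slicePt I ⟨x 0, ‖(WithLp.toLp 2 fun j => x j.succ : EuclideanSpace ℝ (Fin n))‖⟩ := by
  set y : EuclideanSpace ℝ (Fin n) := WithLp.toLp 2 fun j => x j.succ with hy
  by_cases h : y = 0
  · refine ⟨EuclideanSpace.single 0 1, by simp [unitSphere], ?_⟩
    refine PiLp.ext fun k => Fin.cases rfl (fun j => ?_) k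
    have : y j = 0 := by rw [h]; rfl
    rw [slicePt_succ, h, norm_zero, zero_mul]
    exact this
  · refine ⟨‖y‖⁻¹ • y, by simp [unitSphere, norm_smul, h], ?_⟩
    refine PiLp.ext fun k => Fin.cases rfl (fun j => ?_) k
    rw [slicePt_succ, PiLp.smul_apply, smul_eq_mul, mul_inv_cancel_left₀ (norm_ne_zero_iff.2 h)]

lemma isCompact_unitSphere : IsCompact (unitSphere n) := by
  have : unitSphere n = Metric.sphere 0 1 := by ext; simp [unitSphere]
  rw [this]; exact isCompact_sphere 0 1

lemma exists_mem_unitSphere [NeZero n] : ∃ I, I ∈ unitSphere n :=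
  ⟨EuclideanSpace.single 0 1, by simp [unitSphere]⟩

lemma isOpen_slice {U : Set (Para n)} (hU : IsOpen U) (I : EuclideanSpace ℝ (Fin n)) :
    IsOpen (slice I U) := hU.preimage (continuous_slicePt I)

lemma closure_slice_subset {U W : Set (Para n)} (h : closure U ⊆ W) (I : EuclideanSpace ℝ (Fin n)) :
    closure (slice I U) ⊆ slice I W :=
  ((continuous_slicePt I).closure_preimage_subset U).trans (preimage_mono h)

/-- The set of the `z` such that `slicePt J z` lies in `W` for all `J`. -/
def slicesIn (W : Set (Para n)) : Set ℂ := {z | ∀ J ∈ unitSphere n, slicePt J z ∈ W}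

/-- Compactness of the sphere of units: a condition open in (z, J) and true for all J at z persists
for all J near z. -/
lemma isOpen_slicesIn {W : Set (Para n)} (hW : IsOpen W) : IsOpen (slicesIn W) := by
  rw [isOpen_iff_mem_nhds]
  intro z hz
  refine isCompact_unitSphere.eventually_forall_of_forall_eventually fun J hJ => ?_
  have hc : Continuous fun p : ℂ × EuclideanSpace ℝ (Fin n) => slicePt p.2 p.1 :=
    continuous_slicePt_prod.comp continuous_swap
  exact hc.continuousAt.eventually (hW.mem_nhds (hz J hJ))

end Slices

/-! ### The functional calculus in terms of area integrals -/

section Calculus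

variable {V : Type*} [NormedAddCommGroup V] [NormedSpace ℝ V] {n : ℕ}

/-- Left multiplication by the imaginary unit `I`. -/
def unitOp (V : Type*) [NormedAddCommGroup V] [NormedSpace ℝ V] {n : ℕ}
    (I : EuclideanSpace ℝ (Fin n)) : Vn n V →L[ℝ] Vn n V := leftMul (Cl.vec I)

/-- The function `f` on the plane of `I`, as an operator-valued function. -/
def sliceFun (V : Type*) [NormedAddCommGroup V] [NormedSpace ℝ V] {n : ℕ}
    (I : EuclideanSpace ℝ (Fin n)) (f : Para n → Cl n) (z : ℂ) : Vn n V →L[ℝ] Vn n V :=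
  leftMul (f (slicePt I z))

lemma unitOp_mul_self {I : EuclideanSpace ℝ (Fin n)} (hI : I ∈ unitSphere n) :
    unitOp V I * unitOp V I = -1 := by
  rw [unitOp, ← leftMul_mul, vec_mul_vec hI, leftMul_neg, leftMul_one]

lemma leftMul_toCl_slicePt (I : EuclideanSpace ℝ (Fin n)) (z : ℂ) :
    leftMul (slicePt I z).toCl = cplx (unitOp V I) z := by
  rw [toCl_slicePt, leftMul_add, leftMul_smul, leftMul_algebraMap, cplx, unitOp]

lemma pencil_slicePt {I : EuclideanSpace ℝ (Fin n)} (hI : I ∈ unitSphere n)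
    (T : Vn n V →L[ℝ] Vn n V) (z : ℂ) : pencil T (slicePt I z) = planarPencil T z := by
  rw [pencil, planarPencil, norm_slicePt hI, slicePt_zero]

lemma slicePt_mem_sSpectrum {I : EuclideanSpace ℝ (Fin n)} (hI : I ∈ unitSphere n)
    {T : Vn n V →L[ℝ] Vn n V} {z : ℂ} : slicePt I z ∈ sSpectrum T ↔ z ∈ planarSpectrum T := by
  rw [sSpectrum, mem_ofPred_eq, pencil_slicePt hI]; rfl

lemma neg_mul_sub {A : Type*} [Ring A] (x y z : A) : -(x * (y - z)) = x * (z - y) := by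
  rw [← mul_neg, neg_sub]

lemma sResolvent_slicePt {I : EuclideanSpace ℝ (Fin n)} (hI : I ∈ unitSphere n)
    (T : Vn n V →L[ℝ] Vn n V) (z : ℂ) :
    sResolvent (slicePt I z) T = planarResolvent T (unitOp V I) z := by
  rw [sResolvent, pencil_slicePt hI, conj_slicePt, leftMul_toCl_slicePt, planarResolvent]
  exact neg_mul_sub _ _ _

lemma sIntegrand_eq {I : EuclideanSpace ℝ (Fin n)} (hI : I ∈ unitSphere n)
    (T : Vn n V →L[ℝ] Vn n V) (f : Para n → Cl n) (γ : ℝ → ℂ) :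
    sIntegrand T f I γ = contourIntegrand T (unitOp V I) (sliceFun V I f) γ := by
  funext t
  rw [sIntegrand, sResolvent_slicePt hI, leftMul_mul, leftMul_neg, leftMul_mul,
    leftMul_toCl_slicePt]
  rfl

lemma single_add_smul_eq_slicePt {J : EuclideanSpace ℝ (Fin n)} (u : ℝ) (c : ℂ) :
    slicePt J c - EuclideanSpace.single 0 u = slicePt J (c - u) := by
  refine PiLp.ext fun k => Fin.cases ?_ (fun j => ?_) k
  · simp [slicePt_zero]
  · simp [slicePt_succ]

/-- The plane of J meets the sphere with centre u and radius |v| in the circle with the same centre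
and radius. The condition on (u, v) is the same in every plane because the pencil involves only Re s
and |s|. -/
lemma slicePt_mem_circ [NeZero n] {J : EuclideanSpace ℝ (Fin n)} (hJ : J ∈ unitSphere n)
    {T : Vn n V →L[ℝ] Vn n V} {c : ℂ} : slicePt J c ∈ circ (sSpectrum T) ↔ c ∈ circleSet T := by
  constructor
  · rintro ⟨u, v, I, hI, hmem, w, hw, hx⟩
    refine ⟨⟨u, v⟩, (slicePt_mem_sSpectrum hI).1 hmem, ?_⟩
    rw [← norm_slicePt hJ, ← single_add_smul_eq_slicePt, hx, add_sub_cancel_left, norm_smul, hw,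
      mul_one, Real.norm_eq_abs]
  · rintro ⟨⟨u, v⟩, hz, hc⟩
    simp only at hc
    rw [← norm_slicePt hJ, ← single_add_smul_eq_slicePt] at hc
    refine ⟨u, v, J, hJ, (slicePt_mem_sSpectrum hJ).2 hz, ?_⟩
    by_cases hv : v = 0
    · rw [hv, abs_zero, norm_eq_zero, sub_eq_zero] at hc
      exact ⟨slicePt J 1, by rw [norm_slicePt hJ, norm_one], by rw [hc, hv, zero_smul, add_zero]⟩
    · refine ⟨v⁻¹ • (slicePt J c - EuclideanSpace.single 0 u), ?_, ?_⟩
      · rw [norm_smul, hc, norm_inv, Real.norm_eq_abs, inv_mul_cancel₀ (abs_ne_zero.2 hv)]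
      · rw [smul_inv_smul₀ hv, add_sub_cancel]

lemma circ_subset_iff [NeZero n] {T : Vn n V →L[ℝ] Vn n V} {W : Set (Para n)} :
    circ (sSpectrum T) ⊆ W ↔ circleSet T ⊆ slicesIn W := by
  constructor
  · exact fun h c hc J hJ => h ((slicePt_mem_circ hJ).2 hc)
  · intro h x hx
    obtain ⟨J, hJ, hxJ⟩ := exists_slicePt_eq x
    rw [hxJ] at hx ⊢
    exact h ((slicePt_mem_circ hJ).1 hx) J hJ

lemma circleSet_subset_slice [NeZero n] {T : Vn n V →L[ℝ] Vn n V} {W : Set (Para n)}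
    (h : circ (sSpectrum T) ⊆ W) {I : EuclideanSpace ℝ (Fin n)} (hI : I ∈ unitSphere n) :
    circleSet T ⊆ slice I W := fun _ hz => circ_subset_iff.1 h hz I hI

lemma planarSpectrum_subset_slice [NeZero n] {T : Vn n V →L[ℝ] Vn n V} {W : Set (Para n)}
    (h : circ (sSpectrum T) ⊆ W) {I : EuclideanSpace ℝ (Fin n)} (hI : I ∈ unitSphere n) :
    planarSpectrum T ⊆ slice I W :=
  (planarSpectrum_subset_circleSet T).trans (circleSet_subset_slice h hI)

lemma IsSMonogenicOn.mono {f : Para n → Cl n} {U W : Set (Para n)} (h : IsSMonogenicOn f W)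
    (hU : IsOpen U) (hUW : U ⊆ W) : IsSMonogenicOn f U :=
  ⟨hU, h.2.1.mono hUW, fun I hI z hz => h.2.2 I hI z (hUW hz)⟩

lemma IsSMonogenicOn.differentiableAt_slice {f : Para n → Cl n} {W : Set (Para n)}
    (h : IsSMonogenicOn f W) {I : EuclideanSpace ℝ (Fin n)} {z : ℂ} (hz : z ∈ slice I W) :
    DifferentiableAt ℝ (fun w : ℂ => f (slicePt I w)) z := by
  have h1 : DifferentiableAt ℝ f (slicePt I z) := (h.2.1 _ hz).differentiableAt (h.1.mem_nhds hz)
  have h2 : DifferentiableAt ℝ (slicePt I) z := by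
    rw [← coe_slicePtCLM]; exact (slicePtCLM I).differentiableAt
  exact h1.comp z h2

/-- Multiplication from the right in the Clifford algebra. -/
def clMulRight (a : Cl n) : Cl n →L[ℝ] Cl n :=
  LinearMap.toContinuousLinearMap (LinearMap.mulRight ℝ a)

lemma smul_combination_eq_zero {A : Type*} [Ring A] [Algebra ℝ A] {v p q r s : A} (a b : A) {c : ℝ}
    (h : c • (p + v * q) = 0) (h' : c • (r + v * s) = 0) :
    c • (p * a + r * b + v * (q * a + s * b)) = 0 := by
  have e : p * a + r * b + v * (q * a + s * b) = (p + v * q) * a + (r + v * s) * b := by noncomm_ring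
  rw [e, smul_add, ← smul_mul_assoc, ← smul_mul_assoc, h, h', zero_mul, zero_mul, add_zero]

lemma IsSMonogenicOn.add_mul {f g : Para n → Cl n} {W : Set (Para n)} (hf : IsSMonogenicOn f W)
    (hg : IsSMonogenicOn g W) (a b : Cl n) : IsSMonogenicOn (fun x => f x * a + g x * b) W := by
  refine ⟨hf.1, ?_, fun I hI z hz => ?_⟩
  · exact ((clMulRight a).differentiable.comp_differentiableOn hf.2.1).add
      ((clMulRight b).differentiable.comp_differentiableOn hg.2.1)
  · have h1 := (clMulRight a).hasFDerivAt.comp z (hf.differentiableAt_slice hz).hasFDerivAt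
    have h2 := (clMulRight b).hasFDerivAt.comp z (hg.differentiableAt_slice hz).hasFDerivAt
    have h3 : fderiv ℝ (fun w : ℂ => f (slicePt I w) * a + g (slicePt I w) * b) z = _ :=
      (h1.add h2).fderiv
    rw [h3]
    have hf0 := hf.2.2 I hI z hz
    have hg0 := hg.2.2 I hI z hz
    exact smul_combination_eq_zero a b hf0 hg0

lemma IsSMonogenicOn.leftHolAt {f : Para n → Cl n} {W : Set (Para n)} (h : IsSMonogenicOn f W)
    {I : EuclideanSpace ℝ (Fin n)} (hI : I ∈ unitSphere n) :
    ∀ z ∈ slice I W, LeftHolAt (unitOp V I) (sliceFun V I f) z := by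
  intro z hz
  have hd := h.differentiableAt_slice hz
  have hf : HasFDerivAt (sliceFun V I f)
      ((leftMulCLM V n).comp (fderiv ℝ (fun w : ℂ => f (slicePt I w)) z)) z :=
    (leftMulCLM V n).hasFDerivAt.comp z hd.hasFDerivAt
  refine ⟨hf.differentiableAt, ?_⟩
  have h0 := h.2.2 I hI z hz
  rw [smul_eq_zero] at h0
  have h1 := h0.resolve_left (by norm_num)
  rw [hf.fderiv]
  simp only [ContinuousLinearMap.comp_apply, leftMulCLM_apply]
  rw [unitOp, ← leftMul_mul, ← leftMul_add, h1]
  exact map_zero (leftMulCLM V n)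

variable [CompleteSpace V]

/-- A symmetric planar neighbourhood D of the circles is rotated about the real axis: U consists of
the x whose real part and norm of the vector part give a point of D. By symmetry every slice of U is
D, so one system of curves serves all I. -/
lemma exists_isAdmissible [NeZero n] {T : Vn n V →L[ℝ] Vn n V} {W : Set (Para n)} (hW : IsOpen W)
    (h : circ (sSpectrum T) ⊆ W) : ∃ U, IsAdmissible T U ∧ closure U ⊆ W := by
  obtain ⟨D, hD, hCD, hDN, hs, -, m, γ, hγ⟩ := exists_positiveBoundary (isCompact_circleSet T)
    (isOpen_slicesIn hW) (circ_subset_iff.1 h) fun z hz => conj_mem_circleSet hz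
  set φ : Para n → ℂ := fun x =>
    ⟨x 0, ‖(WithLp.toLp 2 fun j => x j.succ : EuclideanSpace ℝ (Fin n))‖⟩ with hφ
  have hφc : Continuous φ := by
    have h1 : Continuous fun x : Para n =>
        ‖(WithLp.toLp 2 fun j => x j.succ : EuclideanSpace ℝ (Fin n))‖ :=
      ((PiLp.continuous_toLp 2 _).comp (continuous_pi fun j => by fun_prop)).norm
    have h2 : Continuous fun x : Para n => x 0 := by fun_prop
    exact Complex.equivRealProdCLM.symm.continuous.comp (h2.prodMk h1)
  have hφs : ∀ J ∈ unitSphere n, ∀ z : ℂ, φ (slicePt J z) = ⟨z.re, |z.im|⟩ := by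
    intro J hJ z
    have : (WithLp.toLp 2 fun j => slicePt J z j.succ : EuclideanSpace ℝ (Fin n)) = z.im • J := rfl
    simp only [hφ, this, norm_smul, slicePt_zero]
    rw [show ‖J‖ = 1 from hJ, mul_one, Real.norm_eq_abs]
  have hslice : ∀ J ∈ unitSphere n, slice J (φ ⁻¹' D) = D := by
    intro J hJ
    ext z
    rw [slice, mem_ofPred_eq, mem_preimage, hφs J hJ]
    rcases abs_cases z.im with ⟨h1, -⟩ | ⟨h1, -⟩
    · rw [h1]
    · rw [h1]
      refine ⟨fun h' => ?_, fun h' => hs _ h'⟩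
      have h2 := hs _ h'
      rwa [show (starRingEnd ℂ) ⟨z.re, -z.im⟩ = z by apply Complex.ext <;> simp] at h2
  refine ⟨φ ⁻¹' D, ⟨hD.preimage hφc, fun J hJ => ⟨m, γ, by rw [hslice J hJ]; exact hγ⟩,
    circ_subset_iff.2 fun c hc J hJ => ?_⟩, fun x hx => ?_⟩
  · have : c ∈ slice J (φ ⁻¹' D) := by rw [hslice J hJ]; exact hCD hc
    exact this
  · have h1 : φ x ∈ slicesIn W := hDN (hφc.closure_preimage_subset D hx)
    obtain ⟨J, hJ, hxJ⟩ := exists_slicePt_eq x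
    rw [hxJ]
    exact h1 J hJ

/-- Frees the hypothesis from admissible sets: only an open set containing the circularized spectrum
has to be tracked. -/
lemma locallySMonogenic_iff [NeZero n] {T : Vn n V →L[ℝ] Vn n V} {f : Para n → Cl n} :
    LocallySMonogenic T f ↔ ∃ W, circ (sSpectrum T) ⊆ W ∧ IsSMonogenicOn f W := by
  constructor
  · rintro ⟨U, W, hU, hUW, hf⟩
    exact ⟨W, hU.circ_subset.trans (subset_closure.trans hUW), hf⟩
  · rintro ⟨W, hW, hf⟩
    obtain ⟨U, hU, hUW⟩ := exists_isAdmissible hf.1 hW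
    exact ⟨U, W, hU, hUW, hf⟩

/-- The contour integral in the definition of the calculus, as an area integral. -/
theorem IsContour.sIntegral_eq [NeZero n] {T : Vn n V →L[ℝ] Vn n V} {f : Para n → Cl n}
    {U : Set (Para n)} {I : EuclideanSpace ℝ (Fin n)} {m : ℕ} {γ : Fin m → ℝ → ℂ}
    (h : IsContour T f U I γ) :
    (∀ k, IntervalIntegrable (sIntegrand T f I (γ k)) volume 0 1) ∧
    ∀ W, circ (sSpectrum T) ⊆ W → IsSMonogenicOn f W → ∀ J ∈ unitSphere n, ∀ χ,
      IsCutoff T (slice J W) χ →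
      sIntegral T f I γ = areaCalc T (unitOp V J) χ (sliceFun V J f) := by
  obtain ⟨hU, ⟨W₀, hUW, hf⟩, hI, hγ⟩ := h
  have hD := isOpen_slice hU.isOpen I
  have hi := unitOp_mul_self (V := V) hI
  have hcirc : circ (sSpectrum T) ⊆ W₀ := hU.circ_subset.trans (subset_closure.trans hUW)
  obtain ⟨χ₀, hχ₀⟩ := exists_isCutoff hD (planarSpectrum_subset_slice hU.circ_subset hI)
  obtain ⟨h1, h2⟩ := hγ.contour_eq_area hD (isOpen_slice hf.1 I) (closure_slice_subset hUW I) hi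
    (planarSpectrum_subset_slice hU.circ_subset hI) (hf.leftHolAt hI) hχ₀
  simp only [← sIntegrand_eq hI] at h1 h2
  refine ⟨h1, fun W hW hfW J hJ χ hχ => ?_⟩
  rw [sIntegral, h2, smul_neg]
  -- The contour integral is an area integral in the plane of I with a cutoff inside U. It is
  -- compared with the given cutoff in the plane of J, the two slice functions agreeing on the
  -- common real axis.
  refine areaCalc_eq_of_eqOn_real hi (unitOp_mul_self hJ) (isOpen_slice hf.1 I)
    (isOpen_slice hfW.1 J) (circleSet_subset_slice hcirc hI) (circleSet_subset_slice hW hJ)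
    (hf.leftHolAt hI) (hfW.leftHolAt hJ) (fun x => ?_)
    (hχ₀.mono fun z hz => closure_slice_subset hUW I (subset_closure hz)) hχ
  rw [sliceFun, sliceFun, slicePt_ofReal I J]

/-- The given contour and the one selected by `Classical.epsilon` both yield the same area integral.
-/
theorem IsContour.sIntegral_eq_sCalc [NeZero n] {T : Vn n V →L[ℝ] Vn n V} {f : Para n → Cl n}
    {U : Set (Para n)} {I : EuclideanSpace ℝ (Fin n)} {m : ℕ} {γ : Fin m → ℝ → ℂ}
    (h : IsContour T f U I γ) : sIntegral T f I γ = sCalc T f := by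
  have hex : ∃ F, ∃ (U : Set (Para n)) (I : EuclideanSpace ℝ (Fin n)) (m : ℕ)
    (γ : Fin m → ℝ → ℂ), IsContour T f U I γ ∧ F = sIntegral T f I γ := ⟨_, U, I, m, γ, h, rfl⟩
  obtain ⟨U', I', m', γ', h', heq⟩ := Classical.epsilon_spec hex
  change _ = Classical.epsilon _
  rw [heq]
  obtain ⟨hU, ⟨W, hUW, hf⟩, hI, hγ⟩ := h
  have hcirc : circ (sSpectrum T) ⊆ W := hU.circ_subset.trans (subset_closure.trans hUW)
  obtain ⟨χ, hχ⟩ := exists_isCutoff (isOpen_slice hf.1 I) (planarSpectrum_subset_slice hcirc hI)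
  rw [(IsContour.sIntegral_eq ⟨hU, ⟨W, hUW, hf⟩, hI, hγ⟩).2 W hcirc hf I hI χ hχ,
    h'.sIntegral_eq.2 W hcirc hf I hI χ hχ]

theorem sCalc_eq_areaCalc [NeZero n] {T : Vn n V →L[ℝ] Vn n V} {f : Para n → Cl n}
    {W : Set (Para n)} (hW : circ (sSpectrum T) ⊆ W) (hf : IsSMonogenicOn f W)
    {J : EuclideanSpace ℝ (Fin n)} (hJ : J ∈ unitSphere n) {χ : ℂ → ℝ}
    (hχ : IsCutoff T (slice J W) χ) :
    sCalc T f = areaCalc T (unitOp V J) χ (sliceFun V J f) := by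
  obtain ⟨U, hU, hUW⟩ := exists_isAdmissible hf.1 hW
  obtain ⟨m, γ, hγ⟩ := hU.boundary J hJ
  have h : IsContour T f U J γ := ⟨hU, ⟨W, hUW, hf⟩, hJ, hγ⟩
  rw [← h.sIntegral_eq_sCalc, h.sIntegral_eq.2 W hW hf J hJ χ hχ]

lemma sCalc_mem_Bn [NeZero n] {T : Vn n V →L[ℝ] Vn n V} (hT : T ∈ Bn n V) {f : Para n → Cl n}
    (hf : LocallySMonogenic T f) : sCalc T f ∈ Bn n V := by
  obtain ⟨W, hW, hf⟩ := locallySMonogenic_iff.1 hf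
  obtain ⟨I, hI⟩ := exists_mem_unitSphere (n := n)
  obtain ⟨χ, hχ⟩ := exists_isCutoff (isOpen_slice hf.1 I) (planarSpectrum_subset_slice hW hI)
  rw [sCalc_eq_areaCalc hW hf hI hχ]
  exact mem_Bn_iff.2 fun B => commute_areaCalc (mem_Bn_iff.1 hT B)
    (mem_Bn_iff.1 (leftMul_mem_Bn _) B) hχ (LeftHolAt.continuousOn (hf.leftHolAt hI))
    fun z => mem_Bn_iff.1 (leftMul_mem_Bn _) B

lemma sCalc_add_mul [NeZero n] {T : Vn n V →L[ℝ] Vn n V} {f g : Para n → Cl n}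
    (hf : LocallySMonogenic T f) (hg : LocallySMonogenic T g) (a b : Cl n) :
    LocallySMonogenic T (fun x => f x * a + g x * b) ∧
    sCalc T (fun x => f x * a + g x * b) = sCalc T f * leftMul a + sCalc T g * leftMul b := by
  obtain ⟨W₁, hW₁, hf⟩ := locallySMonogenic_iff.1 hf
  obtain ⟨W₂, hW₂, hg⟩ := locallySMonogenic_iff.1 hg
  have hW := subset_inter hW₁ hW₂
  have ho := hf.1.inter hg.1
  have hf := hf.mono ho inter_subset_left
  have hg := hg.mono ho inter_subset_right
  have hfg := hf.add_mul hg a b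
  refine ⟨locallySMonogenic_iff.2 ⟨_, hW, hfg⟩, ?_⟩
  obtain ⟨I, hI⟩ := exists_mem_unitSphere (n := n)
  obtain ⟨χ, hχ⟩ := exists_isCutoff (isOpen_slice ho I) (planarSpectrum_subset_slice hW hI)
  rw [sCalc_eq_areaCalc hW hf hI hχ, sCalc_eq_areaCalc hW hg hI hχ, sCalc_eq_areaCalc hW hfg hI hχ,
    ← areaCalc_add_mul hχ (LeftHolAt.continuousOn (hf.leftHolAt hI))
      (LeftHolAt.continuousOn (hg.leftHolAt hI))]
  congr 1
  funext z
  simp only [sliceFun, leftMul_add, leftMul_mul]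

end Calculus

/-! ### Continuity in the operator and the function -/

section Continuity

variable {V : Type*} [NormedAddCommGroup V] [NormedSpace ℝ V] [CompleteSpace V] {n : ℕ} [NeZero n]

/-- One plane and one cutoff serve T and all nearby T', so K can be taken as the image of the
support of the gradient of the cutoff in that plane. -/
theorem exists_sCalc_near {T : Vn n V →L[ℝ] Vn n V} (hT : T ∈ Bn n V) {f : Para n → Cl n}
    {W : Set (Para n)} (hW : circ (sSpectrum T) ⊆ W) (hf : IsSMonogenicOn f W) {ε : ℝ} (hε : 0 < ε) :
    ∃ δ > 0, ∃ K : Set (Para n), IsCompact K ∧ K ⊆ W ∧ ∀ T' ∈ Bn n V, bnNorm (T' - T) < δ →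
      circ (sSpectrum T') ⊆ W ∧ ∀ g, IsSMonogenicOn g W → (∀ x ∈ K, ‖g x - f x‖ < δ) →
        LocallySMonogenic T' g ∧ bnNorm (sCalc T' g - sCalc T f) < ε := by
  obtain ⟨I, hI⟩ := exists_mem_unitSphere (n := n)
  obtain ⟨χ, hχ⟩ := exists_isCutoff (isOpen_slice hf.1 I) (planarSpectrum_subset_slice hW hI)
  obtain ⟨c₁, hc₁, hnorm⟩ := norm_le_bnNorm (V := V) (n := n)
  obtain ⟨c₂, hc₂, hbn⟩ := bnNorm_le_norm (V := V) (n := n)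
  have hfc := LeftHolAt.continuousOn (hf.leftHolAt (V := V) hI)
  obtain ⟨δ₁, hδ₁, hcalc⟩ := hχ.areaCalc_continuous (unitOp V I) hfc (div_pos hε hc₂)
  obtain ⟨δ₂, hδ₂, hev⟩ := Metric.eventually_nhds_iff.1
    ((eventually_circleSet_subset (isOpen_slicesIn hf.1) (circ_subset_iff.1 hW)).and
      hχ.eventually_isCutoff)
  -- The added 1 keeps the divisor positive when V is trivial. The constants c₁ and c₂ pass from the
  -- norm of `Bn` to the operator norm and back.
  set M := ‖leftMulCLM V n‖ + 1 with hM
  have hM0 : 0 < M := by positivity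
  refine ⟨min (min δ₁ δ₂ / c₁) (δ₁ / M), by positivity,
    slicePt I '' tsupport (gradC χ), hχ.isCompact_tsupport_gradC.image (continuous_slicePt I), ?_, ?_⟩
  · rintro _ ⟨z, hz, rfl⟩
    exact hχ.subset (tsupport_gradC_subset χ hz)
  intro T' hT' hd
  have hd' : ‖T' - T‖ < min δ₁ δ₂ := by
    refine (hnorm _ (sub_mem_Bn hT' hT)).trans_lt ?_
    rw [← lt_div_iff₀' hc₁]
    exact hd.trans_le (min_le_left _ _)
  obtain ⟨hcirc, hχ'⟩ := hev (y := T') (by rw [dist_eq_norm]; exact hd'.trans_le (min_le_right _ _))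
  have hW' := circ_subset_iff.2 hcirc
  refine ⟨hW', fun g hg hgf => ⟨locallySMonogenic_iff.2 ⟨W, hW', hg⟩, ?_⟩⟩
  rw [sCalc_eq_areaCalc hW hf hI hχ, sCalc_eq_areaCalc hW' hg hI hχ']
  refine (hbn _).trans_lt ?_
  rw [← lt_div_iff₀' hc₂]
  refine hcalc T' (hd'.trans_le (min_le_left _ _)) _ (LeftHolAt.continuousOn (hg.leftHolAt hI))
    fun z hz => ?_
  have h1 := hgf _ (mem_image_of_mem _ hz)
  rw [sliceFun, sliceFun, ← leftMul_sub, ← leftMulCLM_apply]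
  calc ‖leftMulCLM V n (g (slicePt I z) - f (slicePt I z))‖
      ≤ ‖leftMulCLM V n‖ * ‖g (slicePt I z) - f (slicePt I z)‖ := ContinuousLinearMap.le_opNorm _ _
    _ ≤ M * ‖g (slicePt I z) - f (slicePt I z)‖ := by gcongr; rw [hM]; linarith
    _ < δ₁ := by
      rw [← lt_div_iff₀' hM0]
      exact h1.trans_le (min_le_right _ _)

end Continuity

/-! ### Power series in a paravector variable -/

section PowerSeries

variable {n : ℕ}

/-- The embedding of the complex numbers in the Clifford algebra with image the plane of `I`. -/
def planeHom {I : EuclideanSpace ℝ (Fin n)} (hI : I ∈ unitSphere n) : ℂ →ₐ[ℝ] Cl n :=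
  Complex.liftAux (Cl.vec I) (vec_mul_vec hI)

lemma toCl_slicePt_eq_planeHom {I : EuclideanSpace ℝ (Fin n)} (hI : I ∈ unitSphere n) (z : ℂ) :
    (slicePt I z).toCl = planeHom hI z := by
  rw [toCl_slicePt]; rfl

lemma planeHom_I {I : EuclideanSpace ℝ (Fin n)} (hI : I ∈ unitSphere n) :
    planeHom hI Complex.I = Cl.vec I := Complex.liftAux_apply_I _ _

/-- The embedding of a plane as a continuous linear map. -/
def planeCLM {I : EuclideanSpace ℝ (Fin n)} (hI : I ∈ unitSphere n) : ℂ →L[ℝ] Cl n :=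
  LinearMap.toContinuousLinearMap (planeHom hI).toLinearMap

instance : Nontrivial (Cl n) :=
  ⟨⟨0, 1, fun h => by simpa [Cl.coeff_one] using congrArg (fun x : Cl n => x.coeff ∅) h⟩⟩

lemma exists_norm_le_planeHom {I : EuclideanSpace ℝ (Fin n)} (hI : I ∈ unitSphere n) :
    ∃ c : ℝ, ∀ z, ‖z‖ ≤ c * ‖planeHom hI z‖ := by
  have hker : LinearMap.ker (planeHom hI).toLinearMap = ⊥ :=
    LinearMap.ker_eq_bot.2 (planeHom hI).toRingHom.injective
  obtain ⟨K, -, hK⟩ := LinearMap.exists_antilipschitzWith (planeHom hI).toLinearMap hker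
  exact ⟨K, fun z => by simpa using hK.le_mul_dist z 0⟩

variable (n) in
/-- The inclusion of paravectors in the Clifford algebra as a continuous linear map. -/
def toClCLM : Para n →L[ℝ] Cl n :=
  LinearMap.toContinuousLinearMap
    { toFun := Para.toCl
      map_add' := fun x y => by
        have h : (Cl.vec fun j => (x + y) j.succ)
            = Cl.vec (fun j => x j.succ) + Cl.vec (n := n) fun j => y j.succ :=
          (Cl.vecₗ n).map_add _ _
        rw [Para.toCl, Para.toCl, Para.toCl, h, PiLp.add_apply, map_add]
        exact add_add_add_comm _ _ _ _
      map_smul' := fun r x => by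
        have h : (Cl.vec fun j => (r • x) j.succ) = r • Cl.vec (n := n) fun j => x j.succ :=
          (Cl.vecₗ n).map_smul _ _
        rw [RingHom.id_apply, Para.toCl, Para.toCl, h, PiLp.smul_apply, smul_eq_mul, map_mul,
          ← Algebra.smul_def]
        exact (smul_add _ _ _).symm }

lemma toClCLM_apply (x : Para n) : toClCLM n x = x.toCl := rfl

variable (n) in
/-- The left regular representation of the Clifford algebra. -/
def regularRep : Cl n →L[ℝ] (Cl n →L[ℝ] Cl n) :=
  LinearMap.toContinuousLinearMap (LinearMap.toContinuousLinearMap.toLinearMap ∘ₗ LinearMap.mul ℝ (Cl n))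

lemma regularRep_apply (a b : Cl n) : regularRep n a b = a * b := rfl

/-- The Euclidean norm of `Cl n` is not submultiplicative in general, so powers are differentiated
and estimated in the normed algebra of its endomorphisms. -/
lemma regularRep_pow (a : Cl n) (k : ℕ) : regularRep n (a ^ k) = regularRep n a ^ k := by
  induction k with
  | zero => ext1 b; rw [pow_zero, pow_zero, regularRep_apply, one_mul]; rfl
  | succ k ih =>
    ext1 b
    rw [pow_succ, pow_succ, ← ih, mul_apply_eq_comp, regularRep_apply, regularRep_apply,
      regularRep_apply, mul_assoc]

/-- A paravector lies in a plane isomorphic to ℂ, so its powers are paravectors of norm ‖x‖^k; the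
constant does not depend on k. -/
lemma norm_toCl_pow_le [NeZero n] (x : Para n) (k : ℕ) : ‖x.toCl ^ k‖ ≤ ‖toClCLM n‖ * ‖x‖ ^ k := by
  obtain ⟨I, hI, hx⟩ := exists_slicePt_eq x
  rw [hx, toCl_slicePt_eq_planeHom hI, ← map_pow, ← toCl_slicePt_eq_planeHom hI, norm_slicePt hI,
    ← norm_pow, ← norm_slicePt hI]
  exact (toClCLM n).le_opNorm _

/-- The derivative of `x ↦ x ^ k`. -/
lemma exists_hasFDerivAt_toCl_pow [NeZero n] : ∃ c : ℝ, 0 ≤ c ∧ ∀ (k : ℕ) (x : Para n),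
    ∃ D : Para n →L[ℝ] Cl n, HasFDerivAt (fun x : Para n => x.toCl ^ k) D x ∧
      ‖D‖ ≤ c * (k * ‖x‖ ^ (k - 1)) := by
  set ev : (Cl n →L[ℝ] Cl n) →L[ℝ] Cl n := ContinuousLinearMap.apply ℝ (Cl n) (1 : Cl n) with hev
  set G : Para n →L[ℝ] (Cl n →L[ℝ] Cl n) := (regularRep n).comp (toClCLM n) with hG
  set C : ℝ := ‖regularRep n‖ * ‖toClCLM n‖ with hC
  have hGpow : ∀ (x : Para n) (k : ℕ), ‖G x ^ k‖ ≤ C * ‖x‖ ^ k := by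
    intro x k
    rw [hG, ContinuousLinearMap.comp_apply, ← regularRep_pow, toClCLM_apply, hC, mul_assoc]
    exact ((regularRep n).le_opNorm _).trans (by gcongr; exact norm_toCl_pow_le x k)
  refine ⟨‖ev‖ * (C * ‖G‖ * C), by positivity, fun k x => ?_⟩
  have h := (G.hasFDerivAt (x := x)).fun_pow' k
  refine ⟨_, (ev.hasFDerivAt.comp x h).congr_of_eventuallyEq (Eventually.of_forall fun y => ?_), ?_⟩
  · simp only [hev, hG, Function.comp_apply, ContinuousLinearMap.comp_apply, ← regularRep_pow,
      ContinuousLinearMap.apply_apply, regularRep_apply, mul_one, toClCLM_apply]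
  · refine (ContinuousLinearMap.opNorm_comp_le _ _).trans ?_
    rw [mul_assoc]
    gcongr
    refine (norm_sum_le _ _).trans ?_
    -- The derivative of the noncommutative power is the sum of k terms G(x)^(k-1-i) G(v) G(x)^i,
    -- each of them bounded by the same constant times ‖x‖^(k-1).
    refine (Finset.sum_le_card_nsmul _ _ (C * ‖G‖ * C * ‖x‖ ^ (k - 1)) fun i hi => ?_).trans_eq ?_
    · refine ContinuousLinearMap.opNorm_le_bound _ (by positivity) fun v => ?_
      have hi' : k - 1 = (k.pred - i) + i := by
        have := Finset.mem_range.1 hi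
        rw [Nat.pred_eq_sub_one]; omega
      change ‖G x ^ (k.pred - i) * (G v * G x ^ i)‖ ≤ _
      calc ‖G x ^ (k.pred - i) * (G v * G x ^ i)‖
          ≤ ‖G x ^ (k.pred - i)‖ * (‖G v‖ * ‖G x ^ i‖) :=
            (norm_mul_le _ _).trans (by gcongr; exact norm_mul_le _ _)
        _ ≤ C * ‖x‖ ^ (k.pred - i) * (‖G‖ * ‖v‖ * (C * ‖x‖ ^ i)) := by
            gcongr
            · exact hGpow _ _
            · exact G.le_opNorm v
            · exact hGpow _ _
        _ = C * ‖G‖ * C * ‖x‖ ^ (k - 1) * ‖v‖ := by rw [hi', pow_add]; ring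
    · rw [Finset.card_range, nsmul_eq_mul]; ring

/-- The power series with coefficients `a` converges geometrically on the disc of radius `r`. -/
def CoeffBound (a : ℕ → ℝ) (r : ℝ) : Prop := ∃ B : ℝ, ∀ k, |a k| * r ^ k ≤ B

lemma CoeffBound.summable {a : ℕ → ℝ} {r : ℝ} (h : CoeffBound a r) {ρ : ℝ} (h0 : 0 ≤ ρ) (h1 : ρ < r) :
    Summable fun k => |a k| * ρ ^ k := by
  obtain ⟨B, hB⟩ := h
  have hr : 0 < r := h0.trans_lt h1
  refine Summable.of_nonneg_of_le (fun k => by positivity) (fun k => ?_)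
    ((summable_geometric_of_lt_one (by positivity) ((div_lt_one hr).2 h1)).mul_left B)
  calc |a k| * ρ ^ k = |a k| * r ^ k * (ρ / r) ^ k := by rw [div_pow]; field_simp
    _ ≤ B * (ρ / r) ^ k := by gcongr; exact hB k

lemma CoeffBound.summable_deriv {a : ℕ → ℝ} {r : ℝ} (h : CoeffBound a r) {ρ : ℝ} (h0 : 0 < ρ)
    (h1 : ρ < r) : Summable fun k : ℕ => |a k| * (k * ρ ^ (k - 1)) := by
  obtain ⟨B, hB⟩ := h
  have hr : 0 < r := h0.trans h1
  have hq : ‖ρ / r‖ < 1 := by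
    rw [Real.norm_of_nonneg (by positivity)]; exact (div_lt_one hr).2 h1
  refine Summable.of_nonneg_of_le (fun k => by positivity) (fun k => ?_)
    ((summable_pow_mul_geometric_of_norm_lt_one 1 hq).mul_left (B / ρ))
  rcases k with _ | k
  · simp
  calc |a (k + 1)| * ((k + 1 : ℕ) * ρ ^ (k + 1 - 1))
      = |a (k + 1)| * r ^ (k + 1) * ((k + 1 : ℕ) * (ρ / r) ^ (k + 1)) / ρ := by
        rw [div_pow, Nat.add_sub_cancel, pow_succ ρ]; field_simp
    _ ≤ B * ((k + 1 : ℕ) * (ρ / r) ^ (k + 1)) / ρ := by gcongr; exact hB _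
    _ = B / ρ * (((k + 1 : ℕ) : ℝ) ^ 1 * (ρ / r) ^ (k + 1)) := by ring

/-- The sum of the power series with coefficients `a`. -/
def powerSum (a : ℕ → ℝ) (z : ℂ) : ℂ := ∑' k, (a k : ℂ) * z ^ k

lemma CoeffBound.differentiableAt {a : ℕ → ℝ} {r : ℝ} (h : CoeffBound a r) {z : ℂ} (hz : ‖z‖ < r) :
    DifferentiableAt ℂ (powerSum a) z := by
  obtain ⟨ρ, h1, h2⟩ := exists_between hz
  have hs := h.summable ((norm_nonneg z).trans h1.le) h2
  refine (Complex.differentiableOn_tsum_of_summable_norm hs (U := Metric.ball 0 ρ)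
    (fun k => by fun_prop) Metric.isOpen_ball fun k w hw => ?_).differentiableAt
    (Metric.isOpen_ball.mem_nhds (mem_ball_zero_iff.2 h1))
  rw [norm_mul, norm_pow, Complex.norm_real, Real.norm_eq_abs]
  gcongr
  exact (mem_ball_zero_iff.1 hw).le

lemma CoeffBound.summable_norm {a : ℕ → ℝ} {r : ℝ} (h : CoeffBound a r) {z : ℂ} (hz : ‖z‖ < r) :
    Summable fun k => (a k : ℂ) * z ^ k := by
  refine Summable.of_norm ((h.summable (norm_nonneg z) hz).congr fun k => ?_)
  rw [norm_mul, norm_pow, Complex.norm_real, Real.norm_eq_abs]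

variable {a : ℕ → ℝ} {f : Para n → Cl n} {W : Set (Para n)}

lemma exists_norm_lt_of_isOpen {U : Set ℂ} (hU : IsOpen U) {z : ℂ} (hz : z ∈ U) :
    ∃ w ∈ U, ‖z‖ < ‖w‖ := by
  obtain ⟨δ, hδ, hsub⟩ := Metric.isOpen_iff.1 hU z hz
  obtain ⟨u, hu, hzu⟩ : ∃ u : ℂ, ‖u‖ = 1 ∧ z = ‖z‖ * u := by
    by_cases h : z = 0
    · exact ⟨1, norm_one, by simp [h]⟩
    · exact ⟨z / ‖z‖, by simp [h], by field_simp [norm_ne_zero_iff.2 h]⟩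
  refine ⟨z + (δ / 2 : ℝ) * u, hsub ?_, ?_⟩
  · rw [mem_ball_iff_norm, add_sub_cancel_left, norm_mul, hu, Complex.norm_real, Real.norm_eq_abs,
      abs_of_pos (by positivity)]
    linarith
  · have e : z + (δ / 2 : ℝ) * u = ((‖z‖ + δ / 2 : ℝ) : ℂ) * u := by
      nth_rewrite 1 [hzu]; push_cast; ring
    rw [e, norm_mul, hu, Complex.norm_real, Real.norm_eq_abs, abs_of_pos (by positivity)]
    linarith

lemma mul_algebraMap (b : Cl n) (r : ℝ) : b * algebraMap ℝ (Cl n) r = r • b := by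
  rw [← Algebra.commutes, ← Algebra.smul_def]

lemma toCl_pow_mul_algebraMap {I : EuclideanSpace ℝ (Fin n)} (hI : I ∈ unitSphere n) (z : ℂ) (k : ℕ)
    (r : ℝ) : (slicePt I z).toCl ^ k * algebraMap ℝ (Cl n) r = planeHom hI ((r : ℂ) * z ^ k) := by
  rw [toCl_slicePt_eq_planeHom hI, ← map_pow, ← (planeHom hI).commutes, ← map_mul, mul_comm]
  rfl

/-- An open set contains, with z, a point w of larger modulus in the same plane, and convergence at
w bounds a_k w^k. So W need be neither a ball nor contain 0. -/
lemma exists_coeffBound (hW : IsOpen W)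
    (hf : ∀ x ∈ W, HasSum (fun k => x.toCl ^ k * algebraMap ℝ (Cl n) (a k)) (f x))
    {I : EuclideanSpace ℝ (Fin n)} (hI : I ∈ unitSphere n) {z : ℂ} (hz : z ∈ slice I W) :
    ∃ r, ‖z‖ < r ∧ CoeffBound a r := by
  obtain ⟨w, hw, hzw⟩ := exists_norm_lt_of_isOpen (isOpen_slice hW I) hz
  refine ⟨‖w‖, hzw, ?_⟩
  obtain ⟨c, hc⟩ := exists_norm_le_planeHom hI
  have h1 := (hf _ hw).summable.tendsto_atTop_zero
  simp only [toCl_pow_mul_algebraMap hI] at h1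
  have h2 : Tendsto (fun k => ‖planeHom hI ((a k : ℂ) * w ^ k)‖) atTop (𝓝 0) := by
    simpa using h1.norm
  obtain ⟨B, hB⟩ := (h2.const_mul c).bddAbove_range
  refine ⟨B, fun k => ?_⟩
  have := (hc ((a k : ℂ) * w ^ k)).trans (hB ⟨k, rfl⟩)
  rwa [norm_mul, norm_pow, Complex.norm_real, Real.norm_eq_abs] at this

lemma eq_planeHom_powerSum (hW : IsOpen W)
    (hf : ∀ x ∈ W, HasSum (fun k => x.toCl ^ k * algebraMap ℝ (Cl n) (a k)) (f x))
    {I : EuclideanSpace ℝ (Fin n)} (hI : I ∈ unitSphere n) {z : ℂ} (hz : z ∈ slice I W) :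
    f (slicePt I z) = planeHom hI (powerSum a z) := by
  obtain ⟨r, hr, hb⟩ := exists_coeffBound hW hf hI hz
  have h1 := hf _ hz
  simp only [toCl_pow_mul_algebraMap hI] at h1
  exact h1.unique ((planeCLM hI).hasSum (hb.summable_norm hr).hasSum)

/-- Termwise differentiation on a ball about 0 slightly larger than ‖x‖. The ball need not lie in W;
the sum of the series agrees with f near x. -/
lemma differentiableOn_of_hasSum [NeZero n] (hW : IsOpen W)
    (hf : ∀ x ∈ W, HasSum (fun k => x.toCl ^ k * algebraMap ℝ (Cl n) (a k)) (f x)) :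
    DifferentiableOn ℝ f W := by
  intro x hx
  obtain ⟨I, hI, hxI⟩ := exists_slicePt_eq x
  have hzW := hx
  rw [hxI] at hzW
  obtain ⟨r, hr, hb⟩ := exists_coeffBound hW hf hI hzW
  rw [← norm_slicePt hI, ← hxI] at hr
  obtain ⟨ρ, h1, h2⟩ := exists_between hr
  have hρ : 0 < ρ := (norm_nonneg x).trans_lt h1
  obtain ⟨c, hc, hD⟩ := exists_hasFDerivAt_toCl_pow (n := n)
  choose D hD1 hD2 using hD
  have hmem : x ∈ Metric.ball (0 : Para n) ρ := mem_ball_zero_iff.2 h1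
  have key := hasFDerivAt_tsum_of_isPreconnected
    (f := fun k (y : Para n) => a k • y.toCl ^ k) (f' := fun k y => a k • D k y)
    ((hb.summable_deriv hρ h2).mul_left c) (Metric.isOpen_ball (x := (0 : Para n)) (ε := ρ))
    (convex_ball _ _).isPreconnected (fun k y _ => (hD1 k y).const_smul (a k))
    (fun k y hy => ?_) hmem ?_ hmem
  · refine (key.congr_of_eventuallyEq ?_).differentiableAt.differentiableWithinAt
    filter_upwards [hW.mem_nhds hx] with y hy
    rw [← (hf y hy).tsum_eq]
    exact tsum_congr fun k => mul_algebraMap _ _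
  · rw [norm_smul, Real.norm_eq_abs]
    calc |a k| * ‖D k y‖ ≤ |a k| * (c * (k * ‖y‖ ^ (k - 1))) := by gcongr; exact hD2 k y
      _ ≤ |a k| * (c * (k * ρ ^ (k - 1))) := by
        gcongr
        exact (mem_ball_zero_iff.1 hy).le
      _ = c * (|a k| * (k * ρ ^ (k - 1))) := by ring
  · exact (hf x hx).summable.congr fun k => mul_algebraMap _ _

end PowerSeries

/-! ### Multiplicativity on limits of real polynomials -/

section Polynomials

variable {E : Type*} [NormedRing E] [NormedAlgebra ℝ E]

lemma areaCalc_congr {T i : E} {χ : ℂ → ℝ} {D : Set ℂ} (hχ : IsCutoff T D χ) {f g : ℂ → E}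
    (h : EqOn f g D) : areaCalc T i χ f = areaCalc T i χ g := by
  rw [areaCalc, areaCalc]
  congr 3
  funext z
  by_cases hz : z ∈ tsupport (gradC χ)
  · rw [areaIntegrand, areaIntegrand, h (hχ.subset (tsupport_gradC_subset χ hz))]
  · rw [areaIntegrand_eq_zero hz, areaIntegrand_eq_zero hz]

variable [CompleteSpace E]

lemma areaCalc_aeval {T i : E} (hi : i * i = -1) {χ : ℂ → ℝ} (hχ : IsCutoff T univ χ)
    (p : Polynomial ℝ) :
    areaCalc T i χ (fun z => cplx i (Polynomial.aeval z p)) = Polynomial.aeval T p := by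
  have hc : ∀ p : Polynomial ℝ, ContinuousOn (fun z => cplx i (Polynomial.aeval z p)) univ := fun p =>
    ((continuous_cplx i).comp (Polynomial.continuous_aeval p)).continuousOn
  induction p using Polynomial.induction_on' with
  | add p q hp hq =>
    rw [map_add, ← hp, ← hq]
    have h := areaCalc_add_mul (i := i) hχ (hc p) (hc q) 1 1
    rw [mul_one, mul_one] at h
    rw [← h]
    congr 1
    funext z
    rw [map_add, mul_one, mul_one, ← cplxCLM_apply, map_add, cplxCLM_apply, cplxCLM_apply]
  | monomial k r =>
    have hk : ContinuousOn (fun z : ℂ => cplx i z ^ k) univ := ((continuous_cplx i).pow k).continuousOn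
    have h := areaCalc_add_mul (i := i) hχ hk hk (r • 1) 0
    rw [mul_zero, add_zero, areaCalc_pow hi hχ, mul_smul_comm, mul_one] at h
    rw [Polynomial.aeval_monomial, ← Algebra.smul_def, ← h]
    congr 1
    funext z
    rw [mul_zero, add_zero, mul_smul_comm, mul_one, cplx_pow hi, Polynomial.aeval_monomial,
      ← Algebra.smul_def, ← cplxCLM_apply, ← cplxCLM_apply, map_smul]

lemma tendsto_areaCalc_cplx {T i : E} {D : Set ℂ} {χ : ℂ → ℝ} (hχ : IsCutoff T D χ) {F : ℕ → ℂ → ℂ}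
    {Φ : ℂ → ℂ} (hF : ∀ N, Continuous (F N)) (hΦ : ContinuousOn Φ D)
    (h : TendstoUniformlyOn F Φ atTop (tsupport (gradC χ))) :
    Tendsto (fun N => areaCalc T i χ fun z => cplx i (F N z)) atTop
      (𝓝 (areaCalc T i χ fun z => cplx i (Φ z))) := by
  have hu : TendstoUniformlyOn (fun N z => cplx i (F N z)) (fun z => cplx i (Φ z)) atTop
      (tsupport (gradC χ)) := by
    have := (cplxCLM i).uniformContinuous.comp_tendstoUniformlyOn h
    simpa only [Function.comp_def, cplxCLM_apply] using this
  rw [Metric.tendsto_atTop]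
  intro ε hε
  obtain ⟨δ, hδ, hcalc⟩ := hχ.areaCalc_continuous i ((continuous_cplx i).comp_continuousOn hΦ) hε
  obtain ⟨N₀, hN₀⟩ := eventually_atTop.1 (Metric.tendstoUniformlyOn_iff.1 hu δ hδ)
  refine ⟨N₀, fun N hN => ?_⟩
  rw [dist_eq_norm]
  refine hcalc T (by rwa [sub_self, norm_zero]) _
    ((continuous_cplx i).comp_continuousOn (hF N).continuousOn) fun z hz => ?_
  rw [← dist_eq_norm, dist_comm]
  exact hN₀ N hN z hz

/-- On real polynomials the calculus is evaluation at T, hence multiplicative. It depends only on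
the values on the support of the gradient of the cutoff, so uniform approximation there suffices to
pass to the limit. -/
theorem areaCalc_cplx_mul {T i : E} (hi : i * i = -1) {D : Set ℂ} {χ : ℂ → ℝ} (hχ : IsCutoff T D χ)
    {p q : ℕ → Polynomial ℝ} {Φ Ψ : ℂ → ℂ} (hΦ : ContinuousOn Φ D) (hΨ : ContinuousOn Ψ D)
    (hp : TendstoUniformlyOn (fun N z => Polynomial.aeval z (p N)) Φ atTop (tsupport (gradC χ)))
    (hq : TendstoUniformlyOn (fun N z => Polynomial.aeval z (q N)) Ψ atTop (tsupport (gradC χ))) :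
    areaCalc T i χ (fun z => cplx i (Φ z * Ψ z))
      = areaCalc T i χ (fun z => cplx i (Φ z)) * areaCalc T i χ fun z => cplx i (Ψ z) := by
  have hχu : IsCutoff T univ χ := hχ.mono (subset_univ D)
  have hK : tsupport (gradC χ) ⊆ D := (tsupport_gradC_subset χ).trans hχ.subset
  have hpq : TendstoUniformlyOn (fun N z => Polynomial.aeval z (p N * q N)) (fun z => Φ z * Ψ z) atTop
      (tsupport (gradC χ)) := by
    simp only [map_mul]
    exact (tendstoLocallyUniformlyOn_iff_tendstoUniformlyOn_of_compact hχ.isCompact_tsupport_gradC).1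
      (hp.tendstoLocallyUniformlyOn.fun_mul₀ hq.tendstoLocallyUniformlyOn (hΦ.mono hK) (hΨ.mono hK))
  have h1 := tendsto_areaCalc_cplx (i := i) hχ (fun N => Polynomial.continuous_aeval (p N)) hΦ hp
  have h2 := tendsto_areaCalc_cplx (i := i) hχ (fun N => Polynomial.continuous_aeval (q N)) hΨ hq
  have h3 := tendsto_areaCalc_cplx (i := i) hχ (fun N => Polynomial.continuous_aeval (p N * q N))
    (hΦ.mul hΨ) hpq
  simp only [areaCalc_aeval hi hχu] at h1 h2 h3
  simp only [map_mul] at h3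
  exact tendsto_nhds_unique h3 (h1.mul h2)

end Polynomials

/-! ### Products of power series with real coefficients -/

section Products

variable {V : Type*} [NormedAddCommGroup V] [NormedSpace ℝ V] {n : ℕ}

/-- The same complex function describes f in all planes, with values in the plane itself. Such
functions commute with I there, so their products are again s-monogenic, which fails for s-monogenic
functions in general. -/
lemma isSMonogenicOn_of_planeHom {f : Para n → Cl n} {W : Set (Para n)} (hW : IsOpen W)
    (hd : DifferentiableOn ℝ f W) {Φ : ℂ → ℂ}
    (hΦ : ∀ I ∈ unitSphere n, ∀ z ∈ slice I W, DifferentiableAt ℂ Φ z)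
    (h : ∀ (I) (hI : I ∈ unitSphere n), ∀ z ∈ slice I W, f (slicePt I z) = planeHom hI (Φ z)) :
    IsSMonogenicOn f W := by
  refine ⟨hW, hd, fun I hI z hz => ?_⟩
  have h1 : HasFDerivAt (fun w => f (slicePt I w))
      ((planeCLM hI).comp ((fderiv ℂ Φ z).restrictScalars ℝ)) z := by
    refine ((planeCLM hI).hasFDerivAt.comp z
      ((hΦ I hI z hz).hasFDerivAt.restrictScalars ℝ)).congr_of_eventuallyEq ?_
    filter_upwards [(isOpen_slice hW I).mem_nhds hz] with w hw using h I hI w hw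
  have h2 : fderiv ℂ Φ z Complex.I = Complex.I * fderiv ℂ Φ z 1 := by
    rw [← smul_eq_mul, ← map_smul, smul_eq_mul, mul_one]
  have h3 : planeHom hI (fderiv ℂ Φ z Complex.I) = Cl.vec I * planeHom hI (fderiv ℂ Φ z 1) := by
    rw [h2, map_mul, planeHom_I]
  rw [h1.fderiv]
  change (1 / 2 : ℝ) • (planeHom hI (fderiv ℂ Φ z 1)
    + Cl.vec I * planeHom hI (fderiv ℂ Φ z Complex.I)) = 0
  rw [h3, ← mul_assoc, vec_mul_vec hI, neg_one_mul]
  exact (congrArg _ (add_neg_cancel _)).trans (smul_zero _)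

lemma sliceFun_eq_cplx {f : Para n → Cl n} {I : EuclideanSpace ℝ (Fin n)} (hI : I ∈ unitSphere n)
    {z w : ℂ} (h : f (slicePt I z) = planeHom hI w) : sliceFun V I f z = cplx (unitOp V I) w := by
  rw [sliceFun, h, ← toCl_slicePt_eq_planeHom, leftMul_toCl_slicePt]

lemma aeval_sum_monomial (a : ℕ → ℝ) (N : ℕ) (z : ℂ) :
    Polynomial.aeval z (∑ k ∈ Finset.range N, Polynomial.monomial k (a k))
      = ∑ k ∈ Finset.range N, (a k : ℂ) * z ^ k := by
  rw [map_sum]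
  exact Finset.sum_congr rfl fun k _ => Polynomial.aeval_monomial z

lemma tendstoUniformlyOn_powerSum {a : ℕ → ℝ} {K : Set ℂ} (hK : IsCompact K)
    (h : ∀ z ∈ K, ∃ r, ‖z‖ < r ∧ CoeffBound a r) :
    TendstoUniformlyOn (fun N z => Polynomial.aeval z
      (∑ k ∈ Finset.range N, Polynomial.monomial k (a k))) (powerSum a) atTop K := by
  simp only [aeval_sum_monomial]
  rcases K.eq_empty_or_nonempty with rfl | hne
  · exact tendstoUniformlyOn_empty
  -- The series at a point of maximal modulus dominates the series on all of K.
  obtain ⟨z₀, hz₀, hmax⟩ := hK.exists_isMaxOn hne continuous_norm.continuousOn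
  obtain ⟨r, hr, hb⟩ := h z₀ hz₀
  refine tendstoUniformlyOn_tsum_nat (hb.summable (norm_nonneg z₀) hr) fun k z hz => ?_
  rw [norm_mul, norm_pow, Complex.norm_real, Real.norm_eq_abs]
  gcongr
  exact hmax hz

variable [CompleteSpace V] [NeZero n]

theorem sCalc_mul_of_hasSum {T : Vn n V →L[ℝ] Vn n V} {f g : Para n → Cl n} {a b : ℕ → ℝ}
    {W : Set (Para n)} (hW : IsOpen W) (hTW : circ (sSpectrum T) ⊆ W)
    (hf : ∀ x ∈ W, HasSum (fun k => x.toCl ^ k * algebraMap ℝ (Cl n) (a k)) (f x))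
    (hg : ∀ x ∈ W, HasSum (fun k => x.toCl ^ k * algebraMap ℝ (Cl n) (b k)) (g x)) :
    LocallySMonogenic T f ∧ LocallySMonogenic T g ∧ LocallySMonogenic T (fun x => f x * g x) ∧
      sCalc T (fun x => f x * g x) = sCalc T f * sCalc T g := by
  have hfd := differentiableOn_of_hasSum hW hf
  have hgd := differentiableOn_of_hasSum hW hg
  have hfe := fun (I) (hI : I ∈ unitSphere n) (z) (hz : z ∈ slice I W) =>
    eq_planeHom_powerSum hW hf hI hz
  have hge := fun (I) (hI : I ∈ unitSphere n) (z) (hz : z ∈ slice I W) =>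
    eq_planeHom_powerSum hW hg hI hz
  have hΦ : ∀ I ∈ unitSphere n, ∀ z ∈ slice I W, DifferentiableAt ℂ (powerSum a) z := by
    intro I hI z hz
    obtain ⟨r, hr, hb⟩ := exists_coeffBound hW hf hI hz
    exact hb.differentiableAt hr
  have hΨ : ∀ I ∈ unitSphere n, ∀ z ∈ slice I W, DifferentiableAt ℂ (powerSum b) z := by
    intro I hI z hz
    obtain ⟨r, hr, hb⟩ := exists_coeffBound hW hg hI hz
    exact hb.differentiableAt hr
  have hfge : ∀ (I) (hI : I ∈ unitSphere n), ∀ z ∈ slice I W,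
      f (slicePt I z) * g (slicePt I z) = planeHom hI (powerSum a z * powerSum b z) := by
    intro I hI z hz
    rw [hfe I hI z hz, hge I hI z hz, map_mul]
  have hfgd : DifferentiableOn ℝ (fun x => f x * g x) W :=
    ((regularRep n).differentiable.comp_differentiableOn hfd).clm_apply hgd
  have hfm := isSMonogenicOn_of_planeHom hW hfd hΦ hfe
  have hgm := isSMonogenicOn_of_planeHom hW hgd hΨ hge
  have hfgm : IsSMonogenicOn (fun x => f x * g x) W := isSMonogenicOn_of_planeHom hW hfgd
    (fun I hI z hz => (hΦ I hI z hz).mul (hΨ I hI z hz)) hfge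
  refine ⟨locallySMonogenic_iff.2 ⟨W, hTW, hfm⟩, locallySMonogenic_iff.2 ⟨W, hTW, hgm⟩,
    locallySMonogenic_iff.2 ⟨W, hTW, hfgm⟩, ?_⟩
  obtain ⟨I, hI⟩ := exists_mem_unitSphere (n := n)
  obtain ⟨χ, hχ⟩ := exists_isCutoff (isOpen_slice hW I) (planarSpectrum_subset_slice hTW hI)
  have hK : tsupport (gradC χ) ⊆ slice I W := (tsupport_gradC_subset χ).trans hχ.subset
  rw [sCalc_eq_areaCalc hTW hfm hI hχ, sCalc_eq_areaCalc hTW hgm hI hχ,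
    sCalc_eq_areaCalc hTW hfgm hI hχ,
    areaCalc_congr hχ fun z hz => sliceFun_eq_cplx hI (hfe I hI z hz),
    areaCalc_congr hχ fun z hz => sliceFun_eq_cplx hI (hge I hI z hz),
    areaCalc_congr hχ fun z hz => sliceFun_eq_cplx (f := fun x => f x * g x) hI (hfge I hI z hz)]
  exact areaCalc_cplx_mul (unitOp_mul_self hI) hχ
    (fun z hz => (hΦ I hI z hz).continuousAt.continuousWithinAt)
    (fun z hz => (hΨ I hI z hz).continuousAt.continuousWithinAt)
    (tendstoUniformlyOn_powerSum hχ.isCompact_tsupport_gradC fun z hz =>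
      exists_coeffBound hW hf hI (hK hz))
    (tendstoUniformlyOn_powerSum hχ.isCompact_tsupport_gradC fun z hz =>
      exists_coeffBound hW hg hI (hK hz))

end Products

/-! ### Area integrals of holomorphic functions with compact singular set -/

section Scalar

lemma tsupport_gradC_subset_sdiff {σ U : Set ℂ} {χ : ℂ → ℝ} (hsub : tsupport χ ⊆ U)
    (hev : ∀ᶠ z in 𝓝ˢ σ, χ z = 1) : tsupport (gradC χ) ⊆ U \ σ := by
  refine fun z hz => ⟨hsub (tsupport_gradC_subset χ hz), fun hs => ?_⟩
  refine notMem_tsupport_iff_eventuallyEq.2 ?_ hz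
  filter_upwards [(eventually_nhdsSet_iff_forall.1 hev z hs).eventually_nhds] with w hw
  exact gradC_eq_zero_of_eventually_eq hw

lemma integrable_gradC_mul {σ U : Set ℂ} {χ : ℂ → ℝ} (h1 : ContDiff ℝ 1 χ) (hc : HasCompactSupport χ)
    (hsub : tsupport χ ⊆ U) (hev : ∀ᶠ z in 𝓝ˢ σ, χ z = 1) {φ : ℂ → ℂ}
    (hφ : ContinuousOn φ (U \ σ)) : Integrable fun z => gradC χ z * φ z := by
  have hK : IsCompact (tsupport (gradC χ)) :=
    hc.isCompact.of_isClosed_subset (isClosed_tsupport _) (tsupport_gradC_subset χ)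
  have h2 : IntegrableOn (fun z => gradC χ z * φ z) (tsupport (gradC χ)) :=
    ((continuous_gradC h1).continuousOn.mul
      (hφ.mono (tsupport_gradC_subset_sdiff hsub hev))).integrableOn_compact hK
  refine (integrableOn_iff_integrable_of_support_subset fun z hz => ?_).1 h2
  exact subset_tsupport _ (left_ne_zero_of_mul hz)

lemma integral_gradC_mul_eq {σ U : Set ℂ} (hU : IsOpen U) (hσ : IsClosed σ) {χ ρ : ℂ → ℝ}
    (h1 : ContDiff ℝ 1 χ) (hc : HasCompactSupport χ) (hsub : tsupport χ ⊆ U)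
    (hev : ∀ᶠ z in 𝓝ˢ σ, χ z = 1) (h1' : ContDiff ℝ 1 ρ) (hc' : HasCompactSupport ρ)
    (hsub' : tsupport ρ ⊆ U) (hev' : ∀ᶠ z in 𝓝ˢ σ, ρ z = 1) {φ : ℂ → ℂ}
    (hφ : DifferentiableOn ℂ φ (U \ σ)) :
    ∫ z, gradC χ z * φ z = ∫ z, gradC ρ z * φ z := by
  have hd := h1.differentiable one_ne_zero
  have hd' := h1'.differentiable one_ne_zero
  rw [← sub_eq_zero, ← integral_sub (integrable_gradC_mul h1 hc hsub hev hφ.continuousOn)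
    (integrable_gradC_mul h1' hc' hsub' hev' hφ.continuousOn),
    ← integral_dbar_mul_eq_zero (hU.sdiff hσ) (h1.sub h1') (hc.sub hc') (fun z hz => ⟨?_, fun hs => ?_⟩)
      hφ]
  · refine integral_congr_ae (Eventually.of_forall fun z => ?_)
    have : gradC (fun z => χ z - ρ z) z = gradC χ z - gradC ρ z := by
      simp only [gradC, fderiv_fun_sub (hd z) (hd' z)]
      apply Complex.ext <;> simp
    change _ = dbar (fun w => ((χ w - ρ w : ℝ) : ℂ)) z * φ z
    rw [← gradC_eq_dbar (hd.fun_sub hd'), this, sub_mul]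
  · rcases (tsupport_sub χ ρ) hz with h | h
    exacts [hsub h, hsub' h]
  · refine notMem_tsupport_iff_eventuallyEq.2 ?_ hz
    filter_upwards [eventually_nhdsSet_iff_forall.1 hev z hs,
      eventually_nhdsSet_iff_forall.1 hev' z hs] with w h1 h2
    simp [h1, h2]

lemma gradC_comp_I_mul {χ : ℂ → ℝ} (h : Differentiable ℝ χ) (z : ℂ) :
    gradC (fun w => χ (Complex.I * w)) z = -Complex.I * gradC χ (Complex.I * z) := by
  have h1 : HasFDerivAt (fun w : ℂ => Complex.I * w)
      (ContinuousLinearMap.mul ℝ ℂ Complex.I) z :=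
    (ContinuousLinearMap.mul ℝ ℂ Complex.I).hasFDerivAt
  have h2 := ((h (Complex.I * z)).hasFDerivAt.comp z h1).fderiv
  simp only [Function.comp_def] at h2
  simp only [gradC, h2, ContinuousLinearMap.comp_apply, ContinuousLinearMap.mul_apply', mul_one,
    Complex.I_mul_I, map_neg]
  apply Complex.ext <;> simp

lemma integral_comp_I_mul {E : Type*} [NormedAddCommGroup E] [NormedSpace ℝ E] (F : ℂ → E) :
    ∫ z, F (Complex.I * z) = ∫ z, F z := by
  set c : Circle := ⟨Complex.I, by simp [Submonoid.unitSphere]⟩ with hc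
  have h := (rotation c).measurePreserving.integral_comp
    (rotation c).toHomeomorph.measurableEmbedding F
  exact h

/-- A contour integral around `σ` as an area integral over a possibly different neighbourhood. -/
theorem IsPositiveBoundary.sum_integral_eq_gradC {D Ω U σ : Set ℂ} (hD : IsOpen D) (hΩ : IsOpen Ω)
    (hU : IsOpen U) {m : ℕ} {γ : Fin m → ℝ → ℂ} (h : IsPositiveBoundary D γ) (hDΩ : closure D ⊆ Ω)
    (hσ : IsCompact σ) (hσD : σ ⊆ D) {φ : ℂ → ℂ} (hφ : DifferentiableOn ℂ φ (Ω \ σ))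
    (hφU : DifferentiableOn ℂ φ (U \ σ)) {χ : ℂ → ℝ} (h1 : ContDiff ℝ 1 χ) (hc : HasCompactSupport χ)
    (hsub : tsupport χ ⊆ U) (hσU : σ ⊆ U) (hev : ∀ᶠ z in 𝓝ˢ σ, χ z = 1) :
    ∑ k, ∫ t in (0 : ℝ)..1, φ (γ k t) * deriv (γ k) t = -Complex.I * ∫ z, gradC χ z * φ z := by
  -- A cutoff supported in both D and U links the contour in D with the given cutoff in U, although
  -- φ is not assumed holomorphic on one common domain containing both.
  obtain ⟨ρ, h1', hc', hsub', hev'⟩ := exists_cutoff hσ (hD.inter hU) (subset_inter hσD hσU)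
  rw [h.sum_integral_eq hD hΩ hDΩ hσ.isClosed hσD hφ h1' hc' (hsub'.trans inter_subset_left) hev',
    integral_gradC_mul_eq hU hσ.isClosed h1 hc hsub hev h1' hc' (hsub'.trans inter_subset_right) hev'
      hφU]
  simp only [gradC_eq_dbar (h1'.differentiable one_ne_zero)]

end Scalar

/-! ### The complexification -/

section Complexification

variable {V X : Type*} [NormedAddCommGroup V] [NormedSpace ℝ V] [NormedAddCommGroup X]
  [NormedSpace ℂ X]

/-- The identification of `V₁` with the complexification `X`. -/
def complexify (j : V →L[ℝ] X) : Vn 1 V →L[ℝ] X :=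
  j ∘L PiLp.proj 2 (fun _ : Finset (Fin 1) => V) ∅
    + Complex.I • (j ∘L PiLp.proj 2 (fun _ : Finset (Fin 1) => V) {0})

lemma complexify_apply (j : V →L[ℝ] X) (v : Vn 1 V) :
    complexify j v = j (v ∅) + Complex.I • j (v {0}) := rfl

lemma opOf_apply_empty (S : Finset (Fin 1) → V →L[ℝ] V) (v : Vn 1 V) :
    opOf S v ∅ = S ∅ (v ∅) - S {0} (v {0}) := by
  have hu : (Finset.univ : Finset (Finset (Fin 1))) = {∅, {0}} := rfl
  have h1 : symmDiff ({0} : Finset (Fin 1)) ∅ = {0} := rfl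
  have h2 : symmDiff (∅ : Finset (Fin 1)) ∅ = ∅ := rfl
  rw [opOf_apply, hu, Finset.sum_pair (by decide), h1, h2]
  simp [sgn, sub_eq_add_neg]

lemma opOf_apply_singleton (S : Finset (Fin 1) → V →L[ℝ] V) (v : Vn 1 V) :
    opOf S v {0} = S ∅ (v {0}) + S {0} (v ∅) := by
  have hu : (Finset.univ : Finset (Finset (Fin 1))) = {∅, {0}} := rfl
  have h1 : symmDiff ({0} : Finset (Fin 1)) {0} = ∅ := rfl
  have h2 : symmDiff (∅ : Finset (Fin 1)) {0} = {0} := rfl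
  rw [opOf_apply, hu, Finset.sum_pair (by decide), h1, h2]
  simp [sgn]

lemma complexify_bijective {j : V →L[ℝ] X} (hj : IsComplexification j) :
    Function.Bijective (complexify j) := by
  let e : Vn 1 V ≃ V × V :=
    { toFun := fun v => (v ∅, v {0})
      invFun := fun p => WithLp.toLp 2 fun A => if A = ∅ then p.1 else p.2
      left_inv := fun v => by
        refine PiLp.ext fun A => ?_
        have : A = ∅ ∨ A = {0} := by revert A; decide
        rcases this with rfl | rfl <;> simp
      right_inv := fun p => by simp }
  exact hj.comp e.bijective

/-- The unit e_1 acts on X as multiplication by i, so T = T_1 e_1 becomes iA. -/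
lemma complexify_vecOp {j : V →L[ℝ] X} {A : X →L[ℂ] X} {T : Fin 1 → V →L[ℝ] V}
    (hA : ∀ v, A (j v) = j (T 0 v)) (v : Vn 1 V) :
    complexify j (vecOp T v) = Complex.I • A (complexify j v) := by
  have h0 : ((∅ : Finset (Fin 1)) = {0}) = False := by simp
  simp only [complexify_apply, vecOp, opOf_apply_empty, opOf_apply_singleton, map_add, map_smul, hA,
    Fin.sum_univ_one, Fin.isValue, h0, if_false, if_true, _root_.zero_apply, zero_sub,
    zero_add, map_neg, smul_add, smul_smul, Complex.I_mul_I, neg_smul, one_smul]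
  abel

lemma complexify_cplx (j : V →L[ℝ] X) (z : ℂ) (v : Vn 1 V) :
    complexify j (cplx (unitOp V (EuclideanSpace.single (0 : Fin 1) (1 : ℝ))) z v)
      = z • complexify j v := by
  have h0 : ∀ w : Vn 1 V, complexify j (unitOp V (EuclideanSpace.single (0 : Fin 1) (1 : ℝ)) w)
      = Complex.I • complexify j w := by
    intro w
    have hv : (Cl.vec (EuclideanSpace.single (0 : Fin 1) (1 : ℝ)) : Cl 1) = Cl.e 0 := by
      simp [Cl.vec]
    rw [unitOp, hv, leftMul, complexify_apply, complexify_apply, opOf_apply_empty,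
      opOf_apply_singleton]
    simp [Cl.e, Cl.basisElt, smul_smul]
    exact add_comm _ _
  rw [cplx, _root_.add_apply, _root_.smul_apply, _root_.smul_apply, map_add, map_smul, map_smul, h0]
  nth_rewrite 3 [← Complex.re_add_im z]
  rw [add_smul, mul_smul]
  rfl

end Complexification

/-! ### Comparison with the Riesz–Dunford calculus -/

section RieszDunford

variable {V X : Type*} [NormedAddCommGroup V] [NormedSpace ℝ V] [NormedAddCommGroup X]
  [NormedSpace ℂ X]

/-- With w = z̄ the pencil becomes (z̄ - iA)(z - iA); here the factorization holds because A is
complex-linear. -/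
lemma complexify_planarPencil {j : V →L[ℝ] X} {A : X →L[ℂ] X} {T : Fin 1 → V →L[ℝ] V}
    (hA : ∀ v, A (j v) = j (T 0 v)) (z w : ℂ) (hs : z + w = ((2 * z.re : ℝ) : ℂ))
    (hp : z * w = ((z.re ^ 2 + z.im ^ 2 : ℝ) : ℂ)) (v : Vn 1 V) :
    complexify j (planarPencil (vecOp T) z v)
      = w • (z • complexify j v - Complex.I • A (complexify j v))
        - Complex.I • A (z • complexify j v - Complex.I • A (complexify j v)) := by
  rw [planarPencil_eq, sq (vecOp T), _root_.add_apply, _root_.sub_apply, _root_.smul_apply,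
    _root_.smul_apply, one_apply_eq_self, mul_apply_eq_comp, map_add, map_sub, map_smul, map_smul,
    complexify_vecOp hA, complexify_vecOp hA, ← Complex.coe_smul, ← Complex.coe_smul, ← hs, ← hp]
  simp only [map_sub, map_smul]
  module

variable [CompleteSpace X]

/-- For z = iζ one factor of the pencil is z - iA = i(ζ - A). Cancelling the factor z̄ - iA in the
equation that defines S leaves S = (z - iA)⁻¹ = -i(ζ - A)⁻¹. -/
lemma complexify_planarResolvent {j : V →L[ℝ] X} (hj : IsComplexification j) {A : X →L[ℂ] X}
    {T : Fin 1 → V →L[ℝ] V} (hA : ∀ v, A (j v) = j (T 0 v)) {ζ : ℂ}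
    (hζ : Complex.I * ζ ∉ planarSpectrum (vecOp T)) : ζ ∉ spectrum ℂ A ∧ ∀ v,
      complexify j (planarResolvent (vecOp T)
          (unitOp V (EuclideanSpace.single (0 : Fin 1) (1 : ℝ))) (Complex.I * ζ) v)
        = -Complex.I • resolvent A ζ (complexify j v) := by
  set z := Complex.I * ζ with hz
  set w := (starRingEnd ℂ) z with hw
  have hΘ := complexify_bijective hj
  have hs : z + w = ((2 * z.re : ℝ) : ℂ) := by
    apply Complex.ext <;> simp [hw]; ring
  have hp : z * w = ((z.re ^ 2 + z.im ^ 2 : ℝ) : ℂ) := by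
    rw [hw, Complex.mul_conj, Complex.normSq_apply, sq, sq]
  set Q : X → X := fun x => z • x - Complex.I • A x with hQ
  set Q' : X → X := fun x => w • x - Complex.I • A x with hQ'
  set S : Vn 1 V →L[ℝ] Vn 1 V := planarPencil (vecOp T) z with hS
  have h1 : Q' ∘ Q ∘ complexify j = complexify j ∘ S := by
    funext v
    exact (complexify_planarPencil hA z w hs hp v).symm
  have hcomm : Q ∘ Q' = Q' ∘ Q := by
    funext x
    simp only [hQ, hQ', Function.comp_apply, map_sub, map_smul]
    module
  have hu : IsUnit S := not_not.1 hζ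
  have hpen : Function.Bijective S := by
    obtain ⟨u, hu⟩ := hu
    rw [← hu]
    refine ⟨Function.LeftInverse.injective (g := (↑u⁻¹ : Vn 1 V →L[ℝ] Vn 1 V)) fun v => ?_,
      Function.RightInverse.surjective (g := (↑u⁻¹ : Vn 1 V →L[ℝ] Vn 1 V)) fun v => ?_⟩
    · rw [← mul_apply_eq_comp, u.inv_mul, one_apply_eq_self]
    · rw [← mul_apply_eq_comp, u.mul_inv, one_apply_eq_self]
  have hQQ : Function.Bijective (Q' ∘ Q) := by
    rw [← Function.Bijective.of_comp_iff _ hΘ, Function.comp_assoc, h1]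
    exact hΘ.comp hpen
  -- The factors commute, so bijectivity of the product gives injectivity of Q from one order and
  -- surjectivity from the other.
  have hQbij : Function.Bijective Q :=
    ⟨hQQ.1.of_comp, (hcomm ▸ hQQ).2.of_comp⟩
  have hQinj' : Function.Injective Q' := (hcomm ▸ hQQ).1.of_comp
  set R : X →L[ℂ] X := algebraMap ℂ (X →L[ℂ] X) ζ - A with hR
  have hRQ : ∀ x, Q x = Complex.I • R x := by
    intro x
    simp only [hQ, hR, hz, _root_.sub_apply, smul_sub, mul_smul]
    rfl
  have hRbij : Function.Bijective R := by
    have : (R : X → X) = (fun x => -Complex.I • x) ∘ Q := by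
      funext x
      simp [hRQ, smul_smul]
    rw [this]
    exact ((MulAction.bijective (Units.mk0 (-Complex.I) (by simp)) : Function.Bijective
      fun x : X => Units.mk0 (-Complex.I) (by simp) • x)).comp hQbij
  have hRu : IsUnit R := ContinuousLinearMap.isUnit_iff_bijective.2 hRbij
  refine ⟨spectrum.notMem_iff.2 hRu, fun v => ?_⟩
  set y := planarResolvent (vecOp T) (unitOp V (EuclideanSpace.single (0 : Fin 1) (1 : ℝ))) z v with hy
  have h2 : S y
      = cplx (unitOp V (EuclideanSpace.single (0 : Fin 1) (1 : ℝ))) w v - vecOp T v := by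
    rw [hy, ← mul_apply_eq_comp, planarPencil_mul_resolvent _ _ hζ]
    rfl
  have h3 : Q' (Q (complexify j y)) = Q' (complexify j v) := by
    have := congrFun h1 y
    simp only [Function.comp_apply] at this
    rw [this, h2, map_sub, complexify_cplx, complexify_vecOp hA]
  have h4 := hQinj' h3
  rw [← h4, hRQ, map_smul, smul_smul, neg_mul, Complex.I_mul_I, neg_neg, one_smul, resolvent, ← hR,
    ← mul_apply_eq_comp, Ring.inverse_mul_cancel _ hRu, one_apply_eq_self]

lemma rotated_slicePt {n : ℕ} [NeZero n] (F : ℂ → ℂ) (z : ℂ)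
    (he : EuclideanSpace.single (0 : Fin n) (1 : ℝ) ∈ unitSphere n) :
    rotated F (slicePt (EuclideanSpace.single (0 : Fin n) (1 : ℝ)) z)
      = planeHom he (F (-Complex.I * z)) := by
  have h : (⟨slicePt (EuclideanSpace.single (0 : Fin n) (1 : ℝ)) z (Fin.succ 0),
      -slicePt (EuclideanSpace.single (0 : Fin n) (1 : ℝ)) z 0⟩ : ℂ) = -Complex.I * z := by
    rw [slicePt_succ, slicePt_zero]
    apply Complex.ext <;> simp
  rw [rotated, h, toCl_slicePt_eq_planeHom he]

/-- The plane embeds ℂ injectively in the Clifford algebra, so the s-monogenic equation in this one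
plane is the Cauchy–Riemann equation for F(-iz). -/
lemma differentiableAt_of_rotated {n : ℕ} [NeZero n] {F : ℂ → ℂ} {W : Set (Para n)}
    (hF : IsSMonogenicOn (rotated F) W)
    (he : EuclideanSpace.single (0 : Fin n) (1 : ℝ) ∈ unitSphere n) {ζ : ℂ}
    (hζ : Complex.I * ζ ∈ slice (EuclideanSpace.single (0 : Fin n) (1 : ℝ)) W) :
    DifferentiableAt ℂ F ζ := by
  set e := EuclideanSpace.single (0 : Fin n) (1 : ℝ) with hedef
  set H : ℂ → ℂ := fun w => F (-Complex.I * w) with hH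
  have hfe : (fun w => rotated F (slicePt e w)) = fun w => planeHom he (H w) :=
    funext fun w => rotated_slicePt F w he
  have hinj : Function.Injective (planeHom he) := (planeHom he).toRingHom.injective
  have hd := hF.differentiableAt_slice hζ
  rw [hfe] at hd
  obtain ⟨P, hP⟩ := LinearMap.exists_leftInverse_of_injective (planeHom he).toLinearMap
    (LinearMap.ker_eq_bot.2 hinj)
  have hHd : DifferentiableAt ℝ H (Complex.I * ζ) := by
    have h1 := (LinearMap.toContinuousLinearMap P).differentiableAt.comp _ hd
    refine h1.congr_of_eventuallyEq (Eventually.of_forall fun w => ?_)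
    exact (LinearMap.congr_fun hP (H w)).symm
  have hcr := hF.2.2 e he _ hζ
  have h3 : fderiv ℝ (fun w => planeHom he (H w)) (Complex.I * ζ)
      = (planeCLM he).comp (fderiv ℝ H (Complex.I * ζ)) :=
    ((planeCLM he).hasFDerivAt.comp _ hHd.hasFDerivAt).fderiv
  rw [hfe, h3, ← planeHom_I he] at hcr
  have hcr2 : planeHom he (fderiv ℝ H (Complex.I * ζ) 1
      + Complex.I * fderiv ℝ H (Complex.I * ζ) Complex.I) = 0 := by
    rw [map_add, map_mul]
    exact (smul_eq_zero.1 hcr).resolve_left (by norm_num)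
  have hcr3 := hinj (hcr2.trans (map_zero (planeHom he)).symm)
  have hHc : DifferentiableAt ℂ H (Complex.I * ζ) := by
    refine differentiableAt_complex_iff_differentiableAt_real.2 ⟨hHd, ?_⟩
    rw [smul_eq_mul]
    linear_combination -Complex.I * hcr3 + fderiv ℝ H (Complex.I * ζ) Complex.I * Complex.I_sq
  have h5 : DifferentiableAt ℂ (H ∘ fun w => Complex.I * w) ζ :=
    hHc.comp ζ (by fun_prop)
  refine h5.congr_of_eventuallyEq (Eventually.of_forall fun w => ?_)
  simp [hH, ← mul_assoc]

lemma intervalIntegrable_rieszDunford {A : X →L[ℂ] X} {F : ℂ → ℂ} {γ : ℝ → ℂ} {K : ℝ≥0}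
    (hγ : LipschitzOnWith K γ (Icc 0 1)) (hF : ContinuousOn F (γ '' Icc 0 1))
    (hA : ∀ z ∈ γ '' Icc 0 1, z ∉ spectrum ℂ A) :
    IntervalIntegrable (fun t => (F (γ t) * deriv γ t) • resolvent A (γ t)) volume 0 1 := by
  have hR : ContinuousOn (fun z => F z • resolvent A z) (γ '' Icc 0 1) :=
    hF.smul fun z hz => (spectrum.hasDerivAt_resolvent_const_left
      (spectrum.notMem_iff.1 (hA z hz))).continuousAt.continuousWithinAt
  have h1 := intervalIntegrable_smul_curve hγ hR (a := Complex.reCLM)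
  have h2 := intervalIntegrable_smul_curve hγ (hR.const_smul Complex.I) (a := Complex.imCLM)
  refine (h1.add h2).congr fun t _ => ?_
  simp only [Complex.reCLM_apply, Complex.imCLM_apply, Pi.smul_apply]
  rw [← Complex.coe_smul, ← Complex.coe_smul]
  conv_rhs => rw [← Complex.re_add_im (deriv γ t)]
  module

/-- Both sides are tested against a vector and a complex functional and become area integrals of the
same holomorphic function F(ζ) g((ζ - A)⁻¹ x): the right side by the contour formula, the left side
by the substitution z = iζ. -/
theorem complexify_sCalc [CompleteSpace V] {j : V →L[ℝ] X} (hj : IsComplexification j)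
    {A : X →L[ℂ] X} {T : Fin 1 → V →L[ℝ] V} (hA : ∀ v, A (j v) = j (T 0 v)) {F : ℂ → ℂ}
    (hF : LocallySMonogenic (vecOp T) (rotated F)) {m : ℕ} {γ : Fin m → ℝ → ℂ}
    (hγ : IsRieszDunfordContour A F γ) (v : Vn 1 V) :
    complexify j (sCalc (vecOp T) (rotated F) v) = rieszDunford A F γ (complexify j v) := by
  obtain ⟨W, hTW, hF⟩ := locallySMonogenic_iff.1 hF
  obtain ⟨D, Ω, hD, hΩ, hAD, hDΩ, hFΩ, hγ⟩ := hγ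
  set e := EuclideanSpace.single (0 : Fin 1) (1 : ℝ) with hedef
  have he : e ∈ unitSphere 1 := by simp [unitSphere, hedef]
  obtain ⟨χ, hχ⟩ := exists_isCutoff (isOpen_slice hF.1 e) (planarSpectrum_subset_slice hTW he)
  rw [SeparatingDual.eq_iff_forall_dual_eq (R := ℂ)]
  intro g
  set x := complexify j v with hx
  set φ : ℂ → ℂ := fun ζ => F ζ * g (resolvent A ζ x) with hφ
  have hres : ∀ ζ ∉ spectrum ℂ A, DifferentiableAt ℂ (fun ζ => g (resolvent A ζ x)) ζ := by
    intro ζ hζ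
    have h1 := (spectrum.hasDerivAt_resolvent_const_left
      (spectrum.notMem_iff.1 hζ)).differentiableAt
    exact g.differentiableAt.comp ζ (h1.clm_apply (differentiableAt_const x))
  have hspec : ∀ ζ ∈ spectrum ℂ A, Complex.I * ζ ∈ planarSpectrum (vecOp T) := by
    intro ζ hζ
    by_contra h
    exact (complexify_planarResolvent hj hA h).1 hζ
  -- Domain and cutoff of the S-calculus are carried to the ζ-plane by z = iζ, which maps the
  -- spectrum of A into the planar spectrum of T.
  set U : Set ℂ := (fun ζ => Complex.I * ζ) ⁻¹' slice e W with hU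
  set ρ : ℂ → ℝ := fun ζ => χ (Complex.I * ζ) with hρ
  set rot := Homeomorph.mulLeft₀ Complex.I Complex.I_ne_zero with hrot
  have hcontour := hγ.sum_integral_eq_gradC (U := U) (χ := ρ) hD hΩ
    ((isOpen_slice hF.1 e).preimage (by fun_prop)) hDΩ (spectrum.isCompact A) hAD (φ := φ)
    (fun ζ hζ => (((hFΩ ζ hζ.1).differentiableAt (hΩ.mem_nhds hζ.1)).mul
      (hres ζ hζ.2)).differentiableWithinAt)
    (fun ζ hζ => ((differentiableAt_of_rotated hF he hζ.1).mul (hres ζ hζ.2)).differentiableWithinAt)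
    (hχ.contDiff.comp (by fun_prop)) (hχ.compact.comp_homeomorph rot)
    (by
      rw [show ρ = χ ∘ rot from rfl, tsupport_comp_eq_preimage]
      exact preimage_mono hχ.subset)
    (fun ζ hζ => planarSpectrum_subset_slice hTW he (hspec ζ hζ))
    (eventually_nhdsSet_iff_forall.2 fun ζ hζ =>
      (rot.continuous.tendsto ζ).eventually (hχ.eventually _ (hspec ζ hζ)))
  have hR : g (rieszDunford A F γ x)
      = (2 * Real.pi * Complex.I : ℂ)⁻¹ * ∑ k, ∫ t in (0 : ℝ)..1, φ (γ k t) * deriv (γ k) t := by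
    set Λ : (X →L[ℂ] X) →L[ℂ] ℂ := g ∘L ContinuousLinearMap.apply ℂ X x with hΛ
    change Λ (rieszDunford A F γ) = _
    rw [rieszDunford, map_smul, map_sum, smul_eq_mul]
    congr 1
    refine Finset.sum_congr rfl fun k _ => ?_
    obtain ⟨K, hK⟩ := (hγ.1 k).1
    have hfr : ∀ z ∈ γ k '' Icc 0 1, z ∈ frontier D := by
      rintro _ ⟨t, ht, rfl⟩
      exact hγ.mem_frontier k ht
    rw [← Λ.intervalIntegral_comp_comm (intervalIntegrable_rieszDunford hK
      (hFΩ.continuousOn.mono fun z hz => hDΩ (frontier_subset_closure (hfr z hz)))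
      fun z hz hs => by
        have := hfr z hz
        rw [hD.frontier_eq] at this
        exact this.2 (hAD hs))]
    refine intervalIntegral.integral_congr fun t _ => ?_
    simp only [hΛ, hφ, map_smul, ContinuousLinearMap.comp_apply, ContinuousLinearMap.apply_apply,
      smul_eq_mul]
    ring
  have hL : g (complexify j (sCalc (vecOp T) (rotated F) v))
      = -((1 / (2 * Real.pi) : ℝ) • ∫ ζ, gradC ρ ζ * φ ζ) := by
    set Λ : (Vn 1 V →L[ℝ] Vn 1 V) →L[ℝ] ℂ :=
      (g.restrictScalars ℝ) ∘L complexify j ∘L ContinuousLinearMap.apply ℝ (Vn 1 V) v with hΛ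
    change Λ (sCalc (vecOp T) (rotated F)) = _
    -- The rotation by i preserves area. The factor -i of the resolvent is the one by which the
    -- gradient of the rotated cutoff differs from the gradient of χ.
    rw [sCalc_eq_areaCalc hTW hF he hχ, areaCalc, map_neg, map_smul,
      ← Λ.integral_comp_comm (hχ.integrable _ (LeftHolAt.continuousOn (hF.leftHolAt he))),
      ← integral_comp_I_mul]
    congr 2
    refine integral_congr_ae (Eventually.of_forall fun ζ => ?_)
    simp only
    rw [hρ, gradC_comp_I_mul (hχ.contDiff.differentiable one_ne_zero)]
    by_cases hζ : Complex.I * ζ ∈ tsupport (gradC χ)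
    · have h1 := (complexify_planarResolvent hj hA (hχ.notMem_spectrum hζ)).2
      have h2 : sliceFun V e (rotated F) (Complex.I * ζ) = cplx (unitOp V e) (F ζ) := by
        refine sliceFun_eq_cplx he ?_
        rw [rotated_slicePt F _ he, ← mul_assoc, neg_mul, Complex.I_mul_I, neg_neg, one_mul]
      change g (complexify j ((areaIntegrand (vecOp T) (unitOp V e) χ (sliceFun V e (rotated F))
        (Complex.I * ζ) : Vn 1 V →L[ℝ] Vn 1 V) v)) = _
      rw [areaIntegrand, h2, mul_apply_eq_comp, mul_apply_eq_comp, h1, complexify_cplx,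
        complexify_cplx, map_smul, map_smul, map_smul, map_smul, map_smul]
      simp only [smul_eq_mul, hφ]
      ring
    · rw [areaIntegrand_eq_zero hζ, image_eq_zero_of_notMem_tsupport hζ, map_zero, mul_zero, zero_mul]
  rw [hL, hR, hcontour, Complex.real_smul]
  push_cast
  have hpi : (Real.pi : ℂ) ≠ 0 := by exact_mod_cast Real.pi_ne_zero
  field_simp

end RieszDunford

end SliceCalc

end

open SliceCalc in
theorem mainTheorem1 {V : Type*} [NormedAddCommGroup V] [NormedSpace ℝ V] [CompleteSpace V]
    (n : ℕ) [NeZero n] (T : Fin n → V →L[ℝ] V) :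
    -- `f(T)` is well defined and belongs to `𝓑ₙ(Vₙ)`
    (∀ f : Para n → Cl n, LocallySMonogenic (vecOp T) f →
      sCalc (vecOp T) f ∈ Bn n V ∧
      ∀ (U : Set (Para n)) (I : EuclideanSpace ℝ (Fin n)) (m : ℕ) (γ : Fin m → ℝ → ℂ),
        IsContour (vecOp T) f U I γ →
          (∀ k, IntervalIntegrable (sIntegrand (vecOp T) f I (γ k)) MeasureTheory.volume 0 1) ∧
          sIntegral (vecOp T) f I γ = sCalc (vecOp T) f) ∧
    -- consistency with the Riesz–Dunford calculus for `n = 1`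
    (n = 1 → ∀ (X : Type*) [NormedAddCommGroup X] [NormedSpace ℂ X] [CompleteSpace X]
      (j : V →L[ℝ] X) (A : X →L[ℂ] X), IsComplexification j → (∀ v, A (j v) = j (T 0 v)) →
      ∀ F : ℂ → ℂ, LocallySMonogenic (vecOp T) (rotated F) →
      ∀ (m : ℕ) (γ : Fin m → ℝ → ℂ), IsRieszDunfordContour A F γ →
      ∀ v w : Vn n V, w = sCalc (vecOp T) (rotated F) v →
        j (w ∅) + Complex.I • j (w {0})
          = rieszDunford A F γ (j (v ∅) + Complex.I • j (v {0}))) ∧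
    -- right module homomorphism
    (∀ f g : Para n → Cl n, LocallySMonogenic (vecOp T) f → LocallySMonogenic (vecOp T) g →
      ∀ a b : Cl n,
        LocallySMonogenic (vecOp T) (fun x => f x * a + g x * b) ∧
        sCalc (vecOp T) (fun x => f x * a + g x * b)
          = sCalc (vecOp T) f * leftMul a + sCalc (vecOp T) g * leftMul b) ∧
    -- multiplicativity on power series with real coefficients
    (∀ (f g : Para n → Cl n) (a b : ℕ → ℝ) (W : Set (Para n)), IsOpen W →
      circ (sSpectrum (vecOp T)) ⊆ W →
      (∀ x ∈ W, HasSum (fun k => x.toCl ^ k * algebraMap ℝ (Cl n) (a k)) (f x)) →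
      (∀ x ∈ W, HasSum (fun k => x.toCl ^ k * algebraMap ℝ (Cl n) (b k)) (g x)) →
        LocallySMonogenic (vecOp T) f ∧ LocallySMonogenic (vecOp T) g ∧
        LocallySMonogenic (vecOp T) (fun x => f x * g x) ∧
        sCalc (vecOp T) (fun x => f x * g x) = sCalc (vecOp T) f * sCalc (vecOp T) g) ∧
    -- continuity in `(T, f)`
    (∀ (f : Para n → Cl n) (W : Set (Para n)), circ (sSpectrum (vecOp T)) ⊆ W →
      IsSMonogenicOn f W → ∀ ε > 0, ∃ δ > 0, ∃ K : Set (Para n), IsCompact K ∧ K ⊆ W ∧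
        ∀ T' : Fin n → V →L[ℝ] V, bnNorm (vecOp T' - vecOp T) < δ →
        circ (sSpectrum (vecOp T')) ⊆ W ∧
        ∀ g : Para n → Cl n, IsSMonogenicOn g W → (∀ x ∈ K, ‖g x - f x‖ < δ) →
          LocallySMonogenic (vecOp T') g ∧
          bnNorm (sCalc (vecOp T') g - sCalc (vecOp T) f) < ε) := by
  refine ⟨fun f hf => ⟨sCalc_mem_Bn ⟨_, rfl⟩ hf, fun U I m γ h =>
    ⟨h.sIntegral_eq.1, h.sIntegral_eq_sCalc⟩⟩, ?_, fun f g hf hg a b => sCalc_add_mul hf hg a b,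
    fun f g a b W hW hTW hf hg => sCalc_mul_of_hasSum hW hTW hf hg, ?_⟩
  · rintro rfl X _ _ _ j A hj hA F hF m γ hγ v w rfl
    exact complexify_sCalc hj hA hF hγ v
  · intro f W hW hf ε hε
    obtain ⟨δ, hδ, K, hK, hKW, h⟩ := exists_sCalc_near (T := vecOp T) ⟨_, rfl⟩ hW hf hε
    exact ⟨δ, hδ, K, hK, hKW, fun T' hT' => h (vecOp T') ⟨_, rfl⟩ hT'⟩
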